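/- **Setting.** Let $1\le k\le n$ and $0\le l\le k$, let $\omega_1,\dots,\omega_k\in\mathbb R^n$ be linearly independent, $\Omega=\mathbb Z\omega_1+\dots+\mathbb Z\omega_k$, $C_k=\mathbb R^n/\Omega$ with projection $p(x)=x'$, and for $\omega=\sum m_i\omega_i\in\Omega$ put $\chi(\omega)=(-1)^{m_1+\dots+m_l}$. Let $Cl_n$ be the real Clifford algebra with $e_ie_j+e_je_i=-2\delta_{ij}$ and $D=\sum_i e_i\,\partial/\partial x_i$. A cylindrical/toroidal left monogenic (harmonic) function on an open set $U'\subseteq C_k$, i.e. a section of the spinor bundle $E^{(l)}$ obtained from $\mathbb R^n\times Cl_n$ by identifying $(x,X)$ with $(x+\omega,\chi(\omega)X)$, is given by its lift $f:p^{-1}(U')\to Cl_n$ with $f(x+\omega)=\chi(\omega)f(x)$, where $f$ is real differentiable with $Df=0$ (resp. $f$ is $C^2$ with $\Delta f=0$). Let $j=1$ in the monogenic case, where $n\ge 2$ is assumed, and $j=2$ in the harmonic case, where $n\ge 3$ is assumed. Put $K(x)=G(x)=x/\|x\|^n$ if $j=1$ and $K(x)=H(x)=1/\|x\|^{n-2}$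 if $j=2$. **The functions $\epsilon_{j,k,l,\mathbf m}$, $\mathbf m\in\mathbb N_0^n$.** Unless $k=n$ and $l=0$, let $\epsilon_{j,k,l,\mathbf m}=\partial^{\mathbf m}\cot_{j,k,l}$, where $\cot_{j,k,l}$ is the regularized lattice sum of $\chi(\omega)K(x+\omega)$, namely: * $\sum_{\omega\in\Omega}\chi(\omega)K(x+\omega)$ if $k<n-j$; * $K(x)+\frac12\sum_{\omega\in\Omega\setminus\{0\}}\chi(\omega)\,[K(x+\omega)+K(x-\omega)-K(\omega)-K(-\omega)]$ if $j=1$, $k=n-1$, or if $j=2$, $l=0$, $k\in\{n-2,n-1\}$; * if $j=1$, $l\ge1$, $k=n$, or if $j=2$, $l\ge 1$, $k\ge n-2$: the absolutely convergent series obtained from $\sum_\omega\chi(\omega)K(x+\omega)$ by carrying out twice the regrouping $u(\omega)\mapsto\frac14u(\omega-\omega_1)+\frac12u(\omega)+\frac14u(\omega+\omega_1)$ of its terms $u(\omega)=\chi(\omega)K(x+\omega)$. If $k=n$ and $l=0$, let $W(x)=K(x)+\sum_{\omega\in\Omega\setminus\{0\}}[K(x+\omega)-T_\omega(x)]$, where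 $T_\omega(x)$ is the second Taylor polynomial of $y\mapsto K(\omega+y)$ at $0$, evaluated at $y=x$. For $\mathbf m\ne0$ let $$\epsilon_{j,n,0,\mathbf m}(x)=\partial^{\mathbf m}W(x)-\sum_{i=1}^n t_i(x)\,[\partial^{\mathbf m}W(\tfrac{\omega_i}2)-\partial^{\mathbf m}W(-\tfrac{\omega_i}2)],\qquad x=\sum_i t_i(x)\,\omega_i .$$ For $\mathbf m=0$ one takes further poles: $\epsilon_{1,n,0,0}(x)=W(x)-W(x-b)$ with an arbitrary $b\notin\Omega$, and $\epsilon_{2,n,0,0}(x)=W(x)+W(x-b_2)-W(x-b_3)-W(x-b_4)$ with arbitrary $b_2,b_3,b_4$ such that $0,b_2,b_3,b_4$ are mutually incongruent modulo $\Omega$ and $b_2=b_3+b_4$. **Theorem (Laurent expansion).** Let $a'=p(a)\in C_k$. (i) Let $U'\subseteq C_k$ be an open neighbourhood of $a'$, and let $f'$ be a cylindrical/toroidal left monogenic (harmonic) function with values in $E^{(l)}$ on $U'\setminus\{a'\}$. Then there are coefficients $c_{\mathbf m}\in Cl_n$, an open neighbourhood $N'$ of $0$ in $C_k$ with $a'+N'\subseteq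 U'$, and a cylindrical/toroidal left monogenic (harmonic) function $\phi'$ on $N'$ with values in $E^{(l)}$, such that $\lim_{x'\to a'}\phi'(x'-a')=\phi'(0)$ and $$f'(x')=\sum_{|\mathbf m|\ge0}\epsilon'_{j,k,l,\mathbf m}(x'-a')\,c_{\mathbf m}+\phi'(x'-a')\qquad(x'-a'\in N'\setminus\{0\}),$$ the series over all $\mathbf m\in\mathbb N_0^n$ converging unconditionally and locally uniformly there. (The formula and the limit are understood for the lifts, with $x-a$ in place of $x'-a'$.) (ii) If $f'$ is left monogenic (harmonic) on all of $C_k\setminus\{a'\}$, then such a representation holds globally: there are coefficients $c_{\mathbf m}\in Cl_n$ and a left monogenic (harmonic) $\phi'$ on the whole of $C_k$ with values in $E^{(l)}$ such that $\lim_{x'\to a'}\phi'(x'-a')=\phi'(0)$ and the formula holds, with the same kind of convergence, for all $x'\in C_k\setminus\{a'\}$. -/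

import Mathlib

open scoped Topology

namespace CliffordCylinder

noncomputable section

/-! ### The real Clifford algebra `Cl_n` -/

/-- Euclidean space `ℝⁿ`. -/
abbrev V (n : ℕ) : Type := EuclideanSpace ℝ (Fin n)

/-- The quadratic form `x ↦ -‖x‖²` on `ℝⁿ`. -/
def Q (n : ℕ) : QuadraticForm ℝ (V n) := -LinearMap.BilinMap.toQuadraticMap (innerₗ (V n))

/-- The real Clifford algebra of `ℝⁿ` with `e_i e_j + e_j e_i = -2 δ_{ij}`. -/
abbrev Cl (n : ℕ) : Type := CliffordAlgebra (Q n)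

/-- The standard basis vector `e_i` of `ℝⁿ`. -/
abbrev stdVec {n : ℕ} (i : Fin n) : V n := EuclideanSpace.single i 1

/-- The embedding of `ℝⁿ` into `Cl_n`. -/
abbrev vec {n : ℕ} (x : V n) : Cl n := CliffordAlgebra.ι (Q n) x

/-- The generator `e_i` of `Cl_n`. -/
abbrev e {n : ℕ} (i : Fin n) : Cl n := vec (stdVec i)

lemma Q_apply {n : ℕ} (x : V n) : Q n x = -‖x‖ ^ 2 := by
  simp [Q]

lemma e_mul_self {n : ℕ} (i : Fin n) : (e i * e i : Cl n) = -1 := by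
  rw [e, vec, CliffordAlgebra.ι_sq_scalar, Q_apply]
  simp

lemma e_mul_swap {n : ℕ} {i j : Fin n} (h : i ≠ j) : (e i * e j : Cl n) = -(e j * e i) := by
  have h1 := CliffordAlgebra.ι_mul_ι_add_swap (Q := Q n) (stdVec i) (stdVec j)
  have h2 : QuadraticMap.polar (Q n) (stdVec i) (stdVec j) = 0 := by
    have h3 : inner ℝ (stdVec i : V n) (stdVec j) = 0 := by
      simp [stdVec, EuclideanSpace.inner_single_left, h]
    simp only [QuadraticMap.polar, Q_apply]
    rw [@norm_add_sq_real, h3]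
    ring
  rw [h2, map_zero] at h1
  exact eq_neg_of_add_eq_zero_left h1

/-- The span of the products `e_{i_1} ⋯ e_{i_r}` with `j > i_1 > ⋯ > i_r`. -/
def partialSpan (n : ℕ) : ℕ → Submodule ℝ (Cl n)
  | 0 => Submodule.span ℝ {1}
  | j + 1 => if h : j < n then
      partialSpan n j ⊔ (partialSpan n j).map (LinearMap.mulLeft ℝ (e ⟨j, h⟩))
    else partialSpan n j

lemma partialSpan_fg (n j : ℕ) : (partialSpan n j).FG := by
  induction j with
  | zero => exact Submodule.fg_span_singleton 1
  | succ j ih =>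
    rw [partialSpan]
    split_ifs with h
    · exact ih.sup (ih.map _)
    · exact ih

lemma e_mul_mem_partialSpan {n : ℕ} (i : Fin n) (j : ℕ) (hij : (i : ℕ) < j) (x : Cl n)
    (hx : x ∈ partialSpan n j) : e i * x ∈ partialSpan n j := by
  induction j generalizing x with
  | zero => omega
  | succ j ih =>
    rw [partialSpan] at hx ⊢
    split_ifs at hx ⊢ with h
    · obtain ⟨y, hy, z, hz, rfl⟩ := Submodule.mem_sup.1 hx
      obtain ⟨w, hw, rfl⟩ := Submodule.mem_map.1 hz
      rw [mul_add, LinearMap.mulLeft_apply, ← mul_assoc]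
      by_cases hi : (i : ℕ) = j
      · obtain rfl : i = ⟨j, h⟩ := Fin.ext hi
        rw [e_mul_self, neg_one_mul, add_comm]
        exact Submodule.add_mem_sup (neg_mem hw) (Submodule.mem_map_of_mem hy)
      · have hlt : (i : ℕ) < j := by omega
        have hne : i ≠ ⟨j, h⟩ := fun h' => hi (by rw [h'])
        rw [e_mul_swap hne, neg_mul, mul_assoc]
        exact Submodule.add_mem_sup (ih hlt y hy)
          (neg_mem (Submodule.mem_map_of_mem (f := LinearMap.mulLeft ℝ (e ⟨j, h⟩)) (ih hlt w hw)))
    · exact ih (by omega) x hx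

lemma one_mem_partialSpan (n j : ℕ) : (1 : Cl n) ∈ partialSpan n j := by
  induction j with
  | zero => exact Submodule.mem_span_singleton_self 1
  | succ j ih =>
    rw [partialSpan]
    split_ifs
    · exact Submodule.mem_sup_left ih
    · exact ih

instance instFiniteCl (n : ℕ) : Module.Finite ℝ (Cl n) := by
  refine ⟨?_⟩
  have htop : partialSpan n n = ⊤ := by
    refine Submodule.eq_top_iff'.2 fun x => ?_
    induction x using CliffordAlgebra.left_induction with
    | algebraMap r =>
      rw [Algebra.algebraMap_eq_smul_one]
      exact Submodule.smul_mem _ _ (one_mem_partialSpan n n)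
    | add x y hx hy => exact add_mem hx hy
    | ι_mul x m hx =>
      have hm : CliffordAlgebra.ι (Q n) m = ∑ i, m i • (e i : Cl n) := by
        conv_lhs => rw [← (EuclideanSpace.basisFun (Fin n) ℝ).sum_repr m]
        simp [e, vec, stdVec]
      rw [hm, Finset.sum_mul]
      refine Submodule.sum_mem _ fun i _ => ?_
      rw [smul_mul_assoc]
      exact Submodule.smul_mem _ _ (e_mul_mem_partialSpan i n i.2 x hx)
  rw [← htop]
  exact partialSpan_fg n n

/-- Linear coordinates on the finite-dimensional real vector space `Cl_n`. -/
def coords (n : ℕ) : Cl n ≃ₗ[ℝ] (Fin (Module.finrank ℝ (Cl n)) → ℝ) :=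
  (Module.finBasis ℝ (Cl n)).equivFun

/-- `Cl_n` carries its topology of a finite-dimensional real vector space, given by a norm (all
norms are equivalent, and nothing below depends on which one is taken). -/
instance instNormedAddCommGroupCl (n : ℕ) : NormedAddCommGroup (Cl n) :=
  NormedAddCommGroup.induced (Cl n) (Fin (Module.finrank ℝ (Cl n)) → ℝ) (coords n)
    (coords n).injective

instance instNormedSpaceCl (n : ℕ) : NormedSpace ℝ (Cl n) :=
  NormedSpace.induced ℝ (Cl n) (Fin (Module.finrank ℝ (Cl n)) → ℝ) (coords n)

/-! ### Differential operators, monogenic functions, fundamental solutions -/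

/-- The partial derivative `∂f/∂x_i`. -/
def partialDeriv {n : ℕ} (i : Fin n) (f : V n → Cl n) : V n → Cl n :=
  fun x => fderiv ℝ f x (stdVec i)

/-- The iterated partial derivative `∂^{m_1+⋯+m_n} f / ∂x_1^{m_1} ⋯ ∂x_n^{m_n}`. -/
def multiDeriv {n : ℕ} (m : Fin n → ℕ) (f : V n → Cl n) : V n → Cl n :=
  (List.finRange n).foldr (fun i g => (partialDeriv i)^[m i] g) f

/-- The Euclidean Dirac operator `D = ∑ e_i ∂/∂x_i` acting from the left. -/
def dirac {n : ℕ} (f : V n → Cl n) (x : V n) : Cl n :=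
  ∑ i, e i * partialDeriv i f x

/-- `f` is left monogenic on the (open) set `S`: real differentiable with `D f = 0`. -/
def LeftMonogenicOn {n : ℕ} (f : V n → Cl n) (S : Set (V n)) : Prop :=
  ∀ x ∈ S, DifferentiableAt ℝ f x ∧ dirac f x = 0

/-- The Euclidean Cauchy kernel `G(x) = x / ‖x‖ⁿ`. -/
def G {n : ℕ} (x : V n) : Cl n := (‖x‖ ^ n)⁻¹ • vec x

/-- The Green kernel `H(x) = 1 / ‖x‖ⁿ⁻²` (used for `n ≥ 3` only). -/
def H {n : ℕ} (x : V n) : Cl n := algebraMap ℝ (Cl n) (‖x‖ ^ (n - 2))⁻¹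

/-! ### Cylinders, tori and their spinor bundles

Throughout, `ω_1, …, ω_k` (indexed by `Fin k`) are vectors of `ℝⁿ`. -/

/-- The lattice `ℤ ω_1 + ⋯ + ℤ ω_k`. -/
def lattice {n k : ℕ} (ω : Fin k → V n) : AddSubgroup (V n) :=
  AddSubgroup.closure (Set.range ω)

/-- The lattice point `m_1 ω_1 + ⋯ + m_k ω_k`. -/
def latPt {n k : ℕ} (ω : Fin k → V n) (m : Fin k → ℤ) : V n := ∑ i, m i • ω i

/-- The conformally flat cylinder (torus, if `k = n`) `C_k = ℝⁿ / (ℤ ω_1 + ⋯ + ℤ ω_k)`. -/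
abbrev Cylinder {n k : ℕ} (ω : Fin k → V n) : Type := V n ⧸ lattice ω

/-- The projection `p : ℝⁿ → C_k`. -/
abbrev proj {n k : ℕ} (ω : Fin k → V n) (x : V n) : Cylinder ω := QuotientAddGroup.mk x

/-- The sign `(-1)^{m_1+⋯+m_l}`. -/
def sgn {k : ℕ} (l : ℕ) (m : Fin k → ℤ) : ℝ :=
  (-1) ^ (∑ i ∈ Finset.univ.filter (fun i : Fin k => (i : ℕ) < l), m i)

/-- `f` represents a section over `U' ⊆ C_k` of the spinor bundle `E^{(l)}`, the quotient of
`ℝⁿ × Cl_n` by `(x, X) ∼ (x + m_1 ω_1 + ⋯ + m_k ω_k, (-1)^{m_1+⋯+m_l} X)`. Sections are identified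
with their lifts to `p⁻¹(U')`; values of `f` outside `p⁻¹(U')` are irrelevant. -/
def IsSection {n k : ℕ} (ω : Fin k → V n) (l : ℕ) (U' : Set (Cylinder ω)) (f : V n → Cl n) : Prop :=
  ∀ x, proj ω x ∈ U' → ∀ m : Fin k → ℤ, f (x + latPt ω m) = sgn l m • f x

/-- Cylindrical/toroidal left monogenic functions on `U' ⊆ C_k` with values in `E^{(l)}`. -/
def IsMonogenicSection {n k : ℕ} (ω : Fin k → V n) (l : ℕ) (U' : Set (Cylinder ω))
    (f : V n → Cl n) : Prop :=
  IsSection ω l U' f ∧ LeftMonogenicOn f (proj ω ⁻¹' U')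

/-- Cylindrical/toroidal harmonic functions on `U' ⊆ C_k` with values in `E^{(l)}`. -/
def IsHarmonicSection {n k : ℕ} (ω : Fin k → V n) (l : ℕ) (U' : Set (Cylinder ω))
    (f : V n → Cl n) : Prop :=
  IsSection ω l U' f ∧ InnerProductSpace.HarmonicOnNhd f (proj ω ⁻¹' U')

/-! ### Lattice sums

All infinite sums below are used only where they converge absolutely. -/

/-- The plain series `∑_ω ± K(x + ω)`. -/
def directSum {n k : ℕ} (K : V n → Cl n) (ω : Fin k → V n) (l : ℕ) (x : V n) : Cl n :=
  ∑' m : Fin k → ℤ, sgn l m • K (x + latPt ω m)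

/-- The series with antipodal lattice points coupled and constants subtracted, that is
`K(x) + ∑_{ω > 0} ± [K(x+ω) + K(x-ω) - K(ω) - K(-ω)]`, the sum extending over one of each pair `±ω`
of nonzero lattice points. (It is written as half of the sum over all lattice points. For the odd
function `G` the constants cancel.) -/
def coupledSum {n k : ℕ} (K : V n → Cl n) (ω : Fin k → V n) (l : ℕ) (x : V n) : Cl n :=
  ∑' m : Fin k → ℤ, if m = 0 then K x else
    ((1 / 2 : ℝ) * sgn l m) • (K (x + latPt ω m) + K (x - latPt ω m)
      - K (latPt ω m) - K (-latPt ω m))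

/-- The multi-index of `ω_1`. -/
def firstIdx {k : ℕ} : Fin k → ℤ := fun i => if (i : ℕ) = 0 then 1 else 0

/-- Regrouping a series over `ℤᵏ`: every term is distributed with the weights `1/4, 1/2, 1/4` on
three neighbouring places in the direction of `ω_1`. -/
def regroup {k : ℕ} {E : Type*} [AddCommGroup E] [Module ℝ E] (u : (Fin k → ℤ) → E) :
    (Fin k → ℤ) → E :=
  fun m => (1 / 4 : ℝ) • u (m - firstIdx) + (1 / 2 : ℝ) • u m + (1 / 4 : ℝ) • u (m + firstIdx)

/-- The series `∑_ω ± K(x + ω)` regrouped twice. If `l ≥ 1`, neighbouring terms in the direction of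
`ω_1` have opposite signs, and the regrouped series converges absolutely also where the plain one
does not. (Where the plain series converges absolutely, the two have the same sum.) -/
def regroupedSum {n k : ℕ} (K : V n → Cl n) (ω : Fin k → V n) (l : ℕ) (x : V n) : Cl n :=
  ∑' m : Fin k → ℤ, regroup (regroup fun m' => sgn l m' • K (x + latPt ω m')) m

/-- The second Taylor polynomial of `K` at `y`, evaluated at `y + x`. -/
def taylor2 {n : ℕ} (K : V n → Cl n) (y x : V n) : Cl n :=
  K y + fderiv ℝ K y x + (1 / 2 : ℝ) • fderiv ℝ (fun z => fderiv ℝ K z x) y x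

/-- The Weierstrass type series `K(x) + ∑_{ω ≠ 0} [K(x+ω) - T_ω(x)]` over the lattice, with `T_ω` the
second Taylor polynomial of `K` at `ω`. -/
def weierstrassSum {n k : ℕ} (K : V n → Cl n) (ω : Fin k → V n) (x : V n) : Cl n :=
  ∑' m : Fin k → ℤ, if m = 0 then K x else K (x + latPt ω m) - taylor2 K (latPt ω m) x

/-- Coordinates with respect to `ω_1, …, ω_k`, used for `k = n`: `x = ∑ t_j(x) ω_j`. -/
def latCoord {n k : ℕ} (ω : Fin k → V n) : V n →ₗ[ℝ] (Fin k → ℝ) :=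
  (Fintype.linearCombination ℝ ω).leftInverse

/-- For a function `F` on `ℝⁿ`, `n = k`, whose increments under the `ω_j` are constants, the periodic
function obtained by subtracting the linear function with the same increments. -/
def removePeriods {n k : ℕ} (ω : Fin k → V n) (F : V n → Cl n) (x : V n) : Cl n :=
  F x - ∑ j, latCoord ω x j • (F ((1 / 2 : ℝ) • ω j) - F (-((1 / 2 : ℝ) • ω j)))

/-! ### The functions `cot` and their derivatives `ε` -/

/-- The generalized monogenic cotangent `cot_{1,k,l}`, not for the torus with trivial bundle
(`k = n`, `l = 0`). -/
def cotMono {n k : ℕ} (ω : Fin k → V n) (l : ℕ) : V n → Cl n :=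
  if k + 1 < n then directSum G ω l
  else if k + 1 = n then coupledSum G ω l
  else regroupedSum G ω l

/-- The generalized harmonic cotangent `cot_{2,k,l}`, not for the torus with trivial bundle
(`k = n`, `l = 0`). -/
def cotHarm {n k : ℕ} (ω : Fin k → V n) (l : ℕ) : V n → Cl n :=
  if k + 2 < n then directSum H ω l
  else if l = 0 then coupledSum H ω l
  else regroupedSum H ω l

/-- The functions `ε_{1,k,l,𝐦}`, with a pole at the lattice points. On the torus with trivial bundle
(`k = n`, `l = 0`) there is no monogenic function with one pole of lowest order per period cell, and
`ε_{1,n,0,0}` has a second pole at `b`. -/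
def epsMono {n k : ℕ} (ω : Fin k → V n) (l : ℕ) (b : V n) (m : Fin n → ℕ) : V n → Cl n :=
  if k = n ∧ l = 0 then
    if m = 0 then fun x => weierstrassSum G ω x - weierstrassSum G ω (x - b)
    else removePeriods ω (multiDeriv m (weierstrassSum G ω))
  else multiDeriv m (cotMono ω l)

/-- The functions `ε_{2,k,l,𝐦}`, with a pole at the lattice points. On the torus with trivial bundle
(`k = n`, `l = 0`), `ε_{2,n,0,0}` has further poles at `b₂, b₃, b₄`. -/
def epsHarm {n k : ℕ} (ω : Fin k → V n) (l : ℕ) (b₂ b₃ b₄ : V n) (m : Fin n → ℕ) : V n → Cl n :=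
  if k = n ∧ l = 0 then
    if m = 0 then fun x => weierstrassSum H ω x + weierstrassSum H ω (x - b₂)
      - weierstrassSum H ω (x - b₃) - weierstrassSum H ω (x - b₄)
    else removePeriods ω (multiDeriv m (weierstrassSum H ω))
  else multiDeriv m (cotHarm ω l)

/-- The auxiliary poles `b₂, b₃, b₄` of `ε_{2,n,0,0}` are adequately chosen: `0, b₂, b₃, b₄` are
mutually incongruent modulo the lattice, and `0 + b₂ = b₃ + b₄`. -/
def Adequate {n k : ℕ} (ω : Fin k → V n) (b₂ b₃ b₄ : V n) : Prop :=
  (b₂ ∉ lattice ω ∧ b₃ ∉ lattice ω ∧ b₄ ∉ lattice ω) ∧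
  (b₂ - b₃ ∉ lattice ω ∧ b₂ - b₄ ∉ lattice ω ∧ b₃ - b₄ ∉ lattice ω) ∧ b₂ = b₃ + b₄

/-- On the set `S`: `f(x) = ∑_𝐦 ε_𝐦(x - a) c_𝐦 + φ(x - a)`, the series over all multi-indices `𝐦`
with coefficients `c_𝐦 ∈ Cl_n` converging unconditionally and locally uniformly on `S`. -/
def LaurentOn {n : ℕ} (ε : (Fin n → ℕ) → V n → Cl n) (a : V n) (c : (Fin n → ℕ) → Cl n)
    (φ f : V n → Cl n) (S : Set (V n)) : Prop :=
  HasSumLocallyUniformlyOn (fun m x => ε m (x - a) * c m) (fun x => f x - φ (x - a)) S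

end

end CliffordCylinder

-- Both cases are instances of one argument, for a homogeneous operator `Λ` of order `j` with
-- constant coefficients that commutes with right multiplications (`DiffOp`) and has a fundamental
-- solution `K`, homogeneous of degree `-N` with `N + j = n` (`FundSol`). Null solutions are carried
-- along with bounds `s * A ^ k * k!` on their derivatives (`Tame`), a quantitative analyticity that
-- survives differentiation, summation and parameter integrals.
--
-- Local expansion. Let `f` be a null solution in a punctured ball. Cutting it off near the centre,
-- at a radius `r_p` tending to zero with `p`, and near the boundary, the representation formula
-- writes `f` as the sum of two potentials. The one with density on an outer shell is regular at the
-- centre. In the one with density in the ball of radius `r_p`, the Taylor expansion of `K (x - y)`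
-- in `y` gives derivatives of `K` times moments. By homogeneity and uniqueness of power series the
-- terms of each order do not depend on `p`, so the expansion holds throughout the punctured ball of
-- half the radius. The moments themselves do depend on `p`, since the derivatives of `K` are
-- linearly dependent. Letting `p` grow slowly with the order yields coefficients bounded by `C * r
-- ^ |m| / |m|!` for every `r > 0` (`FundSol.exists_norm_laurentCoeff_le`). With such coefficients
-- the series of all `∂^m w * c_m` converges absolutely wherever `w` is tame
-- (`exists_tame_multiDeriv_mul`).
--
-- Passage to the quotient. Each `ε_m` is quasi-periodic, differs from `∂^m K` near `0` by a regular
-- function, and for all but finitely many `m` is `∂^m` of one fixed function (`EpsFamily`). Hence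
-- `f` minus the sum of the `ε_m c_m` has a removable singularity at `0`, thus at every lattice
-- point, and its extension is `φ` (`EpsFamily.exists_laurent`).
--
-- Quasi-periodicity of the `ε_m`. In the plain, coupled and Weierstrass sums, null polynomials
-- approximating `K (x + ω)` are subtracted from the terms. Under a translation by `ω_i` the kernels
-- telescope to zero, and what remains are increments of the subtracted polynomials, which cancel
-- between `ω` and `-ω` if they are odd in `ω` (`SubPoly.sum_increments_eq_zero`). In the regrouped
-- sums alternating signs produce fourth differences, the convergence is absolute, and a translation
-- is a reindexing. On the torus with trivial bundle the increments of the Weierstrass sum are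
-- constant (first order) or affine (second order).
--
-- Further poles. On that torus `ε_0` has additional poles. Locally they are avoided by shrinking
-- the neighbourhood. Globally `c_0 = 0`: this coefficient is an integral of `Λ` over a period cell,
-- and the fluxes through opposite faces cancel (`laurentCoeff_zero_eq_zero`).
--
-- The representation formulas come from integration by parts against kernels with `‖x‖ ^ 2`
-- replaced by `c + ‖x‖ ^ 2`, letting `c` tend to zero. They also show that differentiable monogenic
-- and `C²` harmonic functions are tame.

open scoped Topology
namespace CliffordCylinder
open scoped ContDiff Nat
open Metric

/-! ### Smooth functions with factorial bounds on their derivatives -/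

section DerivBound

variable {X E F : Type*} [NormedAddCommGroup X] [NormedSpace ℝ X]
  [NormedAddCommGroup E] [NormedSpace ℝ E] [NormedAddCommGroup F] [NormedSpace ℝ F]

/-- `f` is smooth on `U` and its `k`-th derivative is bounded by `s * A ^ k * k!` there. -/
def DerivBound (U : Set X) (f : X → E) (s A : ℝ) : Prop :=
  ∀ x ∈ U, ContDiffAt ℝ ∞ f x ∧ ∀ k : ℕ, ‖iteratedFDeriv ℝ k f x‖ ≤ s * A ^ k * (k ! : ℝ)

lemma DerivBound.nonneg {U : Set X} {f : X → E} {s A : ℝ} (h : DerivBound U f s A)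
    (hU : U.Nonempty) : 0 ≤ s := by
  obtain ⟨x, hx⟩ := hU
  simpa using (norm_nonneg _).trans ((h x hx).2 0)

lemma DerivBound.norm_le {U : Set X} {f : X → E} {s A : ℝ} (h : DerivBound U f s A) {x : X}
    (hx : x ∈ U) : ‖f x‖ ≤ s := by
  simpa using (h x hx).2 0

lemma DerivBound.mono {U U' : Set X} {f : X → E} {s s' A A' : ℝ} (h : DerivBound U f s A)
    (hU : U' ⊆ U) (hs : s ≤ s') (hA : 0 ≤ A) (hA' : A ≤ A') : DerivBound U' f s' A' := by
  intro x hx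
  have h0 := h.nonneg ⟨x, hU hx⟩
  refine ⟨(h x (hU hx)).1, fun k => ((h x (hU hx)).2 k).trans ?_⟩
  have := h0.trans hs
  gcongr

lemma DerivBound.congr {U : Set X} (hU : IsOpen U) {f g : X → E} {s A : ℝ}
    (h : DerivBound U f s A) (hfg : Set.EqOn g f U) : DerivBound U g s A := by
  intro x hx
  have he : g =ᶠ[𝓝 x] f := Filter.eventuallyEq_of_mem (hU.mem_nhds hx) hfg
  refine ⟨(h x hx).1.congr_of_eventuallyEq he, fun k => ?_⟩
  rw [(he.iteratedFDeriv ℝ k).eq_of_nhds]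
  exact (h x hx).2 k

lemma DerivBound.add {U : Set X} {f g : X → E} {s t A : ℝ}
    (hf : DerivBound U f s A) (hg : DerivBound U g t A) :
    DerivBound U (fun x => f x + g x) (s + t) A := by
  intro x hx
  refine ⟨(hf x hx).1.add (hg x hx).1, fun k => ?_⟩
  rw [fun_iteratedFDeriv_add_apply ((hf x hx).1.of_le (by exact_mod_cast le_top))
    ((hg x hx).1.of_le (by exact_mod_cast le_top))]
  refine (norm_add_le _ _).trans ?_
  have h1 := (hf x hx).2 k
  have h2 := (hg x hx).2 k
  linarith [add_mul (s * A ^ k) (t * A ^ k) (k ! : ℝ), add_mul s t (A ^ k)]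

lemma DerivBound.clm_comp {U : Set X} {f : X → E} {s A : ℝ}
    (hf : DerivBound U f s A) (L : E →L[ℝ] F) :
    DerivBound U (fun x => L (f x)) (‖L‖ * s) A := by
  intro x hx
  refine ⟨L.contDiff.contDiffAt.comp x (hf x hx).1, fun k => ?_⟩
  refine (L.norm_iteratedFDeriv_comp_left (f := f) (n := k) (hf x hx).1
    (by exact_mod_cast le_top)).trans ?_
  have h1 := (hf x hx).2 k
  calc _ ≤ ‖L‖ * (s * A ^ k * (k ! : ℝ)) := by gcongr
    _ = _ := by ring

lemma DerivBound.const_smul {U : Set X} {f : X → E} {s A : ℝ}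
    (hf : DerivBound U f s A) (c : ℝ) : DerivBound U (fun x => c • f x) (|c| * s) A := by
  intro x hx
  refine ⟨(hf x hx).1.const_smul c, fun k => ?_⟩
  have := iteratedFDeriv_const_smul_apply' (a := c) ((hf x hx).1.of_le
    (show (k : WithTop ℕ∞) ≤ ∞ by exact_mod_cast le_top))
  rw [this, norm_smul, Real.norm_eq_abs]
  have h1 := (hf x hx).2 k
  calc _ ≤ |c| * (s * A ^ k * (k ! : ℝ)) := by gcongr
    _ = _ := by ring

lemma DerivBound.comp_add_right {U : Set X} {f : X → E} {s A : ℝ}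
    (hf : DerivBound U f s A) (v : X) :
    DerivBound ((fun x => x + v) ⁻¹' U) (fun x => f (x + v)) s A := by
  intro x hx
  refine ⟨(hf _ hx).1.comp x (contDiffAt_id.add contDiffAt_const), fun k => ?_⟩
  rw [iteratedFDeriv_comp_add_right]
  exact (hf _ hx).2 k

/-- One differentiation costs a factor `k + 1 ≤ 2 ^ k`, which is absorbed by doubling the rate. -/
lemma pow_succ_mul_factorial_succ_le {A : ℝ} (hA : 0 ≤ A) (k : ℕ) :
    A ^ (k + 1) * ((k + 1)! : ℝ) ≤ A * (2 * A) ^ k * (k ! : ℝ) := by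
  have h : ((k : ℝ) + 1) ≤ 2 ^ k := by exact_mod_cast Nat.lt_two_pow_self (n := k)
  rw [Nat.factorial_succ, mul_pow]
  push_cast
  calc A ^ (k + 1) * (((k : ℝ) + 1) * (k ! : ℝ)) = A * A ^ k * (k ! : ℝ) * ((k : ℝ) + 1) := by ring
    _ ≤ A * A ^ k * (k ! : ℝ) * 2 ^ k := by gcongr
    _ = _ := by ring

lemma DerivBound.fderiv {U : Set X} {f : X → E} {s A : ℝ} (hA : 0 ≤ A)
    (hf : DerivBound U f s A) : DerivBound U (fderiv ℝ f) (s * A) (2 * A) := by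
  intro x hx
  refine ⟨(hf x hx).1.fderiv_right (by exact_mod_cast le_refl _), fun k => ?_⟩
  rw [norm_iteratedFDeriv_fderiv]
  have h0 := hf.nonneg ⟨x, hx⟩
  calc _ ≤ s * A ^ (k + 1) * ((k + 1)! : ℝ) := (hf x hx).2 (k + 1)
    _ = s * (A ^ (k + 1) * ((k + 1)! : ℝ)) := by ring
    _ ≤ s * (A * (2 * A) ^ k * (k ! : ℝ)) := by
        gcongr s * ?_; exact pow_succ_mul_factorial_succ_le hA k
    _ = _ := by ring

/-- A bound on the derivatives of the differential gives one for a function vanishing at `0`. -/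
lemma DerivBound.of_fderiv {R : ℝ} (hR : 0 < R) {f : X → E} {s A : ℝ} (hA : 1 ≤ A)
    (hs : ∀ x ∈ ball (0 : X) R, ContDiffAt ℝ ∞ f x)
    (hf : DerivBound (ball (0 : X) R) (_root_.fderiv ℝ f) s A) (h0 : f 0 = 0) :
    DerivBound (ball (0 : X) R) f (s * (R + 1)) A := by
  intro x hx
  refine ⟨hs x hx, fun k => ?_⟩
  have hsn := hf.nonneg ⟨x, hx⟩
  rcases k with _ | k
  · have h1 : ‖f x - f 0‖ ≤ s * ‖x - 0‖ :=
      (convex_ball (0 : X) R).norm_image_sub_le_of_norm_fderiv_le (𝕜 := ℝ)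
        (fun y hy => (hs y hy).differentiableAt (by simp))
        (fun y hy => hf.norm_le hy) (mem_ball_self hR) hx
    rw [h0, sub_zero, sub_zero] at h1
    have h2 : ‖x‖ ≤ R + 1 := by have := mem_ball_zero_iff.1 hx; linarith
    simpa using h1.trans (by gcongr)
  · rw [← norm_iteratedFDeriv_fderiv]
    refine ((hf x hx).2 k).trans ?_
    have h1 : A ^ k ≤ A ^ (k + 1) := pow_le_pow_right₀ hA (Nat.le_succ k)
    have h2 : (k ! : ℝ) ≤ ((k + 1)! : ℝ) := by exact_mod_cast Nat.factorial_le (Nat.le_succ k)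
    have h3 : s ≤ s * (R + 1) := by nlinarith
    gcongr

/-- Termwise differentiation of a series of functions with summable derivative bounds. -/
lemma iteratedFDeriv_tsum_of_derivBound [CompleteSpace E] {ι : Type*} {U : Set X} (hU : IsOpen U)
    (hc : IsPreconnected U) {f : ι → X → E} {s : ι → ℝ} {A : ℝ}
    (hf : ∀ i, DerivBound U (f i) (s i) A) (hs : Summable s) (k : ℕ) :
    ∀ x ∈ U, iteratedFDeriv ℝ k (fun y => ∑' i, f i y) x = ∑' i, iteratedFDeriv ℝ k (f i) x ∧
      HasFDerivAt (iteratedFDeriv ℝ k (fun y => ∑' i, f i y))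
        (∑' i, fderiv ℝ (iteratedFDeriv ℝ k (f i)) x) x := by
  have hsum : ∀ k : ℕ, Summable fun i => s i * A ^ k * (k ! : ℝ) := fun k =>
    (hs.mul_right _).mul_right _
  -- The two assertions are proved in alternation: the formula of order `k` on all of `U` gives the
  -- differentiability of that derivative, and this gives the formula of order `k + 1`.
  have key : ∀ k : ℕ, (∀ x ∈ U, iteratedFDeriv ℝ k (fun y => ∑' i, f i y) x =
      ∑' i, iteratedFDeriv ℝ k (f i) x) → ∀ x ∈ U,
      HasFDerivAt (iteratedFDeriv ℝ k (fun y => ∑' i, f i y))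
        (∑' i, fderiv ℝ (iteratedFDeriv ℝ k (f i)) x) x := by
    intro k hk x hx
    have h1 : HasFDerivAt (fun y => ∑' i, iteratedFDeriv ℝ k (f i) y)
        (∑' i, fderiv ℝ (iteratedFDeriv ℝ k (f i)) x) x := by
      refine hasFDerivAt_tsum_of_isPreconnected (u := fun i => s i * A ^ (k + 1) * ((k + 1)! : ℝ))
        (hsum (k + 1)) hU hc (fun i y hy => ?_) (fun i y hy => ?_) hx ?_ hx
      · exact (((hf i y hy).1).differentiableAt_iteratedFDeriv
          (by exact_mod_cast WithTop.coe_lt_top k)).hasFDerivAt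
      · rw [norm_fderiv_iteratedFDeriv]
        exact (hf i y hy).2 (k + 1)
      · exact Summable.of_norm_bounded (hsum k) fun i => (hf i x hx).2 k
    exact h1.congr_of_eventuallyEq (Filter.eventuallyEq_of_mem (hU.mem_nhds hx) hk)
  suffices h : ∀ x ∈ U, iteratedFDeriv ℝ k (fun y => ∑' i, f i y) x =
      ∑' i, iteratedFDeriv ℝ k (f i) x from fun x hx => ⟨h x hx, key k h x hx⟩
  induction k with
  | zero =>
    intro x hx
    have h2 : Summable fun i => f i x := Summable.of_norm_bounded (hsum 0) fun i => by
      simpa using (hf i).norm_le hx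
    simp only [iteratedFDeriv_zero_eq_comp, Function.comp_apply]
    exact (continuousMultilinearCurryFin0 ℝ X E).symm.toContinuousLinearEquiv.map_tsum (f := fun i => f i x)
  | succ k ih =>
    intro x hx
    rw [iteratedFDeriv_succ_eq_comp_left, Function.comp_apply, (key k ih x hx).fderiv]
    simp only [iteratedFDeriv_succ_eq_comp_left, Function.comp_apply]
    exact (continuousMultilinearCurryLeftEquiv ℝ (fun _ : Fin (k + 1) => X)
      E).symm.toContinuousLinearEquiv.map_tsum

lemma DerivBound.tsum [CompleteSpace E] {ι : Type*} {U : Set X} (hU : IsOpen U)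
    (hc : IsPreconnected U) {f : ι → X → E} {s : ι → ℝ} {A : ℝ}
    (hf : ∀ i, DerivBound U (f i) (s i) A) (hs : Summable s) :
    DerivBound U (fun y => ∑' i, f i y) (∑' i, s i) A := by
  intro x hx
  constructor
  · have : ContDiffOn ℝ ∞ (fun y => ∑' i, f i y) U := by
      refine contDiffOn_of_differentiableOn fun k _ => ?_
      intro y hy
      have h1 := ((iteratedFDeriv_tsum_of_derivBound hU hc hf hs k) y hy).2.differentiableAt
      refine (h1.congr_of_eventuallyEq ?_).differentiableWithinAt
      exact Filter.eventuallyEq_of_mem (hU.mem_nhds hy) (iteratedFDerivWithin_of_isOpen k hU)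
    exact this.contDiffAt (hU.mem_nhds hx)
  · intro k
    rw [((iteratedFDeriv_tsum_of_derivBound hU hc hf hs k) x hx).1, ← tsum_mul_right,
      ← tsum_mul_right]
    exact tsum_of_norm_bounded ((hs.mul_right _).mul_right _).hasSum fun i => (hf i x hx).2 k

end DerivBound

end CliffordCylinder

open scoped Topology
namespace CliffordCylinder
open scoped ContDiff Nat
open Metric

/-! ### Iterated partial derivatives -/

section IterD

variable {X E : Type*} [NormedAddCommGroup X] [NormedSpace ℝ X]
  [NormedAddCommGroup E] [NormedSpace ℝ E]

lemma two_add_le_infty (k : ℕ) : (2 : WithTop ℕ∞) + k ≤ ∞ := by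
  have : (2 : WithTop ℕ∞) + k = ((2 + k : ℕ∞) : WithTop ℕ∞) := rfl
  rw [this]
  exact WithTop.coe_le_coe.2 le_top

lemma two_le_infty : (2 : WithTop ℕ∞) ≤ ∞ := by simpa using two_add_le_infty 0

lemma contDiffAt_fderiv_apply {f : X → E} {x : X} (hf : ContDiffAt ℝ ∞ f x) (v : X) :
    ContDiffAt ℝ ∞ (fun y => fderiv ℝ f y v) x :=
  (hf.fderiv_right (m := ∞) (by exact_mod_cast le_refl _)).clm_apply contDiffAt_const

/-- Directional derivatives commute with iterated derivatives. -/
lemma iteratedFDeriv_fderiv_apply {f : X → E} (v : X) (k : ℕ) :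
    ∀ {x : X}, (∀ᶠ y in 𝓝 x, ContDiffAt ℝ ∞ f y) →
    iteratedFDeriv ℝ k (fun y => fderiv ℝ f y v) x = fderiv ℝ (iteratedFDeriv ℝ k f) x v := by
  induction k with
  | zero =>
    intro x hf
    ext w
    have h : DifferentiableAt ℝ (iteratedFDeriv ℝ 0 f) x :=
      hf.self_of_nhds.differentiableAt_iteratedFDeriv (by exact_mod_cast WithTop.coe_lt_top 0)
    rw [← fderiv_continuousMultilinear_apply_const_apply h]
    simp
  | succ k ih =>
    intro x hf
    have hd : ∀ i : ℕ, DifferentiableAt ℝ (iteratedFDeriv ℝ i f) x := fun i =>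
      hf.self_of_nhds.differentiableAt_iteratedFDeriv (by exact_mod_cast WithTop.coe_lt_top i)
    have hg : ContDiffAt ℝ 2 (iteratedFDeriv ℝ k f) x :=
      hf.self_of_nhds.iteratedFDeriv_right (i := k) (m := 2) (two_add_le_infty k)
    have hg' : DifferentiableAt ℝ (fderiv ℝ (iteratedFDeriv ℝ k f)) x :=
      (hg.fderiv_right (m := 1) (by norm_num)).differentiableAt (by simp)
    have hsymm := hg.isSymmSndFDerivAt (by simp)
    have he : iteratedFDeriv ℝ k (fun y => fderiv ℝ f y v) =ᶠ[𝓝 x]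
        fun y => fderiv ℝ (iteratedFDeriv ℝ k f) y v := by
      filter_upwards [hf.eventually_nhds] with y hy
      exact ih hy
    ext w
    rw [iteratedFDeriv_succ_apply_left, he.fderiv_eq,
      ← fderiv_continuousMultilinear_apply_const_apply (hd (k + 1))]
    have h2 : (fun y => iteratedFDeriv ℝ (k + 1) f y w) =
        fun y => fderiv ℝ (iteratedFDeriv ℝ k f) y (w 0) (Fin.tail w) := by
      funext y
      rw [iteratedFDeriv_succ_apply_left]
    rw [h2]
    have h3 : DifferentiableAt ℝ (fun y => fderiv ℝ (iteratedFDeriv ℝ k f) y (w 0)) x :=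
      hg'.clm_apply (differentiableAt_const _)
    rw [fderiv_continuousMultilinear_apply_const_apply h3,
      fderiv_clm_apply hg' (differentiableAt_const _),
      fderiv_clm_apply hg' (differentiableAt_const _)]
    simp only [fderiv_fun_const, Pi.zero_apply, ContinuousLinearMap.comp_zero, zero_add,
      ContinuousLinearMap.flip_apply]
    -- Both sides are the second derivative of the `k`-th derivative in the directions `v` and `w
    -- 0`.
    rw [hsymm.eq]

lemma norm_iteratedFDeriv_fderiv_apply_le {f : X → E} {x : X} (hf : ContDiffAt ℝ ∞ f x) (v : X)
    (k : ℕ) : ‖iteratedFDeriv ℝ k (fun y => fderiv ℝ f y v) x‖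
      ≤ ‖v‖ * ‖iteratedFDeriv ℝ (k + 1) f x‖ := by
  rw [← norm_iteratedFDeriv_fderiv]
  exact norm_iteratedFDeriv_clm_apply_const
    (hf.fderiv_right (m := ∞) (by exact_mod_cast le_refl _)) (by exact_mod_cast le_top)

/-- Binomial coefficients are at most `2 ^ (k + p)`, so `(k + p)!` splits into `k! * p!` at the
price of doubling the rate. -/
lemma factorial_add_le (k p : ℕ) : (((k + p)! : ℕ) : ℝ) ≤ 2 ^ (k + p) * ((k ! : ℝ) * (p ! : ℝ)) := by
  have h1 := Nat.add_choose_mul_factorial_mul_factorial k p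
  have h2 := Nat.choose_le_two_pow (k + p) p
  have h3 : (k + p)! ≤ 2 ^ (k + p) * (k ! * p !) := by
    rw [← h1, mul_assoc]
    exact Nat.mul_le_mul_right _ h2
  exact_mod_cast h3

end IterD

variable {n : ℕ}

/-- The iterated partial derivative along a list of indices, the first one applied last. -/
noncomputable def iterD (L : List (Fin n)) (f : V n → Cl n) : V n → Cl n :=
  L.foldr (fun i g => partialDeriv i g) f

@[simp] lemma iterD_nil (f : V n → Cl n) : iterD [] f = f := rfl

@[simp] lemma iterD_cons (i : Fin n) (L : List (Fin n)) (f : V n → Cl n) :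
    iterD (i :: L) f = partialDeriv i (iterD L f) := rfl

lemma iterD_append (L L' : List (Fin n)) (f : V n → Cl n) :
    iterD (L ++ L') f = iterD L (iterD L' f) := by
  simp [iterD, List.foldr_append]

/-- The sorted list of indices in which `i` occurs `m i` times. -/
noncomputable def multiList (m : Fin n → ℕ) : List (Fin n) :=
  (List.finRange n).flatMap fun i => List.replicate (m i) i

lemma multiDeriv_eq_iterD (m : Fin n → ℕ) (f : V n → Cl n) :
    multiDeriv m f = iterD (multiList m) f := by
  have h1 : ∀ (i : Fin n) (r : ℕ) (g : V n → Cl n),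
      iterD (List.replicate r i) g = (partialDeriv i)^[r] g := by
    intro i r g
    induction r with
    | zero => rfl
    | succ r ih => rw [List.replicate_succ, iterD_cons, ih, Function.iterate_succ_apply']
  unfold multiDeriv multiList
  induction List.finRange n with
  | nil => rfl
  | cons i L ih => rw [List.foldr_cons, List.flatMap_cons, iterD_append, h1, ih]

lemma count_multiList (m : Fin n → ℕ) (i : Fin n) : (multiList m).count i = m i := by
  unfold multiList
  rw [List.count_flatMap]
  have : (List.count i ∘ fun j => List.replicate (m j) j) = fun j => if j = i then m i else 0 := by
    funext j
    simp only [Function.comp_apply, List.count_replicate, beq_iff_eq]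
    split_ifs with h
    · rw [h]
    · rfl
  rw [this, ← List.ofFn_eq_map, List.sum_ofFn]
  simp

lemma length_multiList (m : Fin n → ℕ) : (multiList m).length = ∑ i, m i := by
  simp [multiList, List.length_flatMap, ← List.ofFn_eq_map, List.sum_ofFn]

lemma multiDeriv_zero (f : V n → Cl n) : multiDeriv 0 f = f := by
  have : multiList (0 : Fin n → ℕ) = [] := by
    rw [← List.length_eq_zero_iff, length_multiList]; simp
  rw [multiDeriv_eq_iterD, this]; rfl

lemma partialDeriv_congr {f g : V n → Cl n} {x : V n} (h : f =ᶠ[𝓝 x] g) (i : Fin n) :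
    partialDeriv i f =ᶠ[𝓝 x] partialDeriv i g := by
  filter_upwards [h.eventuallyEq_nhds] with y hy
  simp only [partialDeriv, hy.fderiv_eq]

lemma iterD_congr {f g : V n → Cl n} {x : V n} (h : f =ᶠ[𝓝 x] g) (L : List (Fin n)) :
    iterD L f =ᶠ[𝓝 x] iterD L g := by
  induction L with
  | nil => exact h
  | cons i L ih => exact partialDeriv_congr ih i

lemma multiDeriv_congr {f g : V n → Cl n} {x : V n} (h : f =ᶠ[𝓝 x] g) (m : Fin n → ℕ) :
    multiDeriv m f =ᶠ[𝓝 x] multiDeriv m g := by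
  simpa only [multiDeriv_eq_iterD] using iterD_congr h _

lemma iterD_comp_add_right (f : V n → Cl n) (v : V n) (L : List (Fin n)) :
    iterD L (fun x => f (x + v)) = fun x => iterD L f (x + v) := by
  induction L with
  | nil => rfl
  | cons i L ih =>
    funext x
    rw [iterD_cons, ih, iterD_cons]
    simp only [partialDeriv, fderiv_comp_add_right]

lemma iterD_const_smul (f : V n → Cl n) (c : ℝ) (L : List (Fin n)) :
    iterD L (fun x => c • f x) = fun x => c • iterD L f x := by
  induction L with
  | nil => rfl
  | cons i L ih =>
    funext x
    rw [iterD_cons, ih, iterD_cons]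
    have := congrFun (fderiv_const_smul_field (𝕜 := ℝ) (f := iterD L f) c) x
    simp only [partialDeriv]
    change fderiv ℝ (c • iterD L f) x (stdVec i) = _
    rw [this]
    rfl

lemma contDiffAt_iterD {f : V n → Cl n} {x : V n} (hf : ContDiffAt ℝ ∞ f x) (L : List (Fin n)) :
    ContDiffAt ℝ ∞ (iterD L f) x := by
  induction L with
  | nil => exact hf
  | cons i L ih => exact contDiffAt_fderiv_apply ih _

lemma norm_stdVec (i : Fin n) : ‖(stdVec i : V n)‖ = 1 := by simp [stdVec]

lemma norm_iteratedFDeriv_iterD_le {f : V n → Cl n} {x : V n} (hf : ContDiffAt ℝ ∞ f x)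
    (L : List (Fin n)) (k : ℕ) :
    ‖iteratedFDeriv ℝ k (iterD L f) x‖ ≤ ‖iteratedFDeriv ℝ (k + L.length) f x‖ := by
  induction L generalizing k with
  | nil => simp
  | cons i L ih =>
    have h1 := norm_iteratedFDeriv_fderiv_apply_le (contDiffAt_iterD hf L) (stdVec i) k
    rw [norm_stdVec, one_mul] at h1
    refine h1.trans ((ih (k + 1)).trans (le_of_eq ?_))
    rw [List.length_cons, add_assoc, add_comm 1]

/-- The new rate is `2 * A` whatever the length of `L`; the order of differentiation enters only the
constant. This uniformity makes it possible to sum over all orders on one and the same ball, the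
coefficients compensating the factorial. -/
lemma DerivBound.iterD {U : Set (V n)} {f : V n → Cl n} {s A : ℝ} (hA : 0 ≤ A)
    (hf : DerivBound U f s A) (L : List (Fin n)) :
    DerivBound U (iterD L f) (s * (2 * A) ^ L.length * (L.length ! : ℝ)) (2 * A) := by
  intro x hx
  refine ⟨contDiffAt_iterD (hf x hx).1 L, fun k => ?_⟩
  have h0 := hf.nonneg ⟨x, hx⟩
  refine (norm_iteratedFDeriv_iterD_le (hf x hx).1 L k).trans (((hf x hx).2 _).trans ?_)
  calc s * A ^ (k + L.length) * ((k + L.length)! : ℝ)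
      ≤ s * A ^ (k + L.length) * (2 ^ (k + L.length) * ((k ! : ℝ) * (L.length ! : ℝ))) := by
        gcongr; exact factorial_add_le k _
    _ = _ := by rw [mul_pow, mul_pow]; ring

lemma iterD_perm {f : V n → Cl n} {U : Set (V n)} (hU : IsOpen U)
    (hf : ∀ x ∈ U, ContDiffAt ℝ ∞ f x) {L L' : List (Fin n)} (h : L.Perm L') :
    ∀ x ∈ U, iterD L f x = iterD L' f x := by
  induction h with
  | nil => exact fun _ _ => rfl
  | cons i _ ih =>
    intro x hx
    exact (partialDeriv_congr (Filter.eventuallyEq_of_mem (hU.mem_nhds hx) ih) i).eq_of_nhds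
  | swap i j L =>
    intro x hx
    have hg : ContDiffAt ℝ 2 (iterD L f) x :=
      (contDiffAt_iterD (hf x hx) L).of_le two_le_infty
    have hg' : DifferentiableAt ℝ (fderiv ℝ (iterD L f)) x :=
      (hg.fderiv_right (m := 1) (by norm_num)).differentiableAt (by simp)
    have hsymm := hg.isSymmSndFDerivAt (by simp)
    change fderiv ℝ (fun y => fderiv ℝ (iterD L f) y (stdVec i)) x (stdVec j) =
      fderiv ℝ (fun y => fderiv ℝ (iterD L f) y (stdVec j)) x (stdVec i)
    rw [fderiv_clm_apply hg' (differentiableAt_const _),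
      fderiv_clm_apply hg' (differentiableAt_const _)]
    simp only [fderiv_fun_const, Pi.zero_apply, ContinuousLinearMap.comp_zero, zero_add,
      ContinuousLinearMap.flip_apply]
    exact hsymm.eq _ _
  | trans _ _ ih1 ih2 => exact fun x hx => (ih1 x hx).trans (ih2 x hx)

lemma iterD_eq_multiDeriv {f : V n → Cl n} {U : Set (V n)} (hU : IsOpen U)
    (hf : ∀ x ∈ U, ContDiffAt ℝ ∞ f x) (L : List (Fin n)) {x : V n} (hx : x ∈ U) :
    iterD L f x = multiDeriv (fun i => L.count i) f x := by
  rw [multiDeriv_eq_iterD]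
  refine iterD_perm hU hf ?_ x hx
  rw [List.perm_iff_count]
  intro i
  rw [count_multiList]

lemma iteratedFDeriv_stdVec {f : V n → Cl n} {U : Set (V n)} (hU : IsOpen U)
    (hf : ∀ x ∈ U, ContDiffAt ℝ ∞ f x) (k : ℕ) (i : Fin k → Fin n) {x : V n} (hx : x ∈ U) :
    iteratedFDeriv ℝ k f x (fun j => stdVec (i j)) = iterD (List.ofFn i) f x := by
  induction k generalizing x with
  | zero => simp
  | succ k ih =>
    have hd : DifferentiableAt ℝ (iteratedFDeriv ℝ k f) x :=
      (hf x hx).differentiableAt_iteratedFDeriv (by exact_mod_cast WithTop.coe_lt_top k)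
    rw [hd.iteratedFDeriv_succ_apply_left', List.ofFn_succ, iterD_cons, partialDeriv]
    have : (fun y => iteratedFDeriv ℝ k f y (Fin.tail fun j => stdVec (i j))) =ᶠ[𝓝 x]
        iterD (List.ofFn fun j => i j.succ) f :=
      Filter.eventuallyEq_of_mem (hU.mem_nhds hx) fun y hy => ih (fun j => i j.succ) hy
    rw [this.fderiv_eq]

/-! ### Multiplication in `Cl_n` as a continuous operation -/

/-- Right multiplication by `c`, as a continuous linear map depending linearly on `c`. -/
noncomputable def mulR : Cl n →L[ℝ] (Cl n →L[ℝ] Cl n) :=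
  ((LinearMap.toContinuousLinearMap (𝕜 := ℝ) (E := Cl n) (F' := Cl n)).toLinearMap ∘ₗ
    (LinearMap.mul ℝ (Cl n)).flip).toContinuousLinearMap

/-- Left multiplication by `c`, as a continuous linear map depending linearly on `c`. -/
noncomputable def mulL : Cl n →L[ℝ] (Cl n →L[ℝ] Cl n) :=
  ((LinearMap.toContinuousLinearMap (𝕜 := ℝ) (E := Cl n) (F' := Cl n)).toLinearMap ∘ₗ
    LinearMap.mul ℝ (Cl n)).toContinuousLinearMap

@[simp] lemma mulR_apply (c x : Cl n) : mulR c x = x * c := rfl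

@[simp] lemma mulL_apply (c x : Cl n) : mulL c x = c * x := rfl

lemma norm_mul_le_mulL (x y : Cl n) : ‖x * y‖ ≤ ‖(mulL : Cl n →L[ℝ] _)‖ * ‖x‖ * ‖y‖ :=
  (mulL : Cl n →L[ℝ] _).le_opNorm₂ x y

instance : CompleteSpace (Cl n) := FiniteDimensional.complete ℝ (Cl n)

/-! ### Constant coefficient operators and their smooth null solutions -/

/-- A homogeneous differential operator of order `j` with constant coefficients, acting on
`Cl_n`-valued functions and commuting with right multiplications. -/
structure DiffOp (n j : ℕ) where
  /-- The symbol, applied to the `j`-th derivative. -/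
  op : ContinuousMultilinearMap ℝ (fun _ : Fin j => V n) (Cl n) →L[ℝ] Cl n
  op_mul : ∀ T c, op ((mulR c).compContinuousMultilinearMap T) = op T * c

variable {j : ℕ} (Λ : DiffOp n j)

/-- Null solutions on `U` with factorial derivative bounds. -/
structure Tame (U : Set (V n)) (f : V n → Cl n) (s A : ℝ) : Prop where
  bound : DerivBound U f s A
  null : ∀ x ∈ U, Λ.op (iteratedFDeriv ℝ j f x) = 0

/-- Null solutions with factorial derivative bounds near a point. -/
noncomputable def TameAt (f : V n → Cl n) (x : V n) : Prop :=
  ∃ δ > 0, ∃ s A, 1 ≤ A ∧ Tame Λ (ball x δ) f s A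

variable {Λ}

lemma Tame.mono {U U' : Set (V n)} {f : V n → Cl n} {s s' A A' : ℝ} (h : Tame Λ U f s A)
    (hU : U' ⊆ U) (hs : s ≤ s') (hA : 0 ≤ A) (hA' : A ≤ A') : Tame Λ U' f s' A' :=
  ⟨h.bound.mono hU hs hA hA', fun x hx => h.null x (hU hx)⟩

lemma Tame.congr {U : Set (V n)} (hU : IsOpen U) {f g : V n → Cl n} {s A : ℝ}
    (h : Tame Λ U f s A) (hfg : Set.EqOn g f U) : Tame Λ U g s A := by
  refine ⟨h.bound.congr hU hfg, fun x hx => ?_⟩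
  have he : g =ᶠ[𝓝 x] f := Filter.eventuallyEq_of_mem (hU.mem_nhds hx) hfg
  rw [(he.iteratedFDeriv ℝ j).eq_of_nhds]
  exact h.null x hx

lemma Tame.add {U : Set (V n)} {f g : V n → Cl n} {s t A : ℝ}
    (hf : Tame Λ U f s A) (hg : Tame Λ U g t A) : Tame Λ U (fun x => f x + g x) (s + t) A := by
  refine ⟨hf.bound.add hg.bound, fun x hx => ?_⟩
  rw [fun_iteratedFDeriv_add_apply ((hf.bound x hx).1.of_le (by exact_mod_cast le_top))
    ((hg.bound x hx).1.of_le (by exact_mod_cast le_top)), map_add, hf.null x hx, hg.null x hx,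
    add_zero]

lemma Tame.const_smul {U : Set (V n)} {f : V n → Cl n} {s A : ℝ}
    (hf : Tame Λ U f s A) (c : ℝ) : Tame Λ U (fun x => c • f x) (|c| * s) A := by
  refine ⟨hf.bound.const_smul c, fun x hx => ?_⟩
  rw [iteratedFDeriv_const_smul_apply' (a := c) ((hf.bound x hx).1.of_le
    (by exact_mod_cast le_top)), map_smul, hf.null x hx, smul_zero]

lemma Tame.mul_right {U : Set (V n)} {f : V n → Cl n} {s A : ℝ}
    (hf : Tame Λ U f s A) (c : Cl n) : Tame Λ U (fun x => f x * c) (‖mulR c‖ * s) A := by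
  refine ⟨hf.bound.clm_comp (mulR c), fun x hx => ?_⟩
  have h := (mulR c).iteratedFDeriv_comp_left (f := f) (hf.bound x hx).1
    (i := j) (by exact_mod_cast le_top)
  change Λ.op (iteratedFDeriv ℝ j (mulR c ∘ f) x) = 0
  rw [h, Λ.op_mul, hf.null x hx, zero_mul]

lemma Tame.comp_add_right {U : Set (V n)} {f : V n → Cl n} {s A : ℝ}
    (hf : Tame Λ U f s A) (v : V n) :
    Tame Λ ((fun x => x + v) ⁻¹' U) (fun x => f (x + v)) s A := by
  refine ⟨hf.bound.comp_add_right v, fun x hx => ?_⟩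
  rw [iteratedFDeriv_comp_add_right]
  exact hf.null _ hx

lemma Tame.tsum {ι : Type*} {U : Set (V n)} (hU : IsOpen U) (hc : IsPreconnected U)
    {f : ι → V n → Cl n} {s : ι → ℝ} {A : ℝ} (hf : ∀ i, Tame Λ U (f i) (s i) A)
    (hs : Summable s) : Tame Λ U (fun y => ∑' i, f i y) (∑' i, s i) A := by
  refine ⟨DerivBound.tsum hU hc (fun i => (hf i).bound) hs, fun x hx => ?_⟩
  rw [(iteratedFDeriv_tsum_of_derivBound hU hc (fun i => (hf i).bound) hs j x hx).1]
  have h1 : Summable fun i => iteratedFDeriv ℝ j (f i) x :=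
    Summable.of_norm_bounded ((hs.mul_right (A ^ j)).mul_right (j ! : ℝ))
      fun i => ((hf i).bound x hx).2 j
  have h2 := (h1.hasSum.mapL Λ.op).tsum_eq
  rw [← h2]
  simp [fun i => (hf i).null x hx]

/-- The coefficients of `Λ` are constant: the identity `Λ f = 0` may be differentiated, and
directional derivatives commute with the `j`-th derivative. -/
lemma Tame.iterD {U : Set (V n)} (hU : IsOpen U) {f : V n → Cl n} {s A : ℝ} (hA : 0 ≤ A)
    (hf : Tame Λ U f s A) (L : List (Fin n)) :
    Tame Λ U (iterD L f) (s * (2 * A) ^ L.length * (L.length ! : ℝ)) (2 * A) := by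
  refine ⟨hf.bound.iterD hA L, ?_⟩
  induction L with
  | nil => exact hf.null
  | cons i L ih =>
    intro x hx
    have hs : ∀ y ∈ U, ContDiffAt ℝ ∞ (CliffordCylinder.iterD L f) y :=
      fun y hy => contDiffAt_iterD (hf.bound y hy).1 L
    have h1 := iteratedFDeriv_fderiv_apply (stdVec i) j
      (Filter.eventually_of_mem (hU.mem_nhds hx) hs)
    have hd : DifferentiableAt ℝ (iteratedFDeriv ℝ j (CliffordCylinder.iterD L f)) x :=
      (hs x hx).differentiableAt_iteratedFDeriv (by exact_mod_cast WithTop.coe_lt_top j)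
    have h2 : (fun y => Λ.op (iteratedFDeriv ℝ j (CliffordCylinder.iterD L f) y)) =ᶠ[𝓝 x]
        fun _ => 0 := Filter.eventuallyEq_of_mem (hU.mem_nhds hx) ih
    have h3 := h2.fderiv_eq (𝕜 := ℝ)
    have h4 := ((Λ.op.hasFDerivAt (x := iteratedFDeriv ℝ j (CliffordCylinder.iterD L f) x)).comp x
      hd.hasFDerivAt).fderiv
    rw [Function.comp_def, h3] at h4
    change Λ.op (iteratedFDeriv ℝ j
      (fun y => _root_.fderiv ℝ (CliffordCylinder.iterD L f) y (stdVec i)) x) = 0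
    rw [h1]
    simpa using (DFunLike.congr_fun h4 (stdVec i)).symm

lemma Tame.multiDeriv {U : Set (V n)} (hU : IsOpen U) {f : V n → Cl n} {s A : ℝ} (hA : 0 ≤ A)
    (hf : Tame Λ U f s A) (m : Fin n → ℕ) :
    Tame Λ U (multiDeriv m f) (s * (2 * A) ^ (∑ i, m i) * ((∑ i, m i)! : ℝ)) (2 * A) := by
  rw [multiDeriv_eq_iterD, ← length_multiList]
  exact hf.iterD hU hA _

lemma Tame.tameAt {U : Set (V n)} (hU : IsOpen U) {f : V n → Cl n} {s A : ℝ} (hA : 1 ≤ A)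
    (hf : Tame Λ U f s A) {x : V n} (hx : x ∈ U) : TameAt Λ f x := by
  obtain ⟨δ, hδ, h⟩ := Metric.isOpen_iff.1 hU x hx
  exact ⟨δ, hδ, s, A, hA, hf.mono h le_rfl (by linarith) le_rfl⟩

lemma TameAt.eventually {f : V n → Cl n} {x : V n} (h : TameAt Λ f x) :
    ∀ᶠ y in 𝓝 x, TameAt Λ f y := by
  obtain ⟨δ, hδ, s, A, hA, h⟩ := h
  filter_upwards [ball_mem_nhds x hδ] with y hy
  exact h.tameAt isOpen_ball hA hy

lemma TameAt.contDiffAt {f : V n → Cl n} {x : V n} (h : TameAt Λ f x) : ContDiffAt ℝ ∞ f x := by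
  obtain ⟨δ, hδ, s, A, hA, h⟩ := h
  exact (h.bound x (mem_ball_self hδ)).1

lemma TameAt.null {f : V n → Cl n} {x : V n} (h : TameAt Λ f x) :
    Λ.op (iteratedFDeriv ℝ j f x) = 0 := by
  obtain ⟨δ, hδ, s, A, hA, h⟩ := h
  exact h.null x (mem_ball_self hδ)

lemma TameAt.congr {f g : V n → Cl n} {x : V n} (h : TameAt Λ f x) (hg : g =ᶠ[𝓝 x] f) :
    TameAt Λ g x := by
  obtain ⟨δ, hδ, s, A, hA, h⟩ := h
  obtain ⟨δ', hδ', h'⟩ := Metric.eventually_nhds_iff_ball.1 hg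
  refine ⟨min δ δ', lt_min hδ hδ', s, A, hA, ?_⟩
  exact (h.mono (ball_subset_ball (min_le_left _ _)) le_rfl (by linarith) le_rfl).congr
    isOpen_ball fun y hy => h' y (ball_subset_ball (min_le_right _ _) hy)

lemma TameAt.add {f g : V n → Cl n} {x : V n} (hf : TameAt Λ f x) (hg : TameAt Λ g x) :
    TameAt Λ (fun y => f y + g y) x := by
  obtain ⟨δ, hδ, s, A, hA, h⟩ := hf
  obtain ⟨δ', hδ', s', A', hA', h'⟩ := hg
  refine ⟨min δ δ', lt_min hδ hδ', s + s', max A A', hA.trans (le_max_left _ _), ?_⟩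
  exact (h.mono (ball_subset_ball (min_le_left _ _)) le_rfl (by linarith) (le_max_left _ _)).add
    (h'.mono (ball_subset_ball (min_le_right _ _)) le_rfl (by linarith) (le_max_right _ _))

lemma TameAt.const_smul {f : V n → Cl n} {x : V n} (hf : TameAt Λ f x) (c : ℝ) :
    TameAt Λ (fun y => c • f y) x := by
  obtain ⟨δ, hδ, s, A, hA, h⟩ := hf
  exact ⟨δ, hδ, _, A, hA, h.const_smul c⟩

lemma TameAt.sub {f g : V n → Cl n} {x : V n} (hf : TameAt Λ f x) (hg : TameAt Λ g x) :
    TameAt Λ (fun y => f y - g y) x := by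
  simpa [sub_eq_add_neg] using hf.add (hg.const_smul (-1))

lemma TameAt.mul_right {f : V n → Cl n} {x : V n} (hf : TameAt Λ f x) (c : Cl n) :
    TameAt Λ (fun y => f y * c) x := by
  obtain ⟨δ, hδ, s, A, hA, h⟩ := hf
  exact ⟨δ, hδ, _, A, hA, h.mul_right c⟩

lemma TameAt.comp_add_right {f : V n → Cl n} {x v : V n} (hf : TameAt Λ f (x + v)) :
    TameAt Λ (fun y => f (y + v)) x := by
  obtain ⟨δ, hδ, s, A, hA, h⟩ := hf
  refine ⟨δ, hδ, s, A, hA, (h.comp_add_right v).mono (fun y hy => ?_) le_rfl (by linarith) le_rfl⟩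
  simpa [Set.mem_preimage, mem_ball] using hy

lemma TameAt.multiDeriv {f : V n → Cl n} {x : V n} (hf : TameAt Λ f x) (m : Fin n → ℕ) :
    TameAt Λ (multiDeriv m f) x := by
  obtain ⟨δ, hδ, s, A, hA, h⟩ := hf
  exact ⟨δ, hδ, _, 2 * A, by linarith, h.multiDeriv isOpen_ball (by linarith) m⟩

lemma tameAt_zero (x : V n) : TameAt Λ (fun _ => 0) x := by
  refine ⟨1, one_pos, 0, 1, le_rfl, ⟨fun y _ => ⟨contDiffAt_const, fun k => ?_⟩, fun y _ => ?_⟩⟩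
  · have : iteratedFDeriv ℝ k (fun _ : V n => (0 : Cl n)) y = 0 := by
      have := congrFun (iteratedFDeriv_fun_zero (𝕜 := ℝ) (E := V n) (F := Cl n) (n := k)) y
      exact this
    simp [this]
  · have := congrFun (iteratedFDeriv_fun_zero (𝕜 := ℝ) (E := V n) (F := Cl n) (n := j)) y
    have h2 : iteratedFDeriv ℝ j (fun _ : V n => (0 : Cl n)) y = 0 := this
    rw [h2, map_zero]

lemma TameAt.sum {ι : Type*} {f : ι → V n → Cl n} {x : V n} (F : Finset ι)
    (hf : ∀ i ∈ F, TameAt Λ (f i) x) : TameAt Λ (fun y => ∑ i ∈ F, f i y) x := by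
  classical
  induction F using Finset.induction_on with
  | empty => simpa using tameAt_zero x
  | insert i F hi ih =>
    simp only [Finset.sum_insert hi]
    exact (hf i (Finset.mem_insert_self i F)).add
      (ih fun i' hi' => hf i' (Finset.mem_insert_of_mem hi'))

/-- A series of null solutions with summable derivative bounds, up to finitely many terms. -/
lemma tameAt_tsum {ι : Type*} {f : ι → V n → Cl n} {x : V n} (hf : ∀ i, TameAt Λ (f i) x)
    {δ A : ℝ} (hδ : 0 < δ) (hA : 1 ≤ A) {s : ι → ℝ} (hs : Summable s) (F : Finset ι)
    (hF : ∀ i ∉ F, Tame Λ (ball x δ) (f i) (s i) A) :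
    TameAt Λ (fun y => ∑' i, f i y) x ∧ ∀ᶠ y in 𝓝 x, Summable fun i => f i y := by
  have hF' : ∀ i : {i // i ∉ F}, Tame Λ (ball x δ) (f i) (s i) A := fun i => hF i i.2
  have hs' : Summable fun i : {i // i ∉ F} => s i := hs.subtype _
  have h1 := Tame.tsum isOpen_ball (convex_ball x δ).isPreconnected hF' hs'
  have hsum : ∀ y ∈ ball x δ, Summable fun i => f i y := by
    intro y hy
    refine (Finset.summable_compl_iff F).1 ?_
    exact Summable.of_norm_bounded hs' fun i => (hF' i).bound.norm_le hy
  have h2 := (TameAt.sum F fun i _ => hf i).add (h1.tameAt isOpen_ball hA (mem_ball_self hδ))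
  constructor
  · refine h2.congr ?_
    filter_upwards [ball_mem_nhds x hδ] with y hy
    exact ((hsum y hy).sum_add_tsum_subtype_compl F).symm
  · filter_upwards [ball_mem_nhds x hδ] with y hy using hsum y hy

end CliffordCylinder

open scoped Topology
namespace CliffordCylinder
open scoped ContDiff Nat NNReal
open Metric

/-! ### Derivative bounds for analytic and homogeneous functions -/

section Analytic

variable {X E : Type*} [NormedAddCommGroup X] [NormedSpace ℝ X]
  [NormedAddCommGroup E] [NormedSpace ℝ E] [CompleteSpace E]

/-- The `k`-th derivative is the sum of the `k`-th coefficient over all `k!` permutations of the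
arguments. -/
lemma norm_iteratedFDeriv_le_of_hasFPowerSeriesOnBall {f : X → E}
    {p : FormalMultilinearSeries ℝ X E} {x : X} {r : ENNReal} (h : HasFPowerSeriesOnBall f p x r)
    (k : ℕ) : ‖iteratedFDeriv ℝ k f x‖ ≤ (k ! : ℝ) * ‖p k‖ := by
  refine ContinuousMultilinearMap.opNorm_le_bound (by positivity) fun v => ?_
  rw [h.iteratedFDeriv_eq_sum_of_completeSpace]
  refine (norm_sum_le _ _).trans ?_
  calc ∑ σ : Equiv.Perm (Fin k), ‖p k fun i => v (σ i)‖
      ≤ ∑ σ : Equiv.Perm (Fin k), ‖p k‖ * ∏ i, ‖v i‖ := by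
        refine Finset.sum_le_sum fun σ _ => ((p k).le_opNorm _).trans (le_of_eq ?_)
        rw [Equiv.prod_comp σ fun i => ‖v i‖]
    _ = (k ! : ℝ) * ‖p k‖ * ∏ i, ‖v i‖ := by
        rw [Finset.sum_const, Finset.card_univ, Fintype.card_perm, Fintype.card_fin, nsmul_eq_mul]
        ring

/-- An analytic function has uniform factorial derivative bounds near each point, and its Taylor
series at nearby points converge on balls of a uniform radius. -/
lemma exists_derivBound_of_analyticAt {f : X → E} {x : X} (hf : AnalyticAt ℝ f x) :
    ∃ δ > 0, ∃ s A, 1 ≤ A ∧ DerivBound (ball x δ) f s A ∧ ∀ z ∈ ball x δ, ∀ y, ‖y‖ * A < 1 →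
      HasSum (fun k : ℕ => (k ! : ℝ)⁻¹ • iteratedFDeriv ℝ k f z fun _ => y) (f (z + y)) := by
  obtain ⟨p, r, h⟩ := hf
  obtain ⟨R, hR0, hR⟩ := ENNReal.lt_iff_exists_nnreal_btwn.1 h.r_pos
  have hR0' : 0 < R := by exact_mod_cast hR0
  -- Since `2 * ρ < r`, the series can be recentred at any point of the ball of radius `ρ` and still
  -- converges on a ball of radius `ρ`. Moreover `ρ ≤ 1` makes the rate `ρ⁻¹` at least one.
  set ρ : ℝ≥0 := min (R / 2) 1 with hρ
  have hρ0 : 0 < ρ := lt_min (half_pos hR0') one_pos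
  have hρR : ρ + ρ ≤ R := by
    calc ρ + ρ ≤ R / 2 + R / 2 := add_le_add (min_le_left _ _) (min_le_left _ _)
      _ = R := add_halves R
  have hr : (ρ : ENNReal) + ρ < r := lt_of_le_of_lt (by exact_mod_cast hρR) hR
  have hrad : (ρ : ENNReal) + ρ < p.radius := hr.trans_le h.r_le
  -- One convergent double series dominates the coefficients of all recentred series at once; its
  -- sum is the uniform constant.
  have hS := p.changeOriginSeries_summable_aux₁ hrad
  set S : ℝ≥0 := ∑' s : Σ k l : ℕ, { s : Finset (Fin (k + l)) // s.card = l },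
      ‖p (s.1 + s.2.1)‖₊ * ρ ^ s.2.1 * ρ ^ s.1 with hSdef
  have hser : ∀ z ∈ ball x (ρ : ℝ), HasFPowerSeriesOnBall f (p.changeOrigin (z - x)) z ρ := by
    intro z hz
    have hz' : ‖z - x‖₊ < ρ := by
      rw [mem_ball, dist_eq_norm] at hz; exact_mod_cast hz
    have h1 : (‖z - x‖₊ : ENNReal) < r :=
      lt_of_lt_of_le (by exact_mod_cast hz') (le_self_add.trans hr.le)
    have h2 := h.changeOrigin h1
    rw [add_sub_cancel] at h2
    refine h2.mono (by exact_mod_cast hρ0) ?_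
    refine ENNReal.le_sub_of_add_le_right (by simp) ((add_le_add le_rfl ?_).trans hr.le)
    exact_mod_cast hz'.le
  have hcoef : ∀ z ∈ ball x (ρ : ℝ), ∀ k, ‖p.changeOrigin (z - x) k‖₊ * ρ ^ k ≤ S := by
    intro z hz k
    have hz' : ‖z - x‖₊ < ρ := by
      rw [mem_ball, dist_eq_norm] at hz; exact_mod_cast hz
    have h1 : (‖z - x‖₊ : ENNReal) < p.radius :=
      lt_of_lt_of_le (by exact_mod_cast hz') (le_self_add.trans hrad.le)
    have hk := (NNReal.summable_sigma.1 hS).1 k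
    calc ‖p.changeOrigin (z - x) k‖₊ * ρ ^ k
        ≤ (∑' s : Σ l : ℕ, { s : Finset (Fin (k + l)) // s.card = l },
            ‖p (k + s.1)‖₊ * ‖z - x‖₊ ^ s.1) * ρ ^ k := by
          gcongr; exact p.nnnorm_changeOrigin_le k h1
      _ = ∑' s : Σ l : ℕ, { s : Finset (Fin (k + l)) // s.card = l },
            ‖p (k + s.1)‖₊ * ‖z - x‖₊ ^ s.1 * ρ ^ k := NNReal.tsum_mul_right _ _ |>.symm
      _ ≤ ∑' s : Σ l : ℕ, { s : Finset (Fin (k + l)) // s.card = l },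
            ‖p (k + s.1)‖₊ * ρ ^ s.1 * ρ ^ k := by
          have hle : ∀ s : Σ l : ℕ, { s : Finset (Fin (k + l)) // s.card = l },
              ‖p (k + s.1)‖₊ * ‖z - x‖₊ ^ s.1 * ρ ^ k ≤ ‖p (k + s.1)‖₊ * ρ ^ s.1 * ρ ^ k :=
            fun s => by gcongr
          exact Summable.tsum_le_tsum hle (NNReal.summable_of_le hle hk) hk
      _ ≤ S := (NNReal.summable_sigma.1 hS).2.le_tsum k (fun _ _ => zero_le) |>.trans
            (le_of_eq (hS.tsum_sigma' (NNReal.summable_sigma.1 hS).1).symm)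
  have hρ1 : (ρ : ℝ) ≤ 1 := by exact_mod_cast min_le_right _ _
  have hρ0' : (0 : ℝ) < ρ := by exact_mod_cast hρ0
  refine ⟨ρ, hρ0', S, (ρ : ℝ)⁻¹, (one_le_inv₀ hρ0').2 hρ1, fun z hz => ⟨?_, fun k => ?_⟩, ?_⟩
  · exact (hser z hz).analyticAt.contDiffAt
  · have h1 : ‖p.changeOrigin (z - x) k‖ * (ρ : ℝ) ^ k ≤ S := by exact_mod_cast hcoef z hz k
    have h2 := norm_iteratedFDeriv_le_of_hasFPowerSeriesOnBall (hser z hz) k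
    rw [inv_pow]
    have h3 : ‖p.changeOrigin (z - x) k‖ ≤ S * ((ρ : ℝ) ^ k)⁻¹ := by
      rw [← div_eq_mul_inv, le_div_iff₀ (by positivity)]; exact h1
    calc _ ≤ (k ! : ℝ) * ‖p.changeOrigin (z - x) k‖ := h2
      _ ≤ (k ! : ℝ) * (S * ((ρ : ℝ) ^ k)⁻¹) := by gcongr
      _ = _ := by ring
  · intro z hz y hy
    refine (hser z hz).hasSum_iteratedFDeriv ?_
    rw [← div_eq_mul_inv, div_lt_one hρ0'] at hy
    simpa [mem_eball_zero_iff, enorm, ← NNReal.coe_lt_coe] using hy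

variable {N : ℕ} {f : X → E}

/-- The `k`-th derivative of `z ↦ f (t • z)` is computed twice: by the chain rule, which brings out
`t ^ k`, and by homogeneity. -/
lemma iteratedFDeriv_smul_of_homogeneous (hom : ∀ t : ℝ, 0 < t → ∀ z, f (t • z) = (t ^ N)⁻¹ • f z)
    {t : ℝ} (ht : 0 < t) (k : ℕ) {x : X} (hx : ContDiffAt ℝ ∞ f x) :
    iteratedFDeriv ℝ k f (t • x) = (t ^ (N + k))⁻¹ • iteratedFDeriv ℝ k f x := by
  have h1 : (fun z => (t ^ N)⁻¹ • f z) = fun z => f (t • z) := funext fun z => (hom t ht z).symm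
  let g : X ≃L[ℝ] X := ContinuousLinearEquiv.smulLeft (Units.mk0 t ht.ne')
  have hg : ∀ z, g z = t • z := fun z => rfl
  have h2 : iteratedFDeriv ℝ k (fun z => f (t • z)) x =
      (iteratedFDeriv ℝ k f (t • x)).compContinuousLinearMap fun _ => (g : X →L[ℝ] X) := by
    have := g.iteratedFDerivWithin_comp_right f uniqueDiffOn_univ (Set.mem_univ (g x)) k
    simp only [Set.preimage_univ, iteratedFDerivWithin_univ] at this
    exact this
  rw [← h1, iteratedFDeriv_const_smul_apply' (hx.of_le (by exact_mod_cast le_top))] at h2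
  ext v
  have h3 := congrArg (fun T => T v) h2
  simp only [smul_apply,
    ContinuousMultilinearMap.compContinuousLinearMap_apply, ContinuousLinearEquiv.coe_coe, hg] at h3
  rw [(iteratedFDeriv ℝ k f (t • x)).map_smul_univ (fun _ => t) v] at h3
  simp only [Finset.prod_const, Finset.card_univ, Fintype.card_fin] at h3
  rw [smul_apply, pow_add, mul_inv, mul_comm, mul_smul, h3,
    smul_smul, inv_mul_cancel₀ (by positivity), one_smul]

/-- Derivative bounds and convergence of Taylor series for homogeneous functions. -/
lemma exists_bound_of_homogeneous [ProperSpace X]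
    (hom : ∀ t : ℝ, 0 < t → ∀ z, f (t • z) = (t ^ N)⁻¹ • f z)
    (han : ∀ z, z ≠ 0 → AnalyticAt ℝ f z) :
    ∃ C A : ℝ, 0 ≤ C ∧ 1 ≤ A ∧
      (∀ z, z ≠ 0 → ∀ k : ℕ, ‖iteratedFDeriv ℝ k f z‖ ≤ C * A ^ k * (k ! : ℝ) * (‖z‖ ^ (N + k))⁻¹) ∧
      (∀ z, z ≠ 0 → ∀ y, ‖y‖ * A < ‖z‖ →
        HasSum (fun k : ℕ => (k ! : ℝ)⁻¹ • iteratedFDeriv ℝ k f z fun _ => y) (f (z + y))) := by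
  have hloc : ∀ u ∈ sphere (0 : X) 1, ∃ δ > 0, ∃ s A, 1 ≤ A ∧ DerivBound (ball u δ) f s A ∧
      ∀ z ∈ ball u δ, ∀ y, ‖y‖ * A < 1 →
      HasSum (fun k : ℕ => (k ! : ℝ)⁻¹ • iteratedFDeriv ℝ k f z fun _ => y) (f (z + y)) :=
    fun u hu => exists_derivBound_of_analyticAt (han u (ne_of_mem_sphere hu one_ne_zero))
  -- Compactness makes the local constants uniform on the unit sphere; homogeneity then carries the
  -- bounds to every `z ≠ 0`.
  have hunif : ∃ C A : ℝ, 0 ≤ C ∧ 1 ≤ A ∧ ∀ z ∈ sphere (0 : X) 1,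
      (∀ k : ℕ, ‖iteratedFDeriv ℝ k f z‖ ≤ C * A ^ k * (k ! : ℝ)) ∧ ∀ y, ‖y‖ * A < 1 →
      HasSum (fun k : ℕ => (k ! : ℝ)⁻¹ • iteratedFDeriv ℝ k f z fun _ => y) (f (z + y)) := by
    refine (isCompact_sphere (0 : X) 1).induction_on (p := fun T => ∃ C A : ℝ, 0 ≤ C ∧ 1 ≤ A ∧
      ∀ z ∈ T, (∀ k : ℕ, ‖iteratedFDeriv ℝ k f z‖ ≤ C * A ^ k * (k ! : ℝ)) ∧ ∀ y, ‖y‖ * A < 1 →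
      HasSum (fun k : ℕ => (k ! : ℝ)⁻¹ • iteratedFDeriv ℝ k f z fun _ => y) (f (z + y)))
      ⟨0, 1, le_rfl, le_rfl, by simp⟩ ?_ ?_ ?_
    · rintro s t hst ⟨C, A, hC, hA, h⟩
      exact ⟨C, A, hC, hA, fun z hz => h z (hst hz)⟩
    · rintro s t ⟨C, A, hC, hA, h⟩ ⟨C', A', hC', hA', h'⟩
      refine ⟨max C C', max A A', le_max_of_le_left hC, le_max_of_le_left hA, ?_⟩
      rintro z (hz | hz)
      · refine ⟨fun k => ((h z hz).1 k).trans ?_, fun y hy => (h z hz).2 y (lt_of_le_of_lt ?_ hy)⟩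
        · gcongr <;> exact le_max_left _ _
        · gcongr; exact le_max_left _ _
      · refine ⟨fun k => ((h' z hz).1 k).trans ?_, fun y hy => (h' z hz).2 y (lt_of_le_of_lt ?_ hy)⟩
        · gcongr <;> exact le_max_right _ _
        · gcongr; exact le_max_right _ _
    · intro u hu
      obtain ⟨δ, hδ, s, A, hA, h1, h2⟩ := hloc u hu
      refine ⟨_, mem_nhdsWithin_of_mem_nhds (ball_mem_nhds u hδ), s, A,
        h1.nonneg ⟨u, mem_ball_self hδ⟩, hA, fun z hz => ⟨(h1 z hz).2, h2 z hz⟩⟩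
  obtain ⟨C, A, hC, hA, h⟩ := hunif
  have hscale : ∀ z : X, z ≠ 0 → ∃ u ∈ sphere (0 : X) 1, z = ‖z‖ • u := by
    intro z hz
    have hz' := norm_pos_iff.2 hz
    refine ⟨‖z‖⁻¹ • z, ?_, ?_⟩
    · rw [mem_sphere_zero_iff_norm, norm_smul, norm_inv, norm_norm, inv_mul_cancel₀ hz'.ne']
    · rw [smul_smul, mul_inv_cancel₀ hz'.ne', one_smul]
  refine ⟨C, A, hC, hA, fun z hz k => ?_, fun z hz y hy => ?_⟩
  · obtain ⟨u, hu, hzu⟩ := hscale z hz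
    have hz' := norm_pos_iff.2 hz
    have h1 := iteratedFDeriv_smul_of_homogeneous hom hz' k
      (han u (ne_of_mem_sphere hu one_ne_zero)).contDiffAt
    rw [← hzu] at h1
    rw [h1, norm_smul, norm_inv, norm_pow, norm_norm, mul_comm]
    gcongr
    exact (h u hu).1 k
  · obtain ⟨u, hu, hzu⟩ := hscale z hz
    have hz' := norm_pos_iff.2 hz
    have h2 : ‖‖z‖⁻¹ • y‖ * A < 1 := by
      rw [norm_smul, norm_inv, norm_norm, mul_assoc, inv_mul_lt_iff₀ hz', mul_one]; exact hy
    have h3 := ((h u hu).2 _ h2).const_smul ((‖z‖ ^ N)⁻¹)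
    have h4 : (‖z‖ ^ N)⁻¹ • f (u + ‖z‖⁻¹ • y) = f (z + y) := by
      rw [← hom _ hz', smul_add, ← hzu, smul_smul, mul_inv_cancel₀ hz'.ne', one_smul]
    rw [h4] at h3
    convert h3 using 1
    funext k
    have h1 := iteratedFDeriv_smul_of_homogeneous hom hz' k
      (han u (ne_of_mem_sphere hu one_ne_zero)).contDiffAt
    rw [← hzu] at h1
    rw [h1, (iteratedFDeriv ℝ k f u).map_smul_univ (fun _ => ‖z‖⁻¹) fun _ => y]
    simp only [Finset.prod_const, Finset.card_univ, Fintype.card_fin,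
      smul_apply]
    rw [smul_comm ((‖z‖ ^ N)⁻¹), smul_smul ((‖z‖ ^ N)⁻¹), inv_pow, ← mul_inv, ← pow_add]

end Analytic

end CliffordCylinder

open scoped Topology
namespace CliffordCylinder
open scoped ContDiff Nat
open Metric MeasureTheory

/-! ### The divergence theorem and integration by parts for the Dirac operator -/

/-- The integrals over opposite faces cancel. The divergence theorem in use asks for a
differentiable field with integrable divergence, not for continuous partial derivatives; this
matters because monogenic functions are only assumed differentiable. It serves both for fields of
compact support and for periodic ones. -/
lemma integral_divergence_eq_zero {E : Type*} [NormedAddCommGroup E] [NormedSpace ℝ E] {n : ℕ}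
    (hn : 1 ≤ n) {a b : Fin n → ℝ} (hab : a ≤ b) (g : Fin n → (Fin n → ℝ) → E)
    (g' : Fin n → (Fin n → ℝ) → (Fin n → ℝ) →L[ℝ] E)
    (hg : ∀ x ∈ Set.Icc a b, ∀ i, HasFDerivAt (g i) (g' i x) x)
    (hint : IntegrableOn (fun x => ∑ i, g' i x (Pi.single i 1)) (Set.Icc a b))
    (hface : ∀ i, ∀ x ∈ Set.Icc a b, ∀ y ∈ Set.Icc a b, x i = a i → y i = b i →
      (∀ q, q ≠ i → x q = y q) → g i x = g i y) :
    ∫ x in Set.Icc a b, ∑ i, g' i x (Pi.single i 1) = 0 := by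
  obtain ⟨n, rfl⟩ : ∃ n', n = n' + 1 := ⟨n - 1, by omega⟩
  rw [integral_divergence_of_hasFDerivAt_off_countable' a b hab g g' ∅ Set.countable_empty
    (fun i x hx => (hg x hx i).continuousAt.continuousWithinAt)
    (fun x hx i => hg x ?_ i) hint]
  · refine Finset.sum_eq_zero fun i _ => ?_
    rw [sub_eq_zero]
    refine setIntegral_congr_fun measurableSet_Icc fun x hx => ?_
    have hmem : ∀ c ∈ Set.Icc (a i) (b i), (i.insertNth c x : Fin (n + 1) → ℝ) ∈ Set.Icc a b := by
      intro c hc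
      constructor
      · intro q
        refine Fin.succAboveCases i ?_ (fun q => ?_) q
        · simpa using hc.1
        · simpa using hx.1 q
      · intro q
        refine Fin.succAboveCases i ?_ (fun q => ?_) q
        · simpa using hc.2
        · simpa using hx.2 q
    refine (hface i _ (hmem _ ⟨le_rfl, hab i⟩) _ (hmem _ ⟨hab i, le_rfl⟩) (by simp) (by simp) ?_).symm
    intro q hq
    obtain ⟨q, rfl⟩ := Fin.exists_succAbove_eq hq
    simp
  · have := hx.1
    rw [Set.mem_univ_pi] at this
    exact ⟨fun i => (this i).1.le, fun i => (this i).2.le⟩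

variable {n : ℕ}

lemma integral_eq_integral_toLp {E : Type*} [NormedAddCommGroup E] [NormedSpace ℝ E]
    (f : V n → E) : ∫ x, f x = ∫ y : Fin n → ℝ, f (WithLp.toLp 2 y) := by
  exact ((PiLp.volume_preserving_toLp (Fin n)).integral_comp
    (MeasurableEquiv.toLp 2 (Fin n → ℝ)).measurableEmbedding f).symm

lemma integral_div_eq_zero_of_hasCompactSupport (hn : 1 ≤ n) (X : Fin n → V n → Cl n)
    (hX : ∀ i, Differentiable ℝ (X i)) (hc : ∀ i, HasCompactSupport (X i))
    (hdiv : Continuous fun x => ∑ i, fderiv ℝ (X i) x (stdVec i)) :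
    ∫ x, ∑ i, fderiv ℝ (X i) x (stdVec i) = 0 := by
  obtain ⟨R, hR0, hR⟩ : ∃ R > 0, ∀ i x, R ≤ ‖x‖ → X i x = 0 := by
    have h1 : ∀ i, ∃ R : ℝ, ∀ x, R ≤ ‖x‖ → X i x = 0 := by
      intro i
      obtain ⟨R, hR⟩ := (hc i).isBounded.subset_ball (0 : V n)
      refine ⟨R, fun x hx => ?_⟩
      by_contra h
      have := hR (subset_tsupport _ h)
      rw [mem_ball_zero_iff] at this
      linarith
    choose R hR using h1
    refine ⟨∑ i, |R i| + 1, by positivity, fun i x hx => hR i x ?_⟩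
    have h2 : |R i| ≤ ∑ i, |R i| := Finset.single_le_sum (f := fun i => |R i|) (fun _ _ => abs_nonneg _)
      (Finset.mem_univ i)
    linarith [le_abs_self (R i)]
  let T : (Fin n → ℝ) →L[ℝ] V n := (PiLp.continuousLinearEquiv 2 ℝ fun _ : Fin n => ℝ).symm
  have hT : ∀ y, T y = WithLp.toLp 2 y := fun y => rfl
  have hTs : ∀ i, T (Pi.single i 1) = stdVec i := by
    intro i; rw [hT]; rfl
  have hTn : ∀ y i, |y i| ≤ ‖T y‖ := by
    intro y i
    simpa [hT] using EuclideanSpace.norm_eq (T y) ▸ PiLp.norm_apply_le (T y) i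
  rw [integral_eq_integral_toLp]
  have hz : ∀ x : V n, R < ‖x‖ → ∑ i, fderiv ℝ (X i) x (stdVec i) = 0 := by
    intro x hx
    refine Finset.sum_eq_zero fun i _ => ?_
    have : X i =ᶠ[𝓝 x] fun _ => 0 := by
      filter_upwards [(isOpen_lt continuous_const continuous_norm).mem_nhds hx] with y hy
      exact hR i y (le_of_lt hy)
    rw [this.fderiv_eq]; simp
  have h0 := integral_divergence_eq_zero hn (a := fun _ => -(R + 1)) (b := fun _ => R + 1)
    (fun _ => by linarith) (fun i y => X i (T y)) (fun i y => (fderiv ℝ (X i) (T y)).comp T)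
    (fun y _ i => (hX i (T y)).hasFDerivAt.comp y T.hasFDerivAt) ?_ ?_
  · rw [← setIntegral_eq_integral_of_forall_compl_eq_zero
      (s := Set.Icc (fun _ => -(R + 1)) fun _ => R + 1), ← h0]
    · refine setIntegral_congr_fun measurableSet_Icc fun y _ => ?_
      simp only [ContinuousLinearMap.comp_apply, hTs, hT]
    · intro y hy
      apply hz
      obtain ⟨i, hi⟩ : ∃ i, ¬ (-(R + 1) ≤ y i ∧ y i ≤ R + 1) := by
        by_contra! h
        exact hy ⟨fun i => (h i).1, fun i => (h i).2⟩
      have : R + 1 < |y i| := by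
        by_contra h
        exact hi (abs_le.1 (not_lt.1 h))
      have := hTn y i
      rw [← hT]
      linarith
  · refine ContinuousOn.integrableOn_Icc (Continuous.continuousOn ?_)
    have : Continuous fun y => ∑ i, fderiv ℝ (X i) (T y) (stdVec i) := hdiv.comp T.continuous
    simpa [hTs] using this
  · intro i x _ y _ hx hy _
    have h1 := hTn x i
    have h2 := hTn y i
    rw [hx, abs_neg, abs_of_pos (by linarith)] at h1
    rw [hy, abs_of_pos (by linarith)] at h2
    change X i (T x) = X i (T y)
    rw [hR i _ (by linarith), hR i _ (by linarith)]

/-- The Dirac operator acting from the right. -/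
noncomputable def rdirac (f : V n → Cl n) (x : V n) : Cl n := ∑ i, partialDeriv i f x * e i

lemma hasFDerivAt_mul {f g : V n → Cl n} {f' g' : V n →L[ℝ] Cl n} {x : V n}
    (hf : HasFDerivAt f f' x) (hg : HasFDerivAt g g' x) :
    HasFDerivAt (fun y => f y * g y) ((mulL (f x)).comp g' + (mulR (g x)).comp f') x := by
  have h := (mulL : Cl n →L[ℝ] _).isBoundedBilinearMap.hasFDerivAt (f x, g x)
  have h2 := h.comp x (hf.prodMk hg)
  refine (h2.congr_fderiv ?_)
  ext v
  simp [ContinuousLinearMap.comp_apply]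

lemma continuous_cl_mul {X : Type*} [TopologicalSpace X] {f g : X → Cl n} (hf : Continuous f)
    (hg : Continuous g) : Continuous fun x => f x * g x :=
  (mulL : Cl n →L[ℝ] _).isBoundedBilinearMap.continuous.comp (hf.prodMk hg)

lemma hasCompactSupport_dirac {f : V n → Cl n} (hf : HasCompactSupport f) :
    HasCompactSupport (dirac f) := by
  refine HasCompactSupport.intro hf.isCompact fun x hx => ?_
  have : f =ᶠ[𝓝 x] fun _ => 0 := notMem_tsupport_iff_eventuallyEq.1 hx
  simp [dirac, partialDeriv, this.fderiv_eq]

/-- Integration by parts for the Dirac operator; `F` need not be continuously differentiable. -/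
lemma integral_rdirac_mul_add_mul_dirac (hn : 1 ≤ n) {w F : V n → Cl n} (hw : ContDiff ℝ 1 w)
    (hF : Differentiable ℝ F) (hc : HasCompactSupport F) (hD : Continuous (dirac F)) :
    (∫ x, rdirac w x * F x) + ∫ x, w x * dirac F x = 0 := by
  have hwd : ∀ x, HasFDerivAt w (fderiv ℝ w x) x :=
    fun x => (hw.differentiable (by simp) x).hasFDerivAt
  have hder : ∀ i x, HasFDerivAt (fun y => w y * (e i * F y))
      ((mulL (w x)).comp ((mulL (e i)).comp (fderiv ℝ F x)) +
        (mulR (e i * F x)).comp (fderiv ℝ w x)) x := fun i x =>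
    hasFDerivAt_mul (hwd x) ((mulL (e i)).hasFDerivAt.comp x (hF x).hasFDerivAt)
  have hrc : Continuous (rdirac w) := by
    refine continuous_finsetSum _ fun i _ => continuous_cl_mul ?_ continuous_const
    exact (hw.continuous_fderiv (by simp)).clm_apply continuous_const
  have hsum : ∀ x, ∑ i, fderiv ℝ (fun y => w y * (e i * F y)) x (stdVec i) =
      rdirac w x * F x + w x * dirac F x := by
    intro x
    have : ∀ i, fderiv ℝ (fun y => w y * (e i * F y)) x (stdVec i) =
        w x * (e i * partialDeriv i F x) + partialDeriv i w x * e i * F x := by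
      intro i
      rw [(hder i x).fderiv]
      simp [partialDeriv, mul_assoc]
    simp_rw [this, Finset.sum_add_distrib, rdirac, dirac, Finset.sum_mul, Finset.mul_sum]
    rw [add_comm]
  have hcont : Continuous fun x => rdirac w x * F x + w x * dirac F x :=
    (continuous_cl_mul hrc hF.continuous).add (continuous_cl_mul hw.continuous hD)
  rw [← integral_add]
  · simp_rw [← hsum]
    refine integral_div_eq_zero_of_hasCompactSupport hn _ (fun i x => (hder i x).differentiableAt)
      (fun i => ?_) (by simpa only [hsum] using hcont)
    refine HasCompactSupport.intro hc.isCompact fun x hx => ?_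
    simp [image_eq_zero_of_notMem_tsupport hx]
  · refine (continuous_cl_mul hrc hF.continuous).integrable_of_hasCompactSupport ?_
    refine HasCompactSupport.intro hc.isCompact fun x hx => ?_
    simp [image_eq_zero_of_notMem_tsupport hx]
  · refine (continuous_cl_mul hw.continuous hD).integrable_of_hasCompactSupport ?_
    refine HasCompactSupport.intro (hasCompactSupport_dirac hc).isCompact fun x hx => ?_
    simp [image_eq_zero_of_notMem_tsupport hx]

/-! ### Regularized kernels -/

/-- The Cauchy kernel with `‖x‖ ^ 2` replaced by `c + ‖x‖ ^ 2`. -/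
noncomputable def regG (c : ℝ) (x : V n) : Cl n := ((c + ‖x‖ ^ 2) ^ (-(n : ℝ) / 2)) • vec x

/-- The Green kernel with `‖x‖ ^ 2` replaced by `c + ‖x‖ ^ 2`. -/
noncomputable def regH (c : ℝ) (x : V n) : Cl n :=
  ((c + ‖x‖ ^ 2) ^ (-((n : ℝ) - 2) / 2)) • (1 : Cl n)

/-- The embedding of `ℝⁿ` into `Cl_n` as a continuous linear map. -/
noncomputable def vecL : V n →L[ℝ] Cl n := (CliffordAlgebra.ι (Q n)).toContinuousLinearMap

@[simp] lemma vecL_apply (x : V n) : vecL x = vec x := rfl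

lemma rpow_neg_div_two_eq {r : ℝ} (hr : 0 ≤ r) (N : ℕ) :
    (r ^ 2 : ℝ) ^ (-(N : ℝ) / 2) = (r ^ N)⁻¹ := by
  rw [← Real.rpow_natCast r 2, ← Real.rpow_mul hr]
  have : ((2 : ℕ) : ℝ) * (-(N : ℝ) / 2) = -(N : ℝ) := by push_cast; ring
  rw [this, Real.rpow_neg hr, Real.rpow_natCast]

lemma regG_zero (x : V n) : regG 0 x = G x := by
  rw [regG, zero_add, rpow_neg_div_two_eq (norm_nonneg x), G]

lemma regH_zero (hn : 2 ≤ n) (x : V n) : regH 0 x = H x := by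
  have h := rpow_neg_div_two_eq (norm_nonneg x) (n - 2)
  rw [Nat.cast_sub hn] at h
  rw [regH, zero_add, H, Algebra.algebraMap_eq_smul_one]
  push_cast at h
  rw [h]

lemma hasFDerivAt_add_norm_sq_rpow {c : ℝ} {x : V n} (hs : 0 < c + ‖x‖ ^ 2) (p : ℝ) :
    HasFDerivAt (fun y : V n => (c + ‖y‖ ^ 2) ^ p)
      ((2 * p * (c + ‖x‖ ^ 2) ^ (p - 1)) • innerSL ℝ x) x := by
  have h1 : HasFDerivAt (fun y : V n => c + ‖y‖ ^ 2) (2 • innerSL ℝ x) x :=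
    (hasStrictFDerivAt_norm_sq x).hasFDerivAt.const_add c
  refine (h1.rpow_const (p := p) (Or.inl hs.ne')).congr_fderiv ?_
  ext v
  simp
  ring

lemma sum_smul_e (x : V n) : ∑ i, x i • (e i : Cl n) = vec x := by
  conv_rhs => rw [vec, ← (EuclideanSpace.basisFun (Fin n) ℝ).sum_repr x]
  simp [e, vec, stdVec]

lemma vec_mul_self (x : V n) : (vec x * vec x : Cl n) = (-‖x‖ ^ 2) • 1 := by
  rw [vec, CliffordAlgebra.ι_sq_scalar, Q_apply, Algebra.algebraMap_eq_smul_one]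

lemma innerSL_stdVec (x : V n) (i : Fin n) : innerSL ℝ x (stdVec i) = x i := by
  simp [stdVec, EuclideanSpace.inner_single_right]

lemma partialDeriv_regG {c : ℝ} {x : V n} (hs : 0 < c + ‖x‖ ^ 2) (i : Fin n) :
    partialDeriv i (regG c) x = (c + ‖x‖ ^ 2) ^ (-(n : ℝ) / 2) • e i -
      (n * (c + ‖x‖ ^ 2) ^ (-(n : ℝ) / 2 - 1) * x i) • vec x := by
  have h := (hasFDerivAt_add_norm_sq_rpow hs (-(n : ℝ) / 2)).smul (vecL (n := n)).hasFDerivAt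
  have h2 : HasFDerivAt (regG c) _ x := h
  rw [partialDeriv, h2.fderiv]
  simp only [vecL_apply, add_apply, smul_apply, innerSL_stdVec,
    ContinuousLinearMap.smulRight_apply, smul_eq_mul, sub_eq_add_neg, ← neg_smul]
  congr 2
  ring

/-- The square of the vector `x` is `-‖x‖ ^ 2`, so the two contributions combine to a multiple of
`c`. At `c = 0` this is the monogenicity of `G` off the origin; for `c > 0` it is minus an
approximate identity, up to its total mass. -/
lemma rdirac_regG {c : ℝ} {x : V n} (hs : 0 < c + ‖x‖ ^ 2) :
    rdirac (regG c) x = (-(n * c * (c + ‖x‖ ^ 2) ^ (-(n : ℝ) / 2 - 1))) • (1 : Cl n) ∧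
    dirac (regG c) x = (-(n * c * (c + ‖x‖ ^ 2) ^ (-(n : ℝ) / 2 - 1))) • (1 : Cl n) := by
  have hp : (c + ‖x‖ ^ 2) ^ (-(n : ℝ) / 2) =
      (c + ‖x‖ ^ 2) * (c + ‖x‖ ^ 2) ^ (-(n : ℝ) / 2 - 1) := by
    rw [Real.rpow_sub_one hs.ne']; field_simp
  have key : (∑ i : Fin n, (c + ‖x‖ ^ 2) ^ (-(n : ℝ) / 2) • (-1 : Cl n)) -
      (n * (c + ‖x‖ ^ 2) ^ (-(n : ℝ) / 2 - 1)) • (vec x * vec x : Cl n) =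
      (-(n * c * (c + ‖x‖ ^ 2) ^ (-(n : ℝ) / 2 - 1))) • (1 : Cl n) := by
    rw [vec_mul_self, Finset.sum_const, Finset.card_univ, Fintype.card_fin, hp, smul_neg, smul_smul,
      ← neg_smul, ← Nat.cast_smul_eq_nsmul ℝ, smul_smul, ← sub_smul]
    congr 1
    ring
  constructor
  · rw [← key, rdirac]
    simp_rw [partialDeriv_regG hs, sub_mul, Finset.sum_sub_distrib, smul_mul_assoc, e_mul_self,
      mul_smul, ← Finset.smul_sum]
    congr 3
    conv_rhs => rw [← sum_smul_e x]
    rw [sum_smul_e, ← sum_smul_e x, Finset.mul_sum]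
    refine Finset.sum_congr rfl fun i _ => ?_
    rw [sum_smul_e, mul_smul_comm]
  · rw [← key, dirac]
    simp_rw [partialDeriv_regG hs, mul_sub, Finset.sum_sub_distrib, mul_smul_comm, e_mul_self,
      mul_smul, ← Finset.smul_sum]
    congr 3
    conv_rhs => rw [← sum_smul_e x, Finset.sum_mul]
    simp_rw [smul_mul_assoc, sum_smul_e]

lemma partialDeriv_regH {c : ℝ} {x : V n} (hs : 0 < c + ‖x‖ ^ 2) (i : Fin n) :
    partialDeriv i (regH c) x =
      (-((n : ℝ) - 2) * (c + ‖x‖ ^ 2) ^ (-(n : ℝ) / 2) * x i) • (1 : Cl n) := by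
  have h := (hasFDerivAt_add_norm_sq_rpow hs (-((n : ℝ) - 2) / 2)).smul_const (1 : Cl n)
  have h2 : HasFDerivAt (regH c) _ x := h
  rw [partialDeriv, h2.fderiv]
  simp only [smul_apply, innerSL_stdVec, ContinuousLinearMap.smulRight_apply, smul_eq_mul]
  congr 1
  have : -((n : ℝ) - 2) / 2 - 1 = -(n : ℝ) / 2 := by ring
  rw [this]
  ring

/-- This links the two kernels: one integration by parts reduces the second order formula to the
first order one. -/
lemma rdirac_regH {c : ℝ} {x : V n} (hs : 0 < c + ‖x‖ ^ 2) :
    rdirac (regH c) x = (-((n : ℝ) - 2)) • regG c x := by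
  simp_rw [rdirac, partialDeriv_regH hs, smul_mul_assoc, one_mul, mul_smul, ← Finset.smul_sum,
    sum_smul_e, regG]

end CliffordCylinder

open scoped Topology
namespace CliffordCylinder
open scoped ContDiff Nat
open Metric MeasureTheory Filter

variable {n : ℕ}

/-! ### The representation formulas -/

/-- The total mass of the approximate identity. -/
noncomputable def poissonMass (n : ℕ) : ℝ := ∫ z : V n, n * (1 + ‖z‖ ^ 2) ^ (-(n : ℝ) / 2 - 1)

lemma integrable_poisson (n : ℕ) :
    Integrable fun z : V n => n * (1 + ‖z‖ ^ 2) ^ (-(n : ℝ) / 2 - 1) := by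
  have h := integrable_rpow_neg_one_add_norm_sq (E := V n) (μ := volume) (r := n + 2)
    (by simp)
  have h2 : -((n : ℝ) + 2) / 2 = -(n : ℝ) / 2 - 1 := by ring
  rw [h2] at h
  exact h.const_mul _

lemma poissonMass_pos (hn : 1 ≤ n) : 0 < poissonMass n := by
  have hn' : (0 : ℝ) < n := by exact_mod_cast hn
  have hpos : ∀ z : V n, 0 < n * (1 + ‖z‖ ^ 2) ^ (-(n : ℝ) / 2 - 1) := fun z => by positivity
  rw [poissonMass, integral_pos_iff_support_of_nonneg (fun z => (hpos z).le) (integrable_poisson n)]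
  have : (Function.support fun z : V n => n * (1 + ‖z‖ ^ 2) ^ (-(n : ℝ) / 2 - 1)) = Set.univ := by
    ext z; simpa using (hpos z).ne'
  rw [this]
  exact isOpen_univ.measure_pos _ Set.univ_nonempty

/-- With `ε = 1 / (m + 1)`, the substitution `y = x - ε • z` turns the weights into one fixed
integrable density against `F (x - ε • z)`; dominated convergence applies since `F` is bounded. -/
lemma tendsto_poisson_integral {F : V n → Cl n} (hF : Continuous F) (hc : HasCompactSupport F)
    (x : V n) :
    Tendsto (fun m : ℕ => ∫ y, (n * (1 / ((m : ℝ) + 1)) ^ 2 *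
      ((1 / ((m : ℝ) + 1)) ^ 2 + ‖x - y‖ ^ 2) ^ (-(n : ℝ) / 2 - 1)) • F y) atTop
      (𝓝 (poissonMass n • F x)) := by
  obtain ⟨M, hM⟩ := hF.bounded_above_of_compact_support hc
  have hsub : ∀ m : ℕ, ∫ y, (n * (1 / ((m : ℝ) + 1)) ^ 2 *
      ((1 / ((m : ℝ) + 1)) ^ 2 + ‖x - y‖ ^ 2) ^ (-(n : ℝ) / 2 - 1)) • F y =
      ∫ z, (n * (1 + ‖z‖ ^ 2) ^ (-(n : ℝ) / 2 - 1)) • F (x - (1 / ((m : ℝ) + 1)) • z) := by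
    intro m
    set ε : ℝ := 1 / ((m : ℝ) + 1) with hε
    have hε0 : 0 < ε := by positivity
    set f : V n → Cl n := fun z =>
      (n * ε ^ 2 * (ε ^ 2 + ‖z‖ ^ 2) ^ (-(n : ℝ) / 2 - 1)) • F (x - z) with hf
    have h1 : ∫ y, (n * ε ^ 2 * (ε ^ 2 + ‖x - y‖ ^ 2) ^ (-(n : ℝ) / 2 - 1)) • F y = ∫ z, f z := by
      rw [← integral_sub_left_eq_self f volume x]
      simp [hf]
    have h2 := Measure.integral_comp_smul volume f ε
    have h3 : ∀ z, f (ε • z) =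
        (ε ^ n)⁻¹ • ((n * (1 + ‖z‖ ^ 2) ^ (-(n : ℝ) / 2 - 1)) • F (x - ε • z)) := by
      intro z
      rw [smul_smul]
      simp only [hf]
      congr 1
      have h4 : ε ^ 2 + ‖ε • z‖ ^ 2 = ε ^ 2 * (1 + ‖z‖ ^ 2) := by
        rw [norm_smul, Real.norm_eq_abs, mul_pow, sq_abs]; ring
      have h5 : (ε ^ 2) ^ (-(n : ℝ) / 2 - 1) = (ε ^ n)⁻¹ * (ε ^ 2)⁻¹ := by
        rw [Real.rpow_sub_one (by positivity), rpow_neg_div_two_eq hε0.le, div_eq_mul_inv]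
      rw [h4, Real.mul_rpow (by positivity) (by positivity), h5]
      field_simp
    simp_rw [h3] at h2
    rw [integral_smul, finrank_euclideanSpace_fin, abs_of_pos (by positivity)] at h2
    rw [h1]
    exact (smul_right_injective _ (inv_ne_zero (pow_pos hε0 n).ne') h2).symm
  simp_rw [hsub]
  rw [poissonMass, ← integral_smul_const]
  refine tendsto_integral_of_dominated_convergence
    (fun z => n * (1 + ‖z‖ ^ 2) ^ (-(n : ℝ) / 2 - 1) * M) (fun m => ?_)
    ((integrable_poisson n).mul_const M) (fun m => Eventually.of_forall fun z => ?_)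
    (Eventually.of_forall fun z => ?_)
  · refine AEStronglyMeasurable.smul (integrable_poisson n).aestronglyMeasurable ?_
    exact (hF.comp (by fun_prop)).aestronglyMeasurable
  · rw [norm_smul, Real.norm_of_nonneg (by positivity)]
    gcongr
    exact hM _
  · refine Tendsto.const_smul ?_ _
    have h1 : Tendsto (fun m : ℕ => x - (1 / ((m : ℝ) + 1)) • z) atTop (𝓝 (x - (0 : ℝ) • z)) :=
      (tendsto_one_div_add_atTop_nhds_zero_nat.smul_const z).const_sub x
    rw [zero_smul, sub_zero] at h1
    exact (hF.tendsto x).comp h1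

/-- Passage to the limit in integrals against regularized kernels, off the singularity. -/
lemma tendsto_integral_regularized {Kr : ℝ → V n → Cl n} {g : V n → Cl n} (hg : Continuous g)
    (hc : HasCompactSupport g) {x : V n} (hx : ∀ᶠ y in 𝓝 x, g y = 0)
    (hK : ∀ m : ℕ, Continuous (Kr ((1 / ((m : ℝ) + 1)) ^ 2)))
    (hlim : ∀ z, z ≠ 0 → Tendsto (fun c => Kr c z) (𝓝 0) (𝓝 (Kr 0 z)))
    (hbd : ∀ δ > 0, ∀ R, ∃ B, ∀ c ≥ 0, ∀ z : V n, δ ≤ ‖z‖ → ‖z‖ ≤ R → ‖Kr c z‖ ≤ B) :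
    Tendsto (fun m : ℕ => ∫ y, Kr ((1 / ((m : ℝ) + 1)) ^ 2) (x - y) * g y) atTop
      (𝓝 (∫ y, Kr 0 (x - y) * g y)) := by
  obtain ⟨δ, hδ, hδ'⟩ := Metric.eventually_nhds_iff_ball.1 hx
  obtain ⟨R, hR⟩ := hc.isBounded.subset_closedBall x
  obtain ⟨B, hB⟩ := hbd δ hδ R
  have hgood : ∀ y, g y ≠ 0 → δ ≤ ‖x - y‖ ∧ ‖x - y‖ ≤ R := by
    intro y hy
    constructor
    · by_contra h
      refine hy (hδ' y ?_)
      rw [mem_ball, dist_comm, dist_eq_norm]; linarith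
    · have := hR (subset_tsupport _ hy)
      rwa [mem_closedBall, dist_comm, dist_eq_norm] at this
  refine tendsto_integral_of_dominated_convergence
    (fun y => ‖(mulL : Cl n →L[ℝ] _)‖ * B * ‖g y‖) (fun m => ?_)
    ((hg.integrable_of_hasCompactSupport hc).norm.const_mul _)
    (fun m => Eventually.of_forall fun y => ?_) (Eventually.of_forall fun y => ?_)
  · exact (continuous_cl_mul ((hK m).comp (by fun_prop)) hg).aestronglyMeasurable
  · by_cases hy : g y = 0
    · simp [hy]
    · refine (norm_mul_le_mulL _ _).trans ?_
      gcongr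
      exact hB _ (by positivity) _ (hgood y hy).1 (hgood y hy).2
  · by_cases hy : g y = 0
    · simp [hy]
    · have hne : x - y ≠ 0 := norm_pos_iff.1 (hδ.trans_le (hgood y hy).1)
      have h1 : Tendsto (fun m : ℕ => ((1 : ℝ) / ((m : ℝ) + 1)) ^ 2) atTop (𝓝 0) := by
        simpa using (tendsto_one_div_add_atTop_nhds_zero_nat (𝕜 := ℝ)).pow 2
      exact ((mulR (g y)).continuous.tendsto _).comp ((hlim _ hne).comp h1)

lemma rpow_add_sq_le {δ c p : ℝ} (hδ : 0 < δ) (hc : 0 ≤ c) (hp : p ≤ 0) {z : V n}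
    (hz : δ ≤ ‖z‖) : ‖(c + ‖z‖ ^ 2) ^ p‖ ≤ (δ ^ 2) ^ p := by
  have h0 : δ ^ 2 ≤ c + ‖z‖ ^ 2 := by
    have : δ ^ 2 ≤ ‖z‖ ^ 2 := by gcongr
    linarith
  have h1 : 0 < c + ‖z‖ ^ 2 := lt_of_lt_of_le (by positivity) h0
  rw [Real.norm_of_nonneg (by positivity)]
  exact Real.rpow_le_rpow_of_nonpos (by positivity) h0 hp

lemma tendsto_add_sq_rpow (p : ℝ) {z : V n} (hz : z ≠ 0) :
    Tendsto (fun c : ℝ => (c + ‖z‖ ^ 2) ^ p) (𝓝 0) (𝓝 ((0 + ‖z‖ ^ 2) ^ p)) := by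
  have hz' := norm_pos_iff.2 hz
  have h1 : Tendsto (fun c : ℝ => c + ‖z‖ ^ 2) (𝓝 0) (𝓝 (0 + ‖z‖ ^ 2)) :=
    tendsto_id.add_const _
  exact h1.rpow_const (Or.inl (by positivity))

lemma contDiff_add_sq_rpow {c : ℝ} (hc : 0 < c) (p : ℝ) {r : WithTop ℕ∞} :
    ContDiff ℝ r fun z : V n => (c + ‖z‖ ^ 2) ^ p := by
  refine ContDiff.rpow_const_of_ne (contDiff_const.add (contDiff_norm_sq ℝ)) fun z => ?_
  positivity

lemma contDiff_regG {c : ℝ} (hc : 0 < c) : ContDiff ℝ 1 (regG c : V n → Cl n) :=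
  (contDiff_add_sq_rpow hc _).smul (vecL (n := n)).contDiff

lemma contDiff_regH {c : ℝ} (hc : 0 < c) : ContDiff ℝ 1 (regH c : V n → Cl n) :=
  ContDiff.smul (f := fun z : V n => (c + ‖z‖ ^ 2) ^ (-((n : ℝ) - 2) / 2))
    (g := fun _ => (1 : Cl n)) (contDiff_add_sq_rpow hc _) contDiff_const

lemma rdirac_comp_sub {f : V n → Cl n} (hf : ContDiff ℝ 1 f) (x y : V n) :
    rdirac (fun y => f (x - y)) y = -rdirac f (x - y) := by
  have h : ∀ i, partialDeriv i (fun y => f (x - y)) y = -partialDeriv i f (x - y) := by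
    intro i
    have h1 : HasFDerivAt (fun y => x - y) (-ContinuousLinearMap.id ℝ (V n)) y :=
      (hasFDerivAt_id y).const_sub x
    have h2 := ((hf.differentiable (by simp) (x - y)).hasFDerivAt.comp y h1).fderiv
    simp only [Function.comp_def] at h2
    simp only [partialDeriv, h2]
    simp
  simp only [rdirac, h, neg_mul, Finset.sum_neg_distrib]

lemma poisson_integral_eq (hn : 1 ≤ n) {F : V n → Cl n} (hF : Differentiable ℝ F)
    (hc : HasCompactSupport F) (hD : Continuous (dirac F)) (x : V n) {c : ℝ} (hc0 : 0 < c) :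
    ∫ y, (n * c * (c + ‖x - y‖ ^ 2) ^ (-(n : ℝ) / 2 - 1)) • F y =
      -∫ y, regG c (x - y) * dirac F y := by
  have h := integral_rdirac_mul_add_mul_dirac hn
    (w := fun y => regG c (x - y)) ((contDiff_regG hc0).comp (by fun_prop)) hF hc hD
  rw [eq_neg_iff_add_eq_zero, ← h]
  congr 1
  refine integral_congr_ae (Eventually.of_forall fun y => ?_)
  simp only
  rw [rdirac_comp_sub (contDiff_regG hc0), (rdirac_regG (by positivity)).1, ← neg_smul, neg_neg, smul_mul_assoc,
    one_mul]

/-- Both sides of `poisson_integral_eq` converge as the regularization is removed. Since `dirac F`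
vanishes near `x`, the singularity of the kernel never meets the density, and no singular integral
or integral over small spheres occurs. Differentiability of `F` together with continuity of `dirac
F` is enough, which is what the regularity of monogenic functions requires. -/
theorem dirac_representation (hn : 2 ≤ n) {F : V n → Cl n} (hF : Differentiable ℝ F)
    (hc : HasCompactSupport F) (hD : Continuous (dirac F)) {x : V n}
    (hx : ∀ᶠ y in 𝓝 x, dirac F y = 0) :
    (-poissonMass n) • F x = ∫ y, G (x - y) * dirac F y := by
  have h1 := tendsto_poisson_integral hF.continuous hc x
  have h2 := tendsto_integral_regularized (Kr := regG) hD (hasCompactSupport_dirac hc) hx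
    (fun m => (contDiff_regG (by positivity)).continuous)
    (fun z hz => (tendsto_add_sq_rpow _ hz).smul_const _)
    (fun δ hδ R => ⟨(δ ^ 2) ^ (-(n : ℝ) / 2) * (‖(vecL (n := n))‖ * R), fun c hc0 z hz hz' => by
      rw [regG, norm_smul]
      have hp : -(n : ℝ) / 2 ≤ 0 := by
        have : (0 : ℝ) ≤ n := by positivity
        linarith
      have h3 : ‖(vec z : Cl n)‖ ≤ ‖(vecL (n := n))‖ * R :=
        ((vecL (n := n)).le_opNorm z).trans (by gcongr)
      exact mul_le_mul (rpow_add_sq_le hδ hc0 hp hz) h3 (norm_nonneg _) (by positivity)⟩)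
  simp_rw [regG_zero] at h2
  rw [neg_smul, neg_eq_iff_eq_neg]
  refine tendsto_nhds_unique h1 (h2.neg.congr fun m => ?_)
  exact (poisson_integral_eq (by omega) hF hc hD x (by positivity)).symm

/-- An integration by parts against `regH` produces `regG` and the factor `n - 2`; from there the
first order argument applies. -/
theorem dirac_dirac_representation (hn : 3 ≤ n) {F : V n → Cl n} (hF : ContDiff ℝ 2 F)
    (hc : HasCompactSupport F) {x : V n} (hx : ∀ᶠ y in 𝓝 x, dirac (dirac F) y = 0) :
    (((n : ℝ) - 2) * poissonMass n) • F x = ∫ y, H (x - y) * dirac (dirac F) y := by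
  have hF1 : ContDiff ℝ 1 (dirac F) := by
    refine ContDiff.sum fun i _ => (mulL (e i)).contDiff.comp ?_
    exact (hF.fderiv_right (m := 1) (by norm_num)).clm_apply contDiff_const
  have hD2 : Continuous (dirac (dirac F)) := by
    refine continuous_finsetSum _ fun i _ => (mulL (e i)).continuous.comp ?_
    exact (hF1.continuous_fderiv (by simp)).clm_apply continuous_const
  have hc1 := hasCompactSupport_dirac hc
  have h1 := tendsto_poisson_integral hF.continuous hc x
  have hn' : (2 : ℝ) < n := by exact_mod_cast hn
  have h2 := tendsto_integral_regularized (Kr := regH) hD2 (hasCompactSupport_dirac hc1) hx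
    (fun m => (contDiff_regH (by positivity)).continuous)
    (fun z hz => (tendsto_add_sq_rpow _ hz).smul_const _)
    (fun δ hδ R => ⟨(δ ^ 2) ^ (-((n : ℝ) - 2) / 2) * ‖(1 : Cl n)‖, fun c hc0 z hz hz' => by
      rw [regH, norm_smul]
      gcongr
      exact rpow_add_sq_le hδ hc0 (by linarith) hz⟩)
  simp_rw [regH_zero (show 2 ≤ n by omega)] at h2
  have key : ∀ m : ℕ, ∫ y, regH ((1 / ((m : ℝ) + 1)) ^ 2) (x - y) * dirac (dirac F) y =
      ((n : ℝ) - 2) • ∫ y, (n * (1 / ((m : ℝ) + 1)) ^ 2 *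
      ((1 / ((m : ℝ) + 1)) ^ 2 + ‖x - y‖ ^ 2) ^ (-(n : ℝ) / 2 - 1)) • F y := by
    intro m
    have hc0 : 0 < (1 / ((m : ℝ) + 1)) ^ 2 := by positivity
    generalize (1 / ((m : ℝ) + 1)) ^ 2 = c at hc0 ⊢
    rw [poisson_integral_eq (by omega) (hF.differentiable (by simp)) hc hF1.continuous x hc0,
      smul_neg, ← integral_smul, eq_neg_iff_add_eq_zero, add_comm]
    have h := integral_rdirac_mul_add_mul_dirac (show 1 ≤ n by omega)
      (w := fun y => regH c (x - y)) ((contDiff_regH hc0).comp (by fun_prop))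
      (hF1.differentiable (by simp)) hc1 hD2
    rw [← h]
    congr 1
    refine integral_congr_ae (Eventually.of_forall fun y => ?_)
    simp only
    rw [rdirac_comp_sub (contDiff_regH hc0), rdirac_regH (by positivity), ← neg_smul, neg_neg, smul_mul_assoc]
  rw [mul_smul]
  exact tendsto_nhds_unique (h1.const_smul _) (h2.congr key)

end CliffordCylinder

open scoped Topology
namespace CliffordCylinder
open scoped ContDiff Nat
open Metric MeasureTheory Filter

/-! ### Parameter integrals with factorial derivative bounds -/

section Param

variable {X E Y : Type*} [NormedAddCommGroup X] [NormedSpace ℝ X]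
  [NormedAddCommGroup E] [NormedSpace ℝ E] [MeasurableSpace Y] {μ : Measure Y}

lemma hasFDerivAt_integral_of_bound {U : Set X} (hU : IsOpen U)
    {f : Y → X → E} {s : Y → ℝ} {x : X} (hx : x ∈ U) (hi : Integrable (fun y => f y x) μ)
    (hs : Integrable s μ) (hf : ∀ᵐ y ∂μ, ∀ z ∈ U, DifferentiableAt ℝ (f y) z ∧
      ‖fderiv ℝ (f y) z‖ ≤ s y)
    (hm : ∀ x ∈ U, AEStronglyMeasurable (fun y => f y x) μ)
    (hm' : AEStronglyMeasurable (fun y => fderiv ℝ (f y) x) μ) :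
    HasFDerivAt (fun x => ∫ y, f y x ∂μ) (∫ y, fderiv ℝ (f y) x ∂μ) x := by
  obtain ⟨ε, hε, hεU⟩ := Metric.isOpen_iff.1 hU x hx
  refine hasFDerivAt_integral_of_dominated_of_fderiv_le (𝕜 := ℝ)
    (F' := fun x y => fderiv ℝ (f y) x) (ball_mem_nhds x hε) (bound := s)
    (eventually_of_mem (hU.mem_nhds hx) hm) hi hm' ?_ hs ?_
  · filter_upwards [hf] with y hy z hz using (hy z (hεU hz)).2
  · filter_upwards [hf] with y hy z hz using (hy z (hεU hz)).1.hasFDerivAt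

lemma aestronglyMeasurable_fderiv_iteratedFDeriv {k : ℕ} {f : Y → X → E} {x : X}
    (hm : AEStronglyMeasurable (fun y => iteratedFDeriv ℝ (k + 1) (f y) x) μ) :
    AEStronglyMeasurable (fun y => fderiv ℝ (iteratedFDeriv ℝ k (f y)) x) μ := by
  have := (continuousMultilinearCurryLeftEquiv ℝ (fun _ : Fin (k + 1) => X)
    E).continuous.comp_aestronglyMeasurable hm
  refine AEStronglyMeasurable.congr (f := fun y => (continuousMultilinearCurryLeftEquiv ℝ
    (fun _ : Fin (k + 1) => X) E) (iteratedFDeriv ℝ (k + 1) (f y) x)) this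
    (Eventually.of_forall fun y => ?_)
  simp [iteratedFDeriv_succ_eq_comp_left]

lemma integral_apply_of_bound {h : Y → X →L[ℝ] E} {s : Y → ℝ} (hs : Integrable s μ)
    (hm : AEStronglyMeasurable h μ) (hb : ∀ᵐ y ∂μ, ‖h y‖ ≤ s y) (w : X) :
    (∫ y, h y ∂μ) w = ∫ y, h y w ∂μ :=
  ContinuousLinearMap.integral_apply (Integrable.mono' hs hm hb) w

variable [CompleteSpace E]

/-- As for series: the formula of order `k` gives differentiability under the integral, and this
gives the formula of order `k + 1`. -/
lemma iteratedFDeriv_integral_of_derivBound {U : Set X} (hU : IsOpen U)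
    {f : Y → X → E} {s : Y → ℝ} {A : ℝ}
    (hf : ∀ᵐ y ∂μ, DerivBound U (f y) (s y) A) (hs : Integrable s μ)
    (hm : ∀ k : ℕ, ∀ x ∈ U, AEStronglyMeasurable (fun y => iteratedFDeriv ℝ k (f y) x) μ) (k : ℕ) :
    ∀ x ∈ U, iteratedFDeriv ℝ k (fun x => ∫ y, f y x ∂μ) x = ∫ y, iteratedFDeriv ℝ k (f y) x ∂μ ∧
      HasFDerivAt (iteratedFDeriv ℝ k (fun x => ∫ y, f y x ∂μ))
        (∫ y, fderiv ℝ (iteratedFDeriv ℝ k (f y)) x ∂μ) x := by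
  have hint : ∀ k : ℕ, Integrable (fun y => s y * A ^ k * (k ! : ℝ)) μ := fun k =>
    (hs.mul_const _).mul_const _
  have hi : ∀ k : ℕ, ∀ x ∈ U, Integrable (fun y => iteratedFDeriv ℝ k (f y) x) μ := by
    intro k x hx
    refine Integrable.mono' (hint k) (hm k x hx) ?_
    filter_upwards [hf] with y hy using (hy x hx).2 k
  have hfd : ∀ k : ℕ, ∀ᵐ y ∂μ, ∀ z ∈ U, DifferentiableAt ℝ (iteratedFDeriv ℝ k (f y)) z ∧
      ‖fderiv ℝ (iteratedFDeriv ℝ k (f y)) z‖ ≤ s y * A ^ (k + 1) * ((k + 1)! : ℝ) := by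
    intro k
    filter_upwards [hf] with y hy z hz
    refine ⟨((hy z hz).1).differentiableAt_iteratedFDeriv
      (by exact_mod_cast WithTop.coe_lt_top k), ?_⟩
    rw [norm_fderiv_iteratedFDeriv]
    exact (hy z hz).2 (k + 1)
  have key : ∀ k : ℕ, (∀ x ∈ U, iteratedFDeriv ℝ k (fun x => ∫ y, f y x ∂μ) x =
      ∫ y, iteratedFDeriv ℝ k (f y) x ∂μ) → ∀ x ∈ U,
      HasFDerivAt (iteratedFDeriv ℝ k (fun x => ∫ y, f y x ∂μ))
        (∫ y, fderiv ℝ (iteratedFDeriv ℝ k (f y)) x ∂μ) x := by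
    intro k hk x hx
    have h1 := hasFDerivAt_integral_of_bound hU hx (hi k x hx) (hint (k + 1)) (hfd k) (hm k)
      (aestronglyMeasurable_fderiv_iteratedFDeriv (hm (k + 1) x hx))
    exact h1.congr_of_eventuallyEq (Filter.eventuallyEq_of_mem (hU.mem_nhds hx) hk)
  suffices h : ∀ x ∈ U, iteratedFDeriv ℝ k (fun x => ∫ y, f y x ∂μ) x =
      ∫ y, iteratedFDeriv ℝ k (f y) x ∂μ from fun x hx => ⟨h x hx, key k h x hx⟩
  induction k with
  | zero =>
    intro x hx
    ext m
    rw [ContinuousMultilinearMap.integral_apply (hi 0 x hx)]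
    simp
  | succ k ih =>
    intro x hx
    ext m
    rw [iteratedFDeriv_succ_apply_left, (key k ih x hx).fderiv,
      ContinuousMultilinearMap.integral_apply (hi (k + 1) x hx),
      integral_apply_of_bound (hint (k + 1))
        (aestronglyMeasurable_fderiv_iteratedFDeriv (hm (k + 1) x hx))
        ((hfd k).mono fun y hy => (hy x hx).2),
      ContinuousMultilinearMap.integral_apply]
    · simp only [iteratedFDeriv_succ_apply_left]
    · refine Integrable.mono' ((hint (k + 1)).mul_const ‖m 0‖) ?_ ?_
      · exact (ContinuousLinearMap.apply ℝ (ContinuousMultilinearMap ℝ (fun _ : Fin k => X) E)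
          (m 0)).continuous.comp_aestronglyMeasurable
            (aestronglyMeasurable_fderiv_iteratedFDeriv (hm (k + 1) x hx))
      · filter_upwards [hfd k] with y hy
        exact ((fderiv ℝ (iteratedFDeriv ℝ k (f y)) x).le_opNorm _).trans
          (mul_le_mul_of_nonneg_right (hy x hx).2 (norm_nonneg _))

lemma DerivBound.integral {U : Set X} (hU : IsOpen U) {f : Y → X → E} {s : Y → ℝ} {A : ℝ}
    (hf : ∀ᵐ y ∂μ, DerivBound U (f y) (s y) A) (hs : Integrable s μ)
    (hm : ∀ k : ℕ, ∀ x ∈ U, AEStronglyMeasurable (fun y => iteratedFDeriv ℝ k (f y) x) μ) :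
    DerivBound U (fun x => ∫ y, f y x ∂μ) (∫ y, s y ∂μ) A := by
  intro x hx
  constructor
  · have : ContDiffOn ℝ ∞ (fun x => ∫ y, f y x ∂μ) U := by
      refine contDiffOn_of_differentiableOn fun k _ => ?_
      intro y hy
      have h1 := ((iteratedFDeriv_integral_of_derivBound hU hf hs hm k) y hy).2.differentiableAt
      refine (h1.congr_of_eventuallyEq ?_).differentiableWithinAt
      exact Filter.eventuallyEq_of_mem (hU.mem_nhds hy) (iteratedFDerivWithin_of_isOpen k hU)
    exact this.contDiffAt (hU.mem_nhds hx)
  · intro k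
    rw [((iteratedFDeriv_integral_of_derivBound hU hf hs hm k) x hx).1, ← integral_mul_const,
      ← integral_mul_const]
    refine norm_integral_le_of_norm_le ((hs.mul_const _).mul_const _) ?_
    filter_upwards [hf] with y hy using (hy x hx).2 k

end Param

variable {n j : ℕ} {Λ : DiffOp n j}

lemma Tame.integral {Y : Type*} [MeasurableSpace Y] {μ : Measure Y} {U : Set (V n)} (hU : IsOpen U)
    {f : Y → V n → Cl n} {s : Y → ℝ} {A : ℝ}
    (hf : ∀ᵐ y ∂μ, Tame Λ U (f y) (s y) A) (hs : Integrable s μ)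
    (hm : ∀ k : ℕ, ∀ x ∈ U, AEStronglyMeasurable (fun y => iteratedFDeriv ℝ k (f y) x) μ) :
    Tame Λ U (fun x => ∫ y, f y x ∂μ) (∫ y, s y ∂μ) A := by
  have hb : ∀ᵐ y ∂μ, DerivBound U (f y) (s y) A := hf.mono fun y hy => hy.bound
  refine ⟨DerivBound.integral hU hb hs hm, fun x hx => ?_⟩
  rw [((iteratedFDeriv_integral_of_derivBound hU hb hs hm j) x hx).1,
    ← Λ.op.integral_comp_comm]
  · refine integral_eq_zero_of_ae ?_
    filter_upwards [hf] with y hy using hy.null x hx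
  · refine Integrable.mono' ((hs.mul_const (A ^ j)).mul_const (j ! : ℝ)) (hm j x hx) ?_
    filter_upwards [hb] with y hy using (hy x hx).2 j

/-! ### Kernels -/

/-- The data of an operator and its homogeneous fundamental solution. -/
structure Kernel (Λ : DiffOp n j) where
  /-- The kernel. -/
  K : V n → Cl n
  /-- The rate of decay of the kernel. -/
  N : ℕ
  one_le : 1 ≤ N
  add_eq : N + j = n
  analytic : ∀ z, z ≠ 0 → AnalyticAt ℝ K z
  hom : ∀ t : ℝ, 0 < t → ∀ z, K (t • z) = (t ^ N)⁻¹ • K z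
  null : ∀ z, z ≠ 0 → Λ.op (iteratedFDeriv ℝ j K z) = 0

variable (T : Kernel Λ)

lemma Kernel.exists_bound : ∃ C A : ℝ, 0 ≤ C ∧ 1 ≤ A ∧
    (∀ z, z ≠ 0 → ∀ k : ℕ,
      ‖iteratedFDeriv ℝ k T.K z‖ ≤ C * A ^ k * (k ! : ℝ) * (‖z‖ ^ (T.N + k))⁻¹) ∧
    (∀ z, z ≠ 0 → ∀ y, ‖y‖ * A < ‖z‖ →
      HasSum (fun k : ℕ => (k ! : ℝ)⁻¹ • iteratedFDeriv ℝ k T.K z fun _ => y) (T.K (z + y))) :=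
  exists_bound_of_homogeneous T.hom T.analytic

/-- A bound for the kernel. -/
noncomputable def Kernel.C : ℝ := T.exists_bound.choose

/-- The growth rate of the derivatives of the kernel. -/
noncomputable def Kernel.A : ℝ := T.exists_bound.choose_spec.choose

lemma Kernel.C_nonneg : 0 ≤ T.C := T.exists_bound.choose_spec.choose_spec.1

lemma Kernel.one_le_A : 1 ≤ T.A := T.exists_bound.choose_spec.choose_spec.2.1

lemma Kernel.norm_iteratedFDeriv_le {z : V n} (hz : z ≠ 0) (k : ℕ) :
    ‖iteratedFDeriv ℝ k T.K z‖ ≤ T.C * T.A ^ k * (k ! : ℝ) * (‖z‖ ^ (T.N + k))⁻¹ :=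
  T.exists_bound.choose_spec.choose_spec.2.2.1 z hz k

lemma Kernel.hasSum_taylor {z y : V n} (hz : z ≠ 0) (hy : ‖y‖ * T.A < ‖z‖) :
    HasSum (fun k : ℕ => (k ! : ℝ)⁻¹ • iteratedFDeriv ℝ k T.K z fun _ => y) (T.K (z + y)) :=
  T.exists_bound.choose_spec.choose_spec.2.2.2 z hz y hy

lemma Kernel.contDiffAt {z : V n} (hz : z ≠ 0) : ContDiffAt ℝ ∞ T.K z :=
  (T.analytic z hz).contDiffAt

/-- The kernel shifted by `v`, on a set at distance at least `δ` from its pole. -/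
lemma Kernel.tame_shift {U : Set (V n)} {δ : ℝ} (hδ : 0 < δ) {v : V n}
    (hU : ∀ x ∈ U, δ ≤ ‖x + v‖) :
    Tame Λ U (fun x => T.K (x + v)) (T.C * (δ ^ T.N)⁻¹) (T.A * δ⁻¹) := by
  have hne : ∀ x ∈ U, x + v ≠ 0 := fun x hx => norm_pos_iff.1 (hδ.trans_le (hU x hx))
  refine ⟨fun x hx => ⟨(T.contDiffAt (hne x hx)).comp x (contDiffAt_id.add contDiffAt_const),
    fun k => ?_⟩, fun x hx => ?_⟩
  · rw [iteratedFDeriv_comp_add_right]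
    refine (T.norm_iteratedFDeriv_le (hne x hx) k).trans ?_
    have hA := T.one_le_A
    have hC := T.C_nonneg
    have h1 : (‖x + v‖ ^ (T.N + k))⁻¹ ≤ (δ ^ (T.N + k))⁻¹ := by
      gcongr
      exact hU x hx
    calc _ ≤ T.C * T.A ^ k * (k ! : ℝ) * (δ ^ (T.N + k))⁻¹ := by gcongr
      _ = _ := by rw [pow_add, mul_inv, mul_pow, inv_pow]; ring
  · rw [iteratedFDeriv_comp_add_right]
    exact T.null _ (hne x hx)

lemma Kernel.tameAt_shift {x v : V n} (h : x + v ≠ 0) : TameAt Λ (fun y => T.K (y + v)) x := by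
  have h0 := norm_pos_iff.2 h
  have h1 : ∀ y ∈ ball x (‖x + v‖ / 2), ‖x + v‖ / 2 ≤ ‖y + v‖ := by
    intro y hy
    rw [mem_ball, dist_eq_norm, norm_sub_rev] at hy
    have : ‖x + v‖ ≤ ‖x - y‖ + ‖y + v‖ := by
      calc ‖x + v‖ = ‖(x - y) + (y + v)‖ := by congr 1; abel
        _ ≤ _ := norm_add_le _ _
    linarith
  refine ⟨‖x + v‖ / 2, by positivity, _, max (T.A * (‖x + v‖ / 2)⁻¹) 1, le_max_right _ _,
    (T.tame_shift (by positivity) h1).mono subset_rfl le_rfl ?_ (le_max_left _ _)⟩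
  have := T.one_le_A
  positivity

/-- Potentials are null solutions off the support of the density. -/
lemma Kernel.tame_potential {R r : ℝ} (hrR : r < R) {S : Set (V n)} (hS : IsCompact S)
    (hSR : ∀ y ∈ S, R ≤ ‖y‖) {g : V n → Cl n} (hg : Continuous g) :
    ∃ s A, 1 ≤ A ∧ Tame Λ (ball 0 r) (fun x => ∫ y in S, T.K (x - y) * g y) s A := by
  have hδ : 0 < R - r := by linarith
  have hdist : ∀ y ∈ S, ∀ x ∈ ball (0 : V n) r, R - r ≤ ‖x + -y‖ := by
    intro y hy x hx
    have h1 := hSR y hy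
    rw [mem_ball_zero_iff] at hx
    have h2 : ‖y‖ ≤ ‖x‖ + ‖x + -y‖ := by
      calc ‖y‖ = ‖x - (x + -y)‖ := by congr 1; abel
        _ ≤ _ := norm_sub_le _ _
    linarith
  have hA := T.one_le_A
  have htame : ∀ y ∈ S, Tame Λ (ball 0 r) (fun x => T.K (x - y) * g y)
      (‖mulR (g y)‖ * (T.C * ((R - r) ^ T.N)⁻¹)) (T.A * (R - r)⁻¹) := by
    intro y hy
    have := (T.tame_shift hδ (hdist y hy)).mul_right (g y)
    simpa only [← sub_eq_add_neg] using this
  have hmeas := hS.measurableSet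
  have hae : ∀ᵐ y ∂(volume.restrict S), y ∈ S := ae_restrict_mem hmeas
  refine ⟨_, max (T.A * (R - r)⁻¹) 1, le_max_right _ _, (Tame.integral isOpen_ball
    (hae.mono fun y hy => htame y hy) ?_ ?_).mono subset_rfl le_rfl (by positivity)
    (le_max_left _ _)⟩
  · have hc : Continuous fun y => ‖mulR (g y)‖ * (T.C * ((R - r) ^ T.N)⁻¹) :=
      ((mulR.continuous.comp hg).norm).mul continuous_const
    exact hc.continuousOn.integrableOn_compact hS
  · intro k x hx
    -- Measurability in `y` comes from continuity on `S`, as `x - y` stays away from the pole there.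
    have h1 : ContinuousOn (fun y => (mulR (g y)).compContinuousMultilinearMap
        (iteratedFDeriv ℝ k T.K (x - y))) S := by
      have h2 : ContinuousOn (fun y => iteratedFDeriv ℝ k T.K (x - y)) S := by
        intro y hy
        have hne : x - y ≠ 0 := by
          rw [sub_eq_add_neg]; exact norm_pos_iff.1 (hδ.trans_le (hdist y hy x hx))
        have h3 : ContinuousAt (iteratedFDeriv ℝ k T.K) (x - y) :=
          ((T.contDiffAt hne).differentiableAt_iteratedFDeriv
            (by exact_mod_cast WithTop.coe_lt_top k)).continuousAt
        exact (ContinuousAt.comp (f := fun y => x - y) h3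
          (by fun_prop)).continuousWithinAt
      exact ((ContinuousLinearMap.compContinuousMultilinearMapL ℝ (fun _ : Fin k => V n)
        (Cl n) (Cl n)).continuous.comp (mulR.continuous.comp hg)).continuousOn.clm_apply h2
    refine (h1.aestronglyMeasurable hmeas).congr ?_
    filter_upwards [hae] with y hy
    have hne : x + -y ≠ 0 := norm_pos_iff.1 (hδ.trans_le (hdist y hy x hx))
    have h4 : ContDiffAt ℝ ∞ (fun x => T.K (x + -y)) x :=
      (T.contDiffAt hne).comp x (contDiffAt_id.add contDiffAt_const)
    have h5 := (mulR (g y)).iteratedFDeriv_comp_left h4 (i := k) (by exact_mod_cast le_top)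
    rw [iteratedFDeriv_comp_add_right] at h5
    simp only [← sub_eq_add_neg] at h5
    exact h5.symm

/-! ### Multipole expansions -/

/-- A power series which vanishes for small positive arguments has vanishing coefficients. -/
lemma coeff_eq_zero_of_hasSum_zero {E : Type*} [NormedAddCommGroup E] [NormedSpace ℝ E]
    [CompleteSpace E] {a : ℕ → E} {C q t₀ : ℝ} (hq : 0 < q) (ht : 0 < t₀)
    (ha : ∀ k, ‖a k‖ ≤ C * q ^ k) (h : ∀ t : ℝ, 0 < t → t < t₀ → HasSum (fun k => t ^ k • a k) 0) :
    ∀ k, a k = 0 := by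
  set p : FormalMultilinearSeries ℝ ℝ E :=
    fun k => ContinuousMultilinearMap.mkPiRing ℝ (Fin k) (a k) with hp
  have hcoeff : ∀ k, p.coeff k = a k := fun k => by
    simp [hp, FormalMultilinearSeries.coeff]
  have hfs : HasFPowerSeriesAt (fun t : ℝ => ∑' k, t ^ k • a k) p 0 := by
    rw [hasFPowerSeriesAt_iff]
    filter_upwards [ball_mem_nhds (0 : ℝ) (show 0 < (2 * q)⁻¹ by positivity)] with t ht
    rw [mem_ball_zero_iff, Real.norm_eq_abs] at ht
    simp only [hcoeff, zero_add]
    refine Summable.hasSum (Summable.of_norm_bounded (g := fun k => C * (|t| * q) ^ k) ?_ ?_)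
    · refine (summable_geometric_of_lt_one (by positivity) ?_).mul_left C
      have : |t| * q < (2 * q)⁻¹ * q := by gcongr
      have h2 : (2 * q)⁻¹ * q = 1 / 2 := by field_simp
      linarith
    · intro k
      rw [norm_smul, norm_pow, Real.norm_eq_abs]
      calc |t| ^ k * ‖a k‖ ≤ |t| ^ k * (C * q ^ k) := by gcongr; exact ha k
        _ = _ := by rw [mul_pow]; ring
  -- The zeros accumulate at `0` from the right only, which suffices for the identity theorem.
  have hev : ∃ᶠ t in 𝓝[≠] (0 : ℝ), (∑' k, t ^ k • a k) = 0 := by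
    have h1 : ∀ᶠ t in 𝓝[>] (0 : ℝ), (∑' k, t ^ k • a k) = 0 := by
      filter_upwards [Ioo_mem_nhdsGT ht] with t ht
      exact (h t ht.1 ht.2).tsum_eq
    exact h1.frequently.filter_mono (nhdsWithin_mono _ fun t ht => ne_of_gt ht)
  have h0 := hfs.analyticAt.frequently_zero_iff_eventually_zero.1 hev
  have h2 : HasFPowerSeriesAt (0 : ℝ → E) p 0 := hfs.congr h0
  intro k
  rw [← hcoeff k, h2.eq_zero]
  simp [FormalMultilinearSeries.coeff]

/-- Moments of a density on a ball. -/
noncomputable def moment (g : V n → Cl n) (ρ : ℝ) (k : ℕ) (i : Fin k → Fin n) : Cl n :=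
  (k ! : ℝ)⁻¹ • ∫ y in closedBall (0 : V n) ρ, (∏ r, (-y (i r))) • g y

/-- The terms of the multipole expansion of a potential. -/
noncomputable def Kernel.multipole (g : V n → Cl n) (ρ : ℝ) (k : ℕ) (x : V n) : Cl n :=
  ∑ i : Fin k → Fin n, iterD (List.ofFn i) T.K x * moment g ρ k i

lemma abs_apply_le_norm (y : V n) (i : Fin n) : |y i| ≤ ‖y‖ := by
  simpa using PiLp.norm_apply_le y i

lemma norm_moment_le {g : V n → Cl n} (hg : Continuous g) {ρ : ℝ} (k : ℕ) (i : Fin k → Fin n) :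
    ‖moment g ρ k i‖ ≤ (∫ y in closedBall (0 : V n) ρ, ‖g y‖) * ρ ^ k * (k ! : ℝ)⁻¹ := by
  have hint : IntegrableOn (fun y => ‖g y‖) (closedBall (0 : V n) ρ) :=
    hg.norm.continuousOn.integrableOn_compact (isCompact_closedBall _ _)
  rw [moment, norm_smul, Real.norm_of_nonneg (by positivity), mul_comm, ← integral_mul_const]
  gcongr
  refine norm_integral_le_of_norm_le (hint.mul_const _) ?_
  filter_upwards [ae_restrict_mem measurableSet_closedBall] with y hy
  rw [mem_closedBall_zero_iff] at hy
  rw [norm_smul, mul_comm, Real.norm_eq_abs, Finset.abs_prod]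
  gcongr
  calc ∏ r, |-y (i r)| ≤ ∏ _r : Fin k, ρ := by
        refine Finset.prod_le_prod (fun _ _ => abs_nonneg _) fun r _ => ?_
        rw [abs_neg]
        exact (abs_apply_le_norm y _).trans hy
    _ = ρ ^ k := by simp

/-- Multilinear expansion in coordinates. The sum runs over sequences of indices rather than
multi-indices, so no multinomial coefficients appear; sequences with equal counts are collected only
in `FundSol.laurentCoeff`. -/
lemma iteratedFDeriv_neg_eq_sum {x : V n} (hx : x ≠ 0) (k : ℕ) (y : V n) :
    (iteratedFDeriv ℝ k T.K x fun _ => -y) =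
      ∑ i : Fin k → Fin n, (∏ r, (-y (i r))) • iterD (List.ofFn i) T.K x := by
  have h1 : -y = ∑ i : Fin n, (-y i) • (stdVec i : V n) := by
    conv_lhs => rw [← (EuclideanSpace.basisFun (Fin n) ℝ).sum_repr (-y)]
    simp [stdVec]
  conv_lhs => rw [h1]
  rw [ContinuousMultilinearMap.map_sum]
  refine Finset.sum_congr rfl fun i _ => ?_
  rw [ContinuousMultilinearMap.map_smul_univ,
    iteratedFDeriv_stdVec isOpen_compl_singleton (fun z hz => T.contDiffAt hz) k i hx]

lemma Kernel.iterD_smul (L : List (Fin n)) {t : ℝ} (ht : 0 < t) {x : V n} (hx : x ≠ 0) :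
    iterD L T.K (t • x) = (t ^ (T.N + L.length))⁻¹ • iterD L T.K x := by
  have h := fun z (hz : z ≠ 0) => iteratedFDeriv_stdVec (f := T.K) isOpen_compl_singleton
    (fun z hz => T.contDiffAt hz) L.length L.get (x := z) hz
  rw [List.ofFn_get] at h
  rw [← h _ hx, ← h _ (smul_ne_zero ht.ne' hx),
    iteratedFDeriv_smul_of_homogeneous T.hom ht _ (T.contDiffAt hx)]
  rfl

lemma Kernel.multipole_smul (g : V n → Cl n) (ρ : ℝ) (k : ℕ) {t : ℝ} (ht : 0 < t) {x : V n}
    (hx : x ≠ 0) :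
    T.multipole g ρ k (t • x) = (t ^ (T.N + k))⁻¹ • T.multipole g ρ k x := by
  simp only [Kernel.multipole, T.iterD_smul _ ht hx, List.length_ofFn, smul_mul_assoc,
    Finset.smul_sum]

/-- The multipole expansion of the potential of a density on a ball. -/
lemma Kernel.hasSum_multipole {g : V n → Cl n} (hg : Continuous g) {ρ : ℝ} (hρ : 0 ≤ ρ) {x : V n}
    (hx : ρ * T.A < ‖x‖) :
    HasSum (fun k => T.multipole g ρ k x) (∫ y in closedBall (0 : V n) ρ, T.K (x - y) * g y) ∧
    ∃ C q : ℝ, 0 ≤ q ∧ q < 1 ∧ ∀ k, ‖T.multipole g ρ k x‖ ≤ C * q ^ k := by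
  have hA := T.one_le_A
  have hx0 : 0 < ‖x‖ := lt_of_le_of_lt (by positivity) hx
  have hxne := norm_pos_iff.1 hx0
  have hC := T.C_nonneg
  set M := ‖(mulL : Cl n →L[ℝ] _)‖ with hM
  -- The ratio of the geometric majorant: on the ball the `k`-th Taylor term of `K (x - y)` is of
  -- size `q ^ k`, the factorials cancelling.
  set q := ρ * T.A / ‖x‖ with hq
  have hq0 : 0 ≤ q := by positivity
  have hq1 : q < 1 := (div_lt_one hx0).2 hx
  have hmul : ∀ k, T.multipole g ρ k x = ∫ y in closedBall (0 : V n) ρ,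
      ((k ! : ℝ)⁻¹ • iteratedFDeriv ℝ k T.K x fun _ => -y) * g y := by
    intro k
    simp only [Kernel.multipole, moment, iteratedFDeriv_neg_eq_sum T hxne, Finset.smul_sum,
      Finset.sum_mul]
    rw [integral_finsetSum]
    · refine Finset.sum_congr rfl fun i _ => ?_
      rw [mul_smul_comm, ← smul_mul_assoc]
      change mulL ((k ! : ℝ)⁻¹ • iterD (List.ofFn i) T.K x) _ = _
      have hi : IntegrableOn (fun y : V n => (∏ r, (-y (i r))) • g y) (closedBall 0 ρ) := by
        refine (Continuous.continuousOn ?_).integrableOn_compact (isCompact_closedBall _ _)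
        have hp : Continuous fun y : V n => ∏ r, -y (i r) :=
          continuous_finsetProd _ fun r _ => by fun_prop
        exact hp.smul hg
      rw [← ContinuousLinearMap.integral_comp_comm _ hi]
      refine integral_congr_ae (Eventually.of_forall fun y => ?_)
      simp only [mulL_apply, smul_mul_assoc, mul_smul_comm]
      rw [smul_comm]
    · intro i _
      refine (Continuous.continuousOn ?_).integrableOn_compact (isCompact_closedBall _ _)
      refine continuous_cl_mul ?_ hg
      have hp : Continuous fun y : V n => ∏ r, -y (i r) :=
        continuous_finsetProd _ fun r _ => by fun_prop
      have hp2 : Continuous fun y : V n => (∏ r, -y (i r)) • iterD (List.ofFn i) T.K x :=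
        hp.smul continuous_const
      exact hp2.const_smul (k ! : ℝ)⁻¹
  have hbound : ∀ k : ℕ, ∀ y ∈ closedBall (0 : V n) ρ,
      ‖((k ! : ℝ)⁻¹ • iteratedFDeriv ℝ k T.K x fun _ => -y) * g y‖ ≤
        M * (T.C * (‖x‖ ^ T.N)⁻¹) * ‖g y‖ * q ^ k := by
    intro k y hy
    rw [mem_closedBall_zero_iff] at hy
    refine (norm_mul_le_mulL _ _).trans ?_
    have h1 : ‖(k ! : ℝ)⁻¹ • iteratedFDeriv ℝ k T.K x fun _ => -y‖ ≤
        T.C * (‖x‖ ^ T.N)⁻¹ * q ^ k := by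
      rw [norm_smul, Real.norm_of_nonneg (by positivity)]
      have h2 := (iteratedFDeriv ℝ k T.K x).le_opNorm fun _ => -y
      simp only [norm_neg, Finset.prod_const, Finset.card_univ, Fintype.card_fin] at h2
      calc (k ! : ℝ)⁻¹ * ‖iteratedFDeriv ℝ k T.K x fun _ => -y‖
          ≤ (k ! : ℝ)⁻¹ * (T.C * T.A ^ k * (k ! : ℝ) * (‖x‖ ^ (T.N + k))⁻¹ * ρ ^ k) := by
            gcongr
            refine h2.trans ?_
            gcongr
            exact T.norm_iteratedFDeriv_le hxne k
        _ = T.C * (‖x‖ ^ T.N)⁻¹ * q ^ k := by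
            rw [hq, div_pow, mul_pow, pow_add]
            have : (k ! : ℝ) ≠ 0 := by positivity
            field_simp
    calc M * ‖(k ! : ℝ)⁻¹ • iteratedFDeriv ℝ k T.K x fun _ => -y‖ * ‖g y‖
        ≤ M * (T.C * (‖x‖ ^ T.N)⁻¹ * q ^ k) * ‖g y‖ := by gcongr
      _ = _ := by ring
  have hgint : IntegrableOn (fun y => M * (T.C * (‖x‖ ^ T.N)⁻¹) * ‖g y‖)
      (closedBall (0 : V n) ρ) :=
    (hg.norm.continuousOn.integrableOn_compact (isCompact_closedBall _ _)).const_mul _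
  have hae : ∀ᵐ y ∂(volume.restrict (closedBall (0 : V n) ρ)), y ∈ closedBall (0 : V n) ρ :=
    ae_restrict_mem measurableSet_closedBall
  have hgeo := summable_geometric_of_lt_one hq0 hq1
  constructor
  · simp_rw [hmul]
    refine hasSum_integral_of_dominated_convergence
      (fun k y => M * (T.C * (‖x‖ ^ T.N)⁻¹) * ‖g y‖ * q ^ k) (fun k => ?_)
      (fun k => hae.mono fun y hy => hbound k y hy)
      (Eventually.of_forall fun y => hgeo.mul_left _) ?_ (hae.mono fun y hy => ?_)
    · refine Continuous.aestronglyMeasurable (continuous_cl_mul ?_ hg)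
      have hp : Continuous fun y : V n => iteratedFDeriv ℝ k T.K x fun _ => -y :=
        (iteratedFDeriv ℝ k T.K x).cont.comp (continuous_pi fun _ => continuous_neg)
      exact hp.const_smul (k ! : ℝ)⁻¹
    · simp_rw [tsum_mul_left]
      exact hgint.mul_const _
    · rw [mem_closedBall_zero_iff] at hy
      have h1 := T.hasSum_taylor (y := -y) hxne (by
        rw [norm_neg]; exact lt_of_le_of_lt (by gcongr) hx)
      rw [← sub_eq_add_neg] at h1
      exact h1.mapL (mulR (g y))
  · refine ⟨∫ y in closedBall (0 : V n) ρ, M * (T.C * (‖x‖ ^ T.N)⁻¹) * ‖g y‖, q, hq0, hq1,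
      fun k => ?_⟩
    rw [hmul, ← integral_mul_const]
    exact norm_integral_le_of_norm_le (hgint.mul_const _) (hae.mono fun y hy => hbound k y hy)

end CliffordCylinder

open scoped Topology
namespace CliffordCylinder
open scoped ContDiff Nat
open Metric MeasureTheory Filter

/-! ### Laurent expansions at isolated singularities -/

variable {n j : ℕ} {Λ : DiffOp n j}

/-- The operator applied to a function. -/
noncomputable def DiffOp.app (Λ : DiffOp n j) (f : V n → Cl n) (x : V n) : Cl n :=
  Λ.op (iteratedFDeriv ℝ j f x)

lemma DiffOp.app_congr {f g : V n → Cl n} {x : V n} (h : f =ᶠ[𝓝 x] g) : Λ.app f x = Λ.app g x := by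
  rw [DiffOp.app, DiffOp.app, (h.iteratedFDeriv ℝ j).eq_of_nhds]

lemma DiffOp.app_zero (x : V n) : Λ.app (fun _ => 0) x = 0 := by
  rw [DiffOp.app, iteratedFDeriv_fun_zero]; simp

lemma DiffOp.app_sub {f g : V n → Cl n} {x : V n} (hf : ContDiffAt ℝ ∞ f x)
    (hg : ContDiffAt ℝ ∞ g x) : Λ.app (fun y => f y - g y) x = Λ.app f x - Λ.app g x := by
  rw [DiffOp.app, DiffOp.app, DiffOp.app, fun_iteratedFDeriv_sub_apply
    (hf.of_le (by exact_mod_cast le_top)) (hg.of_le (by exact_mod_cast le_top)), map_sub]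

lemma DiffOp.continuous_app {f : V n → Cl n} (hf : ContDiff ℝ ∞ f) : Continuous (Λ.app f) :=
  Λ.op.continuous.comp (hf.continuous_iteratedFDeriv (by exact_mod_cast le_top))

/-- A kernel with a representation formula for compactly supported functions. -/
structure FundSol (Λ : DiffOp n j) extends Kernel Λ where
  /-- The normalization. -/
  κ : ℝ
  κ_ne : κ ≠ 0
  rep : ∀ F : V n → Cl n, ContDiff ℝ ∞ F → HasCompactSupport F → ∀ x,
    (∀ᶠ y in 𝓝 x, Λ.app F y = 0) → κ • F x = ∫ y, K (x - y) * Λ.app F y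

lemma Kernel.continuousOn_mul (T : Kernel Λ) {g : V n → Cl n} (hg : Continuous g) (x : V n) :
    ContinuousOn (fun y => T.K (x - y) * g y) {x}ᶜ := by
  intro y hy
  have hne : x - y ≠ 0 := sub_ne_zero.2 (Ne.symm hy)
  have h1 : ContinuousAt (fun y => T.K (x - y)) y :=
    ContinuousAt.comp (f := fun y => x - y) (T.contDiffAt hne).continuousAt (by fun_prop)
  have h2 : ContinuousAt (fun y => mulL (T.K (x - y)) (g y)) y :=
    (ContinuousAt.comp (f := fun y => T.K (x - y)) mulL.continuous.continuousAt h1).clm_apply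
      hg.continuousAt
  exact h2.continuousWithinAt

lemma Kernel.integrableOn_mul (T : Kernel Λ) {g : V n → Cl n} (hg : Continuous g) {x : V n}
    {S : Set (V n)} (hS : IsCompact S) (hx : x ∉ S) :
    IntegrableOn (fun y => T.K (x - y) * g y) S :=
  ((T.continuousOn_mul hg x).mono fun y hy h => hx (h ▸ hy)).integrableOn_compact hS

variable (T : FundSol Λ)

/-- The difference `F - F'` vanishes at `x`, and `Λ` of it is supported in the ball, so the
representation formula says that its potential is zero at `x`. -/
lemma FundSol.integral_eq_of_eq_off {F F' : V n → Cl n} (hF : ContDiff ℝ ∞ F)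
    (hF' : ContDiff ℝ ∞ F') (hc : HasCompactSupport F) (hc' : HasCompactSupport F') {ρ : ℝ}
    (h : ∀ y, ρ < ‖y‖ → F y = F' y) {x : V n} (hx : ρ < ‖x‖) :
    ∫ y in closedBall (0 : V n) ρ, T.K (x - y) * Λ.app F y =
      ∫ y in closedBall (0 : V n) ρ, T.K (x - y) * Λ.app F' y := by
  have hev : ∀ y, ρ < ‖y‖ → ∀ᶠ z in 𝓝 y, F z - F' z = 0 := fun y hy => by
    filter_upwards [(isOpen_lt continuous_const continuous_norm).mem_nhds hy] with z hz
    rw [h z hz, sub_self]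
  have h0 : ∀ y, ρ < ‖y‖ → Λ.app (fun z => F z - F' z) y = 0 := fun y hy => by
    rw [DiffOp.app_congr (hev y hy), DiffOp.app_zero]
  have h1 := T.rep (fun z => F z - F' z) (hF.sub hF') (hc.sub hc') x (by
    filter_upwards [(isOpen_lt continuous_const continuous_norm).mem_nhds hx] with z hz
    exact h0 z hz)
  have hxS : x ∉ closedBall (0 : V n) ρ := by simpa using hx
  rw [h x hx, sub_self, smul_zero, ← setIntegral_eq_integral_of_forall_compl_eq_zero
    (s := closedBall (0 : V n) ρ)] at h1
  · rw [← sub_eq_zero, ← integral_sub]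
    · rw [h1]
      refine integral_congr_ae (Eventually.of_forall fun y => ?_)
      simp only [DiffOp.app_sub hF.contDiffAt hF'.contDiffAt, mul_sub]
    · exact T.integrableOn_mul (DiffOp.continuous_app hF) (isCompact_closedBall _ _) hxS
    · exact T.integrableOn_mul (DiffOp.continuous_app hF') (isCompact_closedBall _ _) hxS
  · intro y hy
    rw [h0 y (by simpa using hy), mul_zero]

/-- Both expansions have the same sum outside a ball. Along the ray `t⁻¹ • x` they are, by
homogeneity, power series in `t` up to the factor `t ^ N`, so they agree term by term; homogeneity
then extends this to every `x ≠ 0`. Only the multipole terms are claimed to agree: the moments need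
not, as the derivatives of `K` are linearly dependent. -/
lemma FundSol.multipole_eq_of_eq_off {F F' : V n → Cl n} (hF : ContDiff ℝ ∞ F)
    (hF' : ContDiff ℝ ∞ F') (hc : HasCompactSupport F) (hc' : HasCompactSupport F') {ρ : ℝ}
    (hρ : 0 < ρ) (h : ∀ y, ρ < ‖y‖ → F y = F' y) (k : ℕ) {x : V n} (hx : x ≠ 0) :
    T.multipole (Λ.app F) ρ k x = T.multipole (Λ.app F') ρ k x := by
  have hA := T.one_le_A
  suffices H : ∀ x : V n, ρ * T.A < ‖x‖ → ∀ k,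
      T.multipole (Λ.app F) ρ k x - T.multipole (Λ.app F') ρ k x = 0 by
    have hx0 := norm_pos_iff.2 hx
    set s := (ρ * T.A + 1) / ‖x‖ with hs
    have hs0 : 0 < s := by positivity
    have h1 := H (s • x) (by
      rw [norm_smul, Real.norm_of_nonneg hs0.le, hs, div_mul_cancel₀ _ hx0.ne']; linarith) k
    rw [T.multipole_smul _ _ _ hs0 hx, T.multipole_smul _ _ _ hs0 hx, ← smul_sub] at h1
    have h2 : (s ^ (T.N + k))⁻¹ ≠ 0 := by positivity
    exact sub_eq_zero.1 ((smul_eq_zero.1 h1).resolve_left h2)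
  intro x hx
  have hx0 : 0 < ‖x‖ := lt_of_le_of_lt (by positivity) hx
  have hxne := norm_pos_iff.1 hx0
  obtain ⟨-, C, q, hq0, hq1, hb⟩ := T.hasSum_multipole (DiffOp.continuous_app (Λ := Λ) hF) hρ.le hx
  obtain ⟨-, C', q', hq0', hq1', hb'⟩ :=
    T.hasSum_multipole (DiffOp.continuous_app (Λ := Λ) hF') hρ.le hx
  have hC : 0 ≤ C := by simpa using (norm_nonneg _).trans (hb 0)
  have hC' : 0 ≤ C' := by simpa using (norm_nonneg _).trans (hb' 0)
  refine coeff_eq_zero_of_hasSum_zero (C := C + C') (q := 1) (t₀ := 1) one_pos one_pos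
    (fun k => ?_) fun t ht ht1 => ?_
  · refine (norm_sub_le _ _).trans ?_
    rw [one_pow, mul_one]
    have h1 : q ^ k ≤ 1 := pow_le_one₀ hq0 hq1.le
    have h2 : q' ^ k ≤ 1 := pow_le_one₀ hq0' hq1'.le
    have h3 := hb k
    have h4 := hb' k
    nlinarith
  · have hti : 0 < t⁻¹ := inv_pos.2 ht
    have h1 : ρ * T.A < ‖t⁻¹ • x‖ := by
      rw [norm_smul, Real.norm_of_nonneg hti.le]
      have : 1 < t⁻¹ := (one_lt_inv₀ ht).2 ht1
      nlinarith
    have h2 := (T.hasSum_multipole (DiffOp.continuous_app (Λ := Λ) hF) hρ.le h1).1.sub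
      (T.hasSum_multipole (DiffOp.continuous_app (Λ := Λ) hF') hρ.le h1).1
    rw [T.integral_eq_of_eq_off hF hF' hc hc' h (by nlinarith), sub_self] at h2
    have h3 := h2.const_smul ((t ^ T.N)⁻¹)
    rw [smul_zero] at h3
    refine h3.congr_fun fun k => ?_
    rw [T.multipole_smul _ _ _ hti hxne, T.multipole_smul _ _ _ hti hxne, ← smul_sub, smul_smul]
    congr 1
    rw [inv_pow, inv_inv, pow_add]
    field_simp

lemma moment_eq_of_forall_eq_zero {g : V n → Cl n} {ρ ρ' : ℝ} (h : ρ' ≤ ρ)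
    (hg : ∀ y, ρ' < ‖y‖ → ‖y‖ ≤ ρ → g y = 0) (k : ℕ) (i : Fin k → Fin n) :
    moment g ρ k i = moment g ρ' k i := by
  rw [moment, moment, setIntegral_eq_of_subset_of_forall_sdiff_eq_zero measurableSet_closedBall
    (closedBall_subset_closedBall h)]
  intro y hy
  rw [hg y (by simpa using hy.2) (by simpa using hy.1), smul_zero]

/-- The exponents of an iterated derivative. -/
def counts (i : Σ k : ℕ, Fin k → Fin n) : Fin n → ℕ := fun a => (List.ofFn i.2).count a

lemma sum_counts (i : Σ k : ℕ, Fin k → Fin n) : ∑ a, counts i a = i.1 := by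
  have := Multiset.sum_count_eq_card (s := Finset.univ) (m := (List.ofFn i.2 : Multiset (Fin n)))
    (by simp)
  simpa [counts] using this

/-- There are `n ^ k` sequences of length `k`. -/
lemma summable_sigma_pow {q : ℝ} (hq : 0 ≤ q) (hn : q * n < 1) :
    Summable fun i : Σ k : ℕ, Fin k → Fin n => q ^ i.1 := by
  rw [summable_sigma_of_nonneg fun _ => by positivity]
  refine ⟨fun k => (hasSum_fintype _).summable, ?_⟩
  simp only [tsum_fintype, Finset.sum_const, Finset.card_univ, Fintype.card_fun, Fintype.card_fin,
    nsmul_eq_mul]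
  convert summable_geometric_of_lt_one (by positivity) hn using 2 with k
  rw [mul_pow, mul_comm]; push_cast; rfl

lemma exists_counts_eq (m : Fin n → ℕ) : ∃ i, counts i = m :=
  ⟨⟨_, (multiList m).get⟩, by funext a; simp [counts, List.ofFn_get, count_multiList]⟩

lemma summable_pow_sum {q : ℝ} (hq : 0 ≤ q) (hn : q * n < 1) :
    Summable fun m : Fin n → ℕ => q ^ (∑ a, m a) := by
  choose i hi using exists_counts_eq (n := n)
  have hinj : Function.Injective i := fun m m' h => by rw [← hi m, h, hi m']
  refine ((summable_sigma_pow hq hn).comp_injective hinj).congr fun m => ?_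
  simp only [Function.comp_apply]
  rw [← sum_counts, hi]

end CliffordCylinder

-- Cutting off a solution in a punctured ball, and its Laurent coefficients.

open scoped Topology
namespace CliffordCylinder
open scoped ContDiff Nat
open Metric MeasureTheory Filter

variable {n j : ℕ} {Λ : DiffOp n j} (T : FundSol Λ)

/-- The part of the punctured ball of radius `R` to which a solution is cut off. -/
noncomputable def cutoff {R : ℝ} (hR : 0 < R) (p : ℕ) (y : V n) : ℝ :=
  (⟨R / 2, 3 * R / 4, by positivity, by linarith⟩ : ContDiffBump (0 : V n)) y -
    (⟨R / 4 * (1 / 2) ^ p / 2, R / 4 * (1 / 2) ^ p, by positivity,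
      by linarith [show 0 < R / 4 * (1 / 2 : ℝ) ^ p by positivity]⟩ : ContDiffBump (0 : V n)) y

section Cutoff

variable {R : ℝ} (hR : 0 < R) (p : ℕ)

lemma radius_le (hR : 0 < R) (p : ℕ) : R / 4 * (1 / 2) ^ p ≤ R / 4 :=
  mul_le_of_le_one_right (by positivity) (pow_le_one₀ (by norm_num) (by norm_num))

lemma radius_pos (hR : 0 < R) (p : ℕ) : 0 < R / 4 * (1 / 2) ^ p := by positivity

lemma contDiff_cutoff : ContDiff ℝ ∞ (cutoff (n := n) hR p) :=
  (ContDiffBump.contDiff _).sub (ContDiffBump.contDiff _)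

lemma cutoff_eq_one {y : V n} (h1 : R / 4 * (1 / 2) ^ p ≤ ‖y‖) (h2 : ‖y‖ ≤ R / 2) :
    cutoff hR p y = 1 := by
  rw [cutoff, ContDiffBump.one_of_mem_closedBall _ (by simpa using h2),
    ContDiffBump.zero_of_le_dist _ (by simpa using h1), sub_zero]

lemma cutoff_eq_zero_of_le {y : V n} (h : ‖y‖ ≤ R / 4 * (1 / 2) ^ p / 2) : cutoff hR p y = 0 := by
  have h2 : ‖y‖ ≤ R / 2 := by linarith [radius_le hR p, radius_pos hR p]
  rw [cutoff, ContDiffBump.one_of_mem_closedBall _ (by simpa using h2),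
    ContDiffBump.one_of_mem_closedBall _ (by simpa using h), sub_self]

lemma cutoff_eq_zero_of_ge {y : V n} (h : 3 * R / 4 ≤ ‖y‖) : cutoff hR p y = 0 := by
  have h2 : R / 4 * (1 / 2) ^ p ≤ ‖y‖ := by linarith [radius_le hR p, radius_pos hR p]
  rw [cutoff, ContDiffBump.zero_of_le_dist _ (by simpa using h),
    ContDiffBump.zero_of_le_dist _ (by simpa using h2), sub_zero]

lemma cutoff_eq_cutoff {y : V n} (h : R / 4 ≤ ‖y‖) : cutoff hR p y = cutoff hR 0 y := by
  have h1 : R / 4 * (1 / 2) ^ p ≤ ‖y‖ := (radius_le hR p).trans h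
  have h2 : R / 4 * (1 / 2) ^ 0 ≤ ‖y‖ := (radius_le hR 0).trans h
  rw [cutoff, cutoff, sub_right_inj]
  exact (ContDiffBump.zero_of_le_dist _ (by simpa using h1)).trans
    (ContDiffBump.zero_of_le_dist _ (by simpa using h2)).symm

variable {f : V n → Cl n} (hf : ∀ x, 0 < ‖x‖ → ‖x‖ < R → TameAt Λ f x)
include hf

lemma contDiff_cutoff_smul : ContDiff ℝ ∞ fun y => cutoff hR p y • f y := by
  rw [contDiff_iff_contDiffAt]
  intro y
  have hp := radius_pos hR p
  rcases lt_or_ge ‖y‖ (R / 4 * (1 / 2) ^ p / 2) with h | h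
  · refine (contDiffAt_const (c := (0 : Cl n))).congr_of_eventuallyEq ?_
    filter_upwards [(isOpen_lt continuous_norm continuous_const).mem_nhds h] with z hz
    rw [cutoff_eq_zero_of_le hR p (le_of_lt hz), zero_smul]
  rcases lt_or_ge (3 * R / 4) ‖y‖ with h' | h'
  · refine (contDiffAt_const (c := (0 : Cl n))).congr_of_eventuallyEq ?_
    filter_upwards [(isOpen_lt continuous_const continuous_norm).mem_nhds h'] with z hz
    rw [cutoff_eq_zero_of_ge hR p (le_of_lt hz), zero_smul]
  · exact (contDiff_cutoff hR p).contDiffAt.smul (hf y (by linarith) (by linarith)).contDiffAt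

omit hf in
lemma hasCompactSupport_cutoff_smul : HasCompactSupport fun y => cutoff hR p y • f y := by
  refine HasCompactSupport.intro (isCompact_closedBall (0 : V n) R) fun y hy => ?_
  rw [mem_closedBall_zero_iff, not_le] at hy
  rw [cutoff_eq_zero_of_ge hR p (by linarith), zero_smul]

lemma app_cutoff_smul_eq_zero {y : V n} (h1 : R / 4 * (1 / 2) ^ p < ‖y‖) (h2 : ‖y‖ < R / 2) :
    Λ.app (fun y => cutoff hR p y • f y) y = 0 := by
  have : (fun y => cutoff hR p y • f y) =ᶠ[𝓝 y] f := by
    filter_upwards [(isOpen_lt continuous_norm continuous_const).mem_nhds h2,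
      (isOpen_lt continuous_const continuous_norm).mem_nhds h1] with z hz hz'
    rw [cutoff_eq_one hR p (le_of_lt hz') (le_of_lt hz), one_smul]
  rw [DiffOp.app_congr this]
  exact (hf y ((radius_pos hR p).trans h1) (by linarith)).null

omit hf in
lemma app_cutoff_smul_eq_zero' {y : V n} (h : R < ‖y‖) :
    Λ.app (fun y => cutoff hR p y • f y) y = 0 := by
  have : (fun y => cutoff hR p y • f y) =ᶠ[𝓝 y] fun _ => 0 := by
    filter_upwards [(isOpen_lt continuous_const continuous_norm).mem_nhds h] with z hz
    have hz' : R < ‖z‖ := hz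
    rw [cutoff_eq_zero_of_ge hR p (by linarith), zero_smul]
  rw [DiffOp.app_congr this, DiffOp.app_zero]

/-- The part of a solution in a punctured ball which is regular at the centre. -/
noncomputable def FundSol.regularPart (f : V n → Cl n) (x : V n) : Cl n :=
  T.κ⁻¹ • ∫ y in closedBall (0 : V n) R \ ball 0 (R / 2),
    T.K (x - y) * Λ.app (fun y => cutoff hR 0 y • f y) y

omit hf in
lemma isCompact_shell (R : ℝ) : IsCompact (closedBall (0 : V n) R \ ball 0 (R / 2)) :=
  (isCompact_closedBall _ _).diff isOpen_ball

lemma FundSol.tame_regularPart : ∃ s A, 1 ≤ A ∧ Tame Λ (ball 0 (R / 4)) (T.regularPart hR f) s A := by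
  obtain ⟨s, A, hA, h⟩ := T.tame_potential (R := R / 2) (r := R / 4) (by linarith)
    (isCompact_shell R) (fun y hy => by simpa using hy.2)
    (DiffOp.continuous_app (Λ := Λ) (contDiff_cutoff_smul hR 0 hf))
  exact ⟨_, A, hA, h.const_smul _⟩

/-- After cutting off, `Λ` is nonzero only on a small ball and on the shell from `R / 2` to `R`. All
cutoffs agree beyond `R / 4`, so the potential of the shell is the same for every `p`, and it is the
regular part. -/
lemma FundSol.inner_add_outer {x : V n} (h1 : R / 4 * (1 / 2) ^ p < ‖x‖) (h2 : ‖x‖ < R / 2) :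
    T.κ • (f x - T.regularPart hR f x) = ∫ y in closedBall (0 : V n) (R / 4 * (1 / 2) ^ p),
      T.K (x - y) * Λ.app (fun y => cutoff hR p y • f y) y := by
  have hs := contDiff_cutoff_smul hR p hf
  have hcont := DiffOp.continuous_app (Λ := Λ) hs
  have hr := T.rep _ hs (hasCompactSupport_cutoff_smul hR p) x (by
    filter_upwards [(isOpen_lt continuous_norm continuous_const).mem_nhds h2,
      (isOpen_lt continuous_const continuous_norm).mem_nhds h1] with z hz hz'
    exact app_cutoff_smul_eq_zero hR p hf hz' hz)
  rw [cutoff_eq_one hR p h1.le h2.le, one_smul, ← setIntegral_eq_integral_of_forall_compl_eq_zero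
    (s := closedBall (0 : V n) (R / 4 * (1 / 2) ^ p) ∪ (closedBall (0 : V n) R \ ball 0 (R / 2))),
    setIntegral_union] at hr
  · have ho : T.κ • T.regularPart hR f x = ∫ y in closedBall (0 : V n) R \ ball 0 (R / 2),
        T.K (x - y) * Λ.app (fun y => cutoff hR p y • f y) y := by
      rw [regularPart, smul_smul, mul_inv_cancel₀ T.κ_ne, one_smul]
      refine setIntegral_congr_fun (isCompact_shell R).measurableSet fun y hy => ?_
      have hy' : R / 4 < ‖y‖ := by
        have : R / 2 ≤ ‖y‖ := by simpa using hy.2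
        linarith
      have : (fun y => cutoff hR 0 y • f y) =ᶠ[𝓝 y] fun y => cutoff hR p y • f y := by
        filter_upwards [(isOpen_lt continuous_const continuous_norm).mem_nhds hy'] with z hz
        rw [cutoff_eq_cutoff hR p (le_of_lt hz)]
      simp only [DiffOp.app_congr this]
    rw [smul_sub, hr, ho, add_sub_cancel_right]
  · rw [Set.disjoint_left]
    intro y hy hy'
    rw [mem_closedBall_zero_iff] at hy
    have : R / 2 ≤ ‖y‖ := by simpa using hy'.2
    linarith [radius_le hR p]
  · exact (isCompact_shell R).measurableSet
  · exact T.integrableOn_mul hcont (isCompact_closedBall _ _) (by simpa using h1)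
  · exact T.integrableOn_mul hcont (isCompact_shell R) fun h => by
      have : R / 2 ≤ ‖x‖ := by simpa using h.2
      linarith
  · intro y hy
    rw [Set.mem_union, not_or, mem_closedBall_zero_iff, not_le, Set.mem_sdiff, not_and_not_right,
      mem_closedBall_zero_iff, mem_ball_zero_iff] at hy
    rcases le_or_gt ‖y‖ R with h | h
    · rw [app_cutoff_smul_eq_zero hR p hf hy.1 (hy.2 h), mul_zero]
    · rw [app_cutoff_smul_eq_zero' hR p h, mul_zero]

/-- The two cut-off functions agree beyond `R / 4`, hence have the same multipole terms with respect
to the ball of radius `R / 4`; that ball may be shrunk because the density of level `p` vanishes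
between the two radii. -/
lemma FundSol.multipole_cutoff_eq (k : ℕ) {x : V n} (hx : x ≠ 0) :
    T.multipole (Λ.app fun y => cutoff hR p y • f y) (R / 4 * (1 / 2) ^ p) k x =
      T.multipole (Λ.app fun y => cutoff hR 0 y • f y) (R / 4) k x := by
  rw [← T.multipole_eq_of_eq_off (contDiff_cutoff_smul hR p hf) (contDiff_cutoff_smul hR 0 hf)
    (hasCompactSupport_cutoff_smul hR p) (hasCompactSupport_cutoff_smul hR 0) (ρ := R / 4)
    (by positivity) (fun y hy => by rw [cutoff_eq_cutoff hR p hy.le]) k hx]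
  simp only [Kernel.multipole]
  refine Finset.sum_congr rfl fun i _ => ?_
  rw [moment_eq_of_forall_eq_zero (radius_le hR p)]
  exact fun y hy hy' => app_cutoff_smul_eq_zero hR p hf hy (by linarith)

/-- For given `x`, a large `p` brings `x` into the region where the expansion of level `p`
converges, and the terms do not depend on `p`. -/
lemma FundSol.hasSum_multipole_cutoff {x : V n} (h1 : 0 < ‖x‖) (h2 : ‖x‖ < R / 2) :
    HasSum (fun k => T.multipole (Λ.app fun y => cutoff hR 0 y • f y) (R / 4) k x)
      (T.κ • (f x - T.regularPart hR f x)) := by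
  have hA := T.one_le_A
  have ht : Tendsto (fun p : ℕ => R / 4 * (1 / 2 : ℝ) ^ p * T.A) atTop (𝓝 (R / 4 * 0 * T.A)) :=
    ((tendsto_pow_atTop_nhds_zero_of_lt_one (by norm_num) (by norm_num)).const_mul _).mul_const _
  rw [mul_zero, zero_mul] at ht
  obtain ⟨p, hp⟩ := (ht.eventually (gt_mem_nhds h1)).exists
  have hp0 := radius_pos hR p
  rw [T.inner_add_outer hR p hf (lt_of_le_of_lt (le_mul_of_one_le_right hp0.le hA) hp) h2]
  have := (T.hasSum_multipole (DiffOp.continuous_app (Λ := Λ) (contDiff_cutoff_smul hR p hf))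
    hp0.le hp).1
  simpa only [T.multipole_cutoff_eq hR p hf _ (norm_pos_iff.1 h1)] using this


/-- The index of the density used for the coefficients of order `k`. -/
noncomputable def FundSol.level (f : V n → Cl n) (k : ℕ) : ℕ :=
  Nat.findGreatest (fun p => ∫ y in closedBall (0 : V n) (R / 4 * (1 / 2) ^ p),
    ‖Λ.app (fun y => cutoff hR p y • f y) y‖ ≤ 2 ^ k) k

omit hf in
-- However fast the masses of the densities grow with `p`, each single one is eventually below `2 ^
-- k`.
lemma FundSol.tendsto_level : Tendsto (FundSol.level (Λ := Λ) hR f) atTop atTop := by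
  refine tendsto_atTop.2 fun b => ?_
  obtain ⟨k₀, hk₀⟩ := pow_unbounded_of_one_lt (∫ y in closedBall (0 : V n) (R / 4 * (1 / 2) ^ b),
    ‖Λ.app (fun y => cutoff hR b y • f y) y‖) (one_lt_two : (1 : ℝ) < 2)
  filter_upwards [eventually_ge_atTop k₀, eventually_ge_atTop b] with k hk hb
  exact Nat.le_findGreatest hb (hk₀.le.trans (pow_le_pow_right₀ one_le_two hk))

omit hf in
lemma FundSol.exists_integral_level_le : ∃ C : ℝ, 0 ≤ C ∧ ∀ k, ∫ y in closedBall (0 : V n)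
      (R / 4 * (1 / 2) ^ FundSol.level (Λ := Λ) hR f k),
    ‖Λ.app (fun y => cutoff hR (FundSol.level (Λ := Λ) hR f k) y • f y) y‖ ≤ C * 2 ^ k := by
  set M : ℕ → ℝ := fun p => ∫ y in closedBall (0 : V n) (R / 4 * (1 / 2) ^ p),
    ‖Λ.app (fun y => cutoff hR p y • f y) y‖ with hM
  have hM0 : ∀ p, 0 ≤ M p := fun p => integral_nonneg fun _ => norm_nonneg _
  refine ⟨M 0 + 1, by linarith [hM0 0], fun k => ?_⟩
  change M (FundSol.level (Λ := Λ) hR f k) ≤ _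
  have h1 : (1 : ℝ) ≤ 2 ^ k := one_le_pow₀ one_le_two
  by_cases h : FundSol.level (Λ := Λ) hR f k = 0
  · rw [h]
    nlinarith [hM0 0]
  · have h2 : M (FundSol.level (Λ := Λ) hR f k) ≤ 2 ^ k :=
      Nat.findGreatest_of_ne_zero (P := fun p => M p ≤ 2 ^ k) rfl h
    nlinarith [hM0 0]

/-- The coefficients of the Laurent expansion, indexed by iterated derivatives. -/
noncomputable def FundSol.coeff (f : V n → Cl n) (i : Σ k : ℕ, Fin k → Fin n) : Cl n :=
  T.κ⁻¹ • moment (Λ.app fun y => cutoff hR (FundSol.level (Λ := Λ) hR f i.1) y • f y)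
    (R / 4 * (1 / 2) ^ FundSol.level (Λ := Λ) hR f i.1) i.1 i.2

/-- The moments of order `k` at level `p` are at most the mass of the density times `r_p ^ k / k!`,
where `r_p = R / 4 * (1 / 2) ^ p`. At the chosen level the mass is at most `C * 2 ^ k`, and `2 *
r_p` tends to zero as `k` grows, so its `k`-th power is `O(r ^ k)` for every `r > 0`. A fixed level
would give this only for `r` at least comparable to its own radius. -/
lemma FundSol.exists_norm_coeff_le {r : ℝ} (hr : 0 < r) :
    ∃ C : ℝ, 0 ≤ C ∧ ∀ i, ‖T.coeff hR f i‖ ≤ C * r ^ i.1 * (i.1 ! : ℝ)⁻¹ := by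
  obtain ⟨C, hC, hb⟩ := FundSol.exists_integral_level_le (Λ := Λ) (f := f) hR
  have ht : Tendsto (fun k => R / 4 * (1 / 2 : ℝ) ^ FundSol.level (Λ := Λ) hR f k) atTop
      (𝓝 (R / 4 * 0)) :=
    ((tendsto_pow_atTop_nhds_zero_of_lt_one (by norm_num) (by norm_num)).comp
      (FundSol.tendsto_level hR)).const_mul _
  rw [mul_zero] at ht
  have hev : ∀ᶠ k in atTop, (2 * (R / 4 * (1 / 2 : ℝ) ^ FundSol.level (Λ := Λ) hR f k)) ^ k / r ^ k
      ≤ 1 := by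
    filter_upwards [ht.eventually (gt_mem_nhds (show 0 < r / 2 by positivity))] with k hk
    rw [← div_pow]
    refine pow_le_one₀ (by positivity) ?_
    rw [div_le_one hr]
    linarith
  obtain ⟨B, hB⟩ := Filter.IsBoundedUnder.bddAbove_range
    (f := fun k => (2 * (R / 4 * (1 / 2 : ℝ) ^ FundSol.level (Λ := Λ) hR f k)) ^ k / r ^ k)
    ⟨1, hev⟩
  have hB' : ∀ k, (2 * (R / 4 * (1 / 2 : ℝ) ^ FundSol.level (Λ := Λ) hR f k)) ^ k ≤ B * r ^ k :=
    fun k => (div_le_iff₀ (by positivity)).1 (hB (Set.mem_range_self k))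
  have hB0 : 0 ≤ B := le_trans (by positivity) (hB (Set.mem_range_self 0))
  refine ⟨|T.κ⁻¹| * (C * B), by positivity, fun ⟨k, i⟩ => ?_⟩
  have h1 := norm_moment_le (DiffOp.continuous_app (Λ := Λ) (contDiff_cutoff_smul hR
    (FundSol.level (Λ := Λ) hR f k) hf)) (ρ := R / 4 * (1 / 2) ^ FundSol.level (Λ := Λ) hR f k) k i
  have h2 := hb k
  have h3 := hB' k
  rw [FundSol.coeff, norm_smul, Real.norm_eq_abs]
  simp only [mul_assoc |T.κ⁻¹|]
  gcongr
  refine h1.trans (mul_le_mul_of_nonneg_right ?_ (by positivity))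
  calc _ ≤ C * 2 ^ k * (R / 4 * (1 / 2) ^ FundSol.level (Λ := Λ) hR f k) ^ k := by gcongr
    _ = C * (2 * (R / 4 * (1 / 2) ^ FundSol.level (Λ := Λ) hR f k)) ^ k := by
      rw [mul_pow 2]; ring
    _ ≤ C * (B * r ^ k) := by gcongr
    _ = _ := by ring

/-- Absolute convergence over all sequences comes from the coefficient bound. The sum is then
evaluated order by order, and the multipole term of order `k` may be computed with the density of
its own level. -/
lemma FundSol.hasSum_coeff {x : V n} (h1 : 0 < ‖x‖) (h2 : ‖x‖ < R / 2) :
    HasSum (fun i : Σ k : ℕ, Fin k → Fin n => iterD (List.ofFn i.2) T.K x * T.coeff hR f i)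
      (f x - T.regularPart hR f x) := by
  have hx := norm_pos_iff.1 h1
  have hA := T.one_le_A
  have hC := T.C_nonneg
  have hsum : Summable fun i : Σ k : ℕ, Fin k → Fin n =>
      iterD (List.ofFn i.2) T.K x * T.coeff hR f i := by
    -- Chosen so that `A * r / ‖x‖` is the number `q` below, and `q * n < 1` outweighs the `n ^ k`
    -- sequences of length `k`.
    set r : ℝ := ‖x‖ / (2 * (n + 1) * T.A) with hr
    have hr0 : 0 < r := by positivity
    obtain ⟨C, hC0, hb⟩ := T.exists_norm_coeff_le hR hf hr0
    set q : ℝ := (2 * (n + 1))⁻¹ with hq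
    have hq0 : 0 ≤ q := by positivity
    have hqn : q * n < 1 := by
      rw [hq, inv_mul_lt_iff₀ (by positivity)]; linarith
    refine Summable.of_norm_bounded (((summable_sigma_pow hq0 hqn).mul_left
      (‖(mulL : Cl n →L[ℝ] _)‖ * (T.C * (‖x‖ ^ T.N)⁻¹ * C)))) fun ⟨k, i⟩ => ?_
    refine (norm_mul_le_mulL _ _).trans ?_
    have h3 : ‖iterD (List.ofFn i) T.K x‖ ≤ T.C * T.A ^ k * (k ! : ℝ) * (‖x‖ ^ (T.N + k))⁻¹ := by
      rw [← iteratedFDeriv_stdVec isOpen_compl_singleton (fun z hz => T.contDiffAt hz) k i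
        (x := x) hx]
      refine ((iteratedFDeriv ℝ k T.K x).le_opNorm _).trans ?_
      simp only [norm_stdVec, Finset.prod_const_one, mul_one]
      exact T.norm_iteratedFDeriv_le hx k
    have h4 : (k ! : ℝ) ≠ 0 := by positivity
    calc _ ≤ ‖(mulL : Cl n →L[ℝ] _)‖ * (T.C * T.A ^ k * (k ! : ℝ) * (‖x‖ ^ (T.N + k))⁻¹) *
          (C * r ^ k * (k ! : ℝ)⁻¹) := by
          gcongr
          exact hb ⟨k, i⟩
      _ = _ := by
        have h5 : q ^ k = T.A ^ k * (‖x‖ ^ k)⁻¹ * r ^ k := by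
          rw [← inv_pow, ← mul_pow, ← mul_pow, hq, hr]
          congr 1
          field_simp
        rw [h5, pow_add]
        field_simp
  have hs := hsum.hasSum.sigma (fun k => hasSum_fintype _)
  have h3 := (T.hasSum_multipole_cutoff hR hf h1 h2).const_smul T.κ⁻¹
  rw [smul_smul, inv_mul_cancel₀ T.κ_ne, one_smul] at h3
  have h4 := HasSum.unique (h3.congr_fun fun k => ?_) hs
  · rw [h4]; exact hsum.hasSum
  · rw [← T.multipole_cutoff_eq hR (FundSol.level (Λ := Λ) hR f k) hf k hx]
    simp only [Kernel.multipole, Finset.smul_sum, FundSol.coeff, mul_smul_comm]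

omit hf in
-- The level never exceeds the order, so it is `0` for order `0`, and the residue is an explicit
-- integral for the fixed cutoff `p = 0`.
lemma FundSol.coeff_zero (i : Fin 0 → Fin n) : T.coeff hR f ⟨0, i⟩ =
    T.κ⁻¹ • ∫ y in closedBall (0 : V n) (R / 4), Λ.app (fun y => cutoff hR 0 y • f y) y := by
  have : FundSol.level (Λ := Λ) hR f 0 = 0 := by simp [FundSol.level]
  simp [FundSol.coeff, moment, this]

/-- The coefficients of the Laurent expansion. -/
noncomputable def FundSol.laurentCoeff (f : V n → Cl n) (m : Fin n → ℕ) : Cl n :=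
  ∑' i : {i // counts i = m}, T.coeff hR f i.1

/-- The bound for single coefficients is used with `r * q` in place of `r`; the surplus `q ^ k` pays
for all sequences with the same counts. -/
lemma FundSol.exists_norm_laurentCoeff_le {r : ℝ} (hr : 0 < r) :
    ∃ C : ℝ, 0 ≤ C ∧ (∀ m, Summable fun i : {i // counts i = m} => T.coeff hR f i.1) ∧
      ∀ m, ‖T.laurentCoeff hR f m‖ ≤ C * r ^ (∑ a, m a) * ((∑ a, m a)! : ℝ)⁻¹ := by
  set q : ℝ := (2 * (n + 1))⁻¹ with hq
  have hq0 : 0 < q := by positivity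
  have hqn : q * n < 1 := by
    rw [hq, inv_mul_lt_iff₀ (by positivity)]; linarith
  obtain ⟨C, hC, hb⟩ := T.exists_norm_coeff_le hR hf (show 0 < r * q by positivity)
  have hs := summable_sigma_pow hq0.le hqn
  have hb' : ∀ m, ∀ i : {i // counts i = m}, ‖T.coeff hR f i.1‖ ≤
      C * r ^ (∑ a, m a) * ((∑ a, m a)! : ℝ)⁻¹ * q ^ i.1.1 := by
    rintro m ⟨i, rfl⟩
    rw [sum_counts]
    refine (hb i).trans (le_of_eq ?_)
    rw [mul_pow]; ring
  have hs' : ∀ m, Summable fun i : {i // counts i = m} => C * r ^ (∑ a, m a) *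
      ((∑ a, m a)! : ℝ)⁻¹ * q ^ i.1.1 := fun m =>
    (hs.comp_injective Subtype.val_injective).mul_left _
  refine ⟨C * ∑' i : Σ k : ℕ, Fin k → Fin n, q ^ i.1, mul_nonneg hC (tsum_nonneg fun _ => by
    positivity), fun m => Summable.of_norm_bounded (hs' m) (hb' m), fun m => ?_⟩
  refine (tsum_of_norm_bounded (hs' m).hasSum (hb' m)).trans ?_
  rw [tsum_mul_left]
  have h1 : ∑' i : {i // counts i = m}, q ^ i.1.1 ≤ ∑' i : Σ k : ℕ, Fin k → Fin n, q ^ i.1 :=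
    Summable.tsum_subtype_le (fun i : Σ k : ℕ, Fin k → Fin n => q ^ i.1) {i | counts i = m}
      (fun _ => by positivity) hs
  calc _ ≤ C * r ^ (∑ a, m a) * ((∑ a, m a)! : ℝ)⁻¹ *
        ∑' i : Σ k : ℕ, Fin k → Fin n, q ^ i.1 := by gcongr
    _ = _ := by ring

omit hf in
lemma FundSol.laurentCoeff_zero : T.laurentCoeff hR f 0 =
    T.κ⁻¹ • ∫ y in closedBall (0 : V n) (R / 4), Λ.app (fun y => cutoff hR 0 y • f y) y := by
  have h0 : counts (⟨0, Fin.elim0⟩ : Σ k : ℕ, Fin k → Fin n) = 0 := by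
    funext a; simp [counts]
  rw [FundSol.laurentCoeff, tsum_eq_single ⟨⟨0, Fin.elim0⟩, h0⟩]
  · exact T.coeff_zero hR _
  · rintro ⟨⟨k, i⟩, hi⟩ hne
    exfalso
    apply hne
    have h1 := sum_counts ⟨k, i⟩
    rw [hi] at h1
    simp only [Pi.zero_apply, Finset.sum_const_zero] at h1
    subst h1
    congr
    exact Subsingleton.elim _ _

/-- The Laurent expansion of a solution at an isolated singularity. -/
lemma FundSol.hasSum_laurent {x : V n} (h1 : 0 < ‖x‖) (h2 : ‖x‖ < R / 2) :
    HasSum (fun m => multiDeriv m T.K x * T.laurentCoeff hR f m) (f x - T.regularPart hR f x) := by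
  obtain ⟨C, -, hs, -⟩ := T.exists_norm_laurentCoeff_le hR hf one_pos
  have h3 := T.hasSum_coeff hR hf h1 h2
  rw [← (Equiv.sigmaFiberEquiv counts).hasSum_iff] at h3
  refine h3.sigma fun m => ?_
  have h4 := (hs m).hasSum.mapL (mulL (multiDeriv m T.K x))
  refine h4.congr_fun ?_
  rintro ⟨i, rfl⟩
  rw [Function.comp_apply, Equiv.sigmaFiberEquiv_apply, iterD_eq_multiDeriv isOpen_compl_singleton
    (fun z hz => T.contDiffAt hz) _ (x := x) (norm_pos_iff.1 h1)]
  rfl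

end Cutoff

end CliffordCylinder

open scoped Topology
namespace CliffordCylinder
open Metric Filter

/-! ### Lattices -/

section Lattice

variable {n k : ℕ} (ω : Fin k → V n)

lemma latPt_add (m m' : Fin k → ℤ) : latPt ω (m + m') = latPt ω m + latPt ω m' := by
  simp [latPt, add_smul, Finset.sum_add_distrib]

@[simp] lemma latPt_zero : latPt ω 0 = 0 := by simp [latPt]

lemma latPt_neg (m : Fin k → ℤ) : latPt ω (-m) = -latPt ω m := by
  simp [latPt]

lemma latPt_single (i : Fin k) : latPt ω (Pi.single i 1) = ω i := by
  classical
  rw [latPt, Finset.sum_eq_single i]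
  · simp
  · intro b _ hb; simp [hb]
  · simp

lemma latPt_mem_lattice (m : Fin k → ℤ) : latPt ω m ∈ lattice ω :=
  AddSubgroup.sum_mem _ fun i _ => AddSubgroup.zsmul_mem _
    (AddSubgroup.subset_closure (Set.mem_range_self i)) _

lemma mem_lattice_iff {x : V n} : x ∈ lattice ω ↔ ∃ m, latPt ω m = x := by
  refine ⟨fun h => ?_, fun ⟨m, hm⟩ => hm ▸ latPt_mem_lattice ω m⟩
  induction h using AddSubgroup.closure_induction with
  | mem x hx => obtain ⟨i, rfl⟩ := hx; exact ⟨_, latPt_single ω i⟩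
  | zero => exact ⟨0, latPt_zero ω⟩
  | add x y _ _ hx hy =>
    obtain ⟨a, rfl⟩ := hx
    obtain ⟨b, rfl⟩ := hy
    exact ⟨a + b, latPt_add ω a b⟩
  | neg x _ hx => obtain ⟨a, rfl⟩ := hx; exact ⟨-a, latPt_neg ω a⟩

variable {l : ℕ}

lemma sgn_add (m m' : Fin k → ℤ) : sgn l (m + m') = sgn l m * sgn l m' := by
  simp only [sgn, Pi.add_apply, Finset.sum_add_distrib]
  exact zpow_add₀ (by norm_num) _ _

@[simp] lemma sgn_zero : sgn l (0 : Fin k → ℤ) = 1 := by simp [sgn]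

lemma sgn_zero_left (m : Fin k → ℤ) : sgn 0 m = 1 := by simp [sgn]

lemma sgn_mul_self (m : Fin k → ℤ) : sgn l m * sgn l m = 1 := by
  rw [sgn, ← mul_zpow]; norm_num

lemma sgn_neg (m : Fin k → ℤ) : sgn l (-m) = sgn l m := by
  have h1 := sgn_add (l := l) m (-m)
  rw [add_neg_cancel, sgn_zero] at h1
  have h2 := sgn_mul_self (l := l) m
  calc sgn l (-m) = sgn l m * sgn l m * sgn l (-m) := by rw [h2, one_mul]
    _ = sgn l m * (sgn l m * sgn l (-m)) := by ring
    _ = sgn l m := by rw [← h1, mul_one]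

lemma abs_sgn (m : Fin k → ℤ) : |sgn l m| = 1 := by
  have h := sgn_mul_self (l := l) m
  rw [← abs_mul_abs_self] at h
  nlinarith [abs_nonneg (sgn l m)]

lemma norm_intCast_pi (m : Fin k → ℤ) : ‖(fun i => (m i : ℝ))‖ = ‖m‖ := by
  simp only [Pi.norm_def, nnnorm, Int.norm_eq_abs, Real.norm_eq_abs]

variable {ω} (hω : LinearIndependent ℝ ω)
include hω

lemma exists_norm_latPt_ge : ∃ c > 0, ∀ m : Fin k → ℤ, c * ‖m‖ ≤ ‖latPt ω m‖ := by
  have hinj : Function.Injective (Fintype.linearCombination ℝ ω) :=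
    hω.fintypeLinearCombination_injective
  obtain ⟨K, hK, hA⟩ := (LinearMap.injective_iff_antilipschitz _).1 hinj
  refine ⟨(K : ℝ)⁻¹, by positivity, fun m => ?_⟩
  have h1 := ZeroHomClass.bound_of_antilipschitz (Fintype.linearCombination ℝ ω) hA
    (fun i => (m i : ℝ))
  have h2 : Fintype.linearCombination ℝ ω (fun i => (m i : ℝ)) = latPt ω m := by
    simp [Fintype.linearCombination_apply, latPt, Int.cast_smul_eq_zsmul]
  have h3 := norm_intCast_pi m
  rw [h2, h3] at h1
  rw [inv_mul_le_iff₀ (by positivity)]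
  exact h1

lemma latPt_ne_zero {m : Fin k → ℤ} (hm : m ≠ 0) : latPt ω m ≠ 0 := by
  obtain ⟨c, hc, h⟩ := exists_norm_latPt_ge hω
  have := h m
  have h2 := norm_pos_iff.2 hm
  exact norm_pos_iff.1 (lt_of_lt_of_le (by positivity) this)

lemma finite_norm_latPt_lt (R : ℝ) : {m : Fin k → ℤ | ‖latPt ω m‖ < R}.Finite := by
  obtain ⟨c, hc, h⟩ := exists_norm_latPt_ge hω
  refine (isCompact_closedBall (0 : Fin k → ℤ) (R / c)).finite_of_discrete.subset fun m hm => ?_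
  rw [mem_closedBall_zero_iff, le_div_iff₀ hc, mul_comm]
  exact (h m).trans (le_of_lt hm)

/-- By linear independence `‖latPt ω m‖` is bounded below by a multiple of `‖m‖`, so the sum is
compared with the one over `ℤᵏ`. The critical exponent is the rank `k` and not the dimension `n`. -/
lemma summable_norm_latPt {M : ℕ} (hM : k < M) :
    Summable fun m : Fin k → ℤ => ‖latPt ω m‖⁻¹ ^ M := by
  obtain ⟨c, hc, h⟩ := exists_norm_latPt_ge hω
  set b := Pi.basisFun ℝ (Fin k)
  have hr : Module.finrank ℤ (Submodule.span ℤ (Set.range b)) = k := by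
    rw [ZLattice.rank ℝ (Submodule.span ℤ (Set.range b))]; simp
  have h1 := ZLattice.summable_norm_pow_inv (Submodule.span ℤ (Set.range b)) M (by rwa [hr])
  have hmem : ∀ m : Fin k → ℤ, (fun i => (m i : ℝ)) ∈ Submodule.span ℤ (Set.range b) := fun m => by
    have : (fun i => (m i : ℝ)) = ∑ i, m i • b i := by
      funext i
      simp [b, Finset.sum_apply, Pi.single_apply]
    rw [this]
    exact Submodule.sum_mem _ fun i _ => Submodule.smul_mem _ _
      (Submodule.subset_span (Set.mem_range_self i))
  have hinj : Function.Injective fun m : Fin k → ℤ =>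
      (⟨fun i => (m i : ℝ), hmem m⟩ : Submodule.span ℤ (Set.range b)) := fun m m' hmm => by
    funext i
    have := congrFun (congrArg Subtype.val hmm) i
    exact Int.cast_injective (α := ℝ) this
  have h2 := (h1.comp_injective hinj).mul_left (c⁻¹ ^ M)
  refine Summable.of_nonneg_of_le (fun _ => by positivity) (fun m => ?_) h2
  have h3 : ‖(⟨fun i => (m i : ℝ), hmem m⟩ : Submodule.span ℤ (Set.range b))‖ = ‖m‖ := by
    rw [← norm_intCast_pi]; rfl
  rw [Function.comp_apply, h3, ← mul_pow, ← mul_inv]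
  by_cases hm : m = 0
  · simp [hm]
  · have := norm_pos_iff.2 hm
    gcongr
    exact h m

end Lattice

open scoped ContDiff Nat

/-! ### Taylor remainders -/

section Taylor

variable {X E : Type*} [NormedAddCommGroup X] [NormedSpace ℝ X]
  [NormedAddCommGroup E] [NormedSpace ℝ E]

/-- In the applications `A` is of the size of `1 / ‖ω‖`, so the factor `A` gained here is one order
of decay; the rate may be relaxed to `1`. -/
lemma DerivBound.sub_zero_apply {R : ℝ} (hR : 0 < R) {f : X → E} {s A : ℝ} (hA : 0 ≤ A)
    (hA1 : 2 * A ≤ 1) (hf : DerivBound (ball 0 R) f s A) :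
    DerivBound (ball 0 R) (fun x => f x - f 0) (s * A * (R + 1)) 1 := by
  have h := (hf.fderiv hA).mono subset_rfl le_rfl (by positivity) hA1
  refine DerivBound.of_fderiv hR le_rfl (fun x hx => (hf x hx).1.sub contDiffAt_const) ?_
    (sub_self _)
  refine h.congr isOpen_ball fun x _ => ?_
  exact fderiv_sub_const _

/-- The differential of the remainder is the remainder of one order less for `fderiv ℝ f`, and a
function vanishing at `0` is controlled by its differential. Each order doubles the rate once more,
whence the stronger smallness condition on `A`. -/
lemma DerivBound.sub_taylor_one {R : ℝ} (hR : 0 < R) {f : X → E} {s A : ℝ} (hA : 0 ≤ A)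
    (hA1 : 4 * A ≤ 1) (hf : DerivBound (ball 0 R) f s A) :
    DerivBound (ball 0 R) (fun x => f x - (f 0 + _root_.fderiv ℝ f 0 x))
      (s * A * (2 * A) * (R + 1) * (R + 1)) 1 := by
  have h := (hf.fderiv hA).sub_zero_apply hR (by positivity) (by linarith)
  refine DerivBound.of_fderiv hR le_rfl (fun x hx => (hf x hx).1.sub (contDiffAt_const.add
    (ContinuousLinearMap.contDiff _).contDiffAt)) ?_ (by simp)
  refine h.congr isOpen_ball fun x hx => ?_
  have h1 : HasFDerivAt f (_root_.fderiv ℝ f x) x :=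
    ((hf x hx).1.differentiableAt (by simp)).hasFDerivAt
  have h2 := h1.sub ((_root_.fderiv ℝ f 0).hasFDerivAt (x := x) |>.const_add (f 0))
  exact h2.fderiv

lemma DerivBound.sub_taylor_two {R : ℝ} (hR : 0 < R) {f : X → E} {s A : ℝ} (hA : 0 ≤ A)
    (hA1 : 8 * A ≤ 1) (hf : DerivBound (ball 0 R) f s A) :
    DerivBound (ball 0 R) (fun x => f x - (f 0 + _root_.fderiv ℝ f 0 x +
      (1 / 2 : ℝ) • _root_.fderiv ℝ (_root_.fderiv ℝ f) 0 x x))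
      (s * A * (2 * A) * (2 * (2 * A)) * (R + 1) * (R + 1) * (R + 1)) 1 := by
  have h := (hf.fderiv hA).sub_taylor_one hR (by positivity) (by linarith)
  set B := _root_.fderiv ℝ (_root_.fderiv ℝ f) 0 with hB
  have hq : ∀ x, HasFDerivAt (fun x => B x x) (B x + B.flip x) x := by
    intro x
    have := (B.hasFDerivAt (x := x)).clm_apply (hasFDerivAt_id x)
    simpa using! this
  have hqs : ContDiff ℝ ∞ fun x => B x x := B.contDiff.clm_apply contDiff_id
  refine DerivBound.of_fderiv hR le_rfl (fun x hx => (hf x hx).1.sub ((contDiffAt_const.add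
    (ContinuousLinearMap.contDiff _).contDiffAt).add (hqs.const_smul (1 / 2 : ℝ)).contDiffAt)) ?_
    (by simp)
  refine h.congr isOpen_ball fun x hx => ?_
  have h1 : HasFDerivAt f (_root_.fderiv ℝ f x) x :=
    ((hf x hx).1.differentiableAt (by simp)).hasFDerivAt
  have h2 := h1.sub (((_root_.fderiv ℝ f 0).hasFDerivAt (x := x) |>.const_add (f 0)).add
    ((hq x).const_smul (1 / 2 : ℝ)))
  refine h2.fderiv.trans ?_
  have hsymm : B.flip x = B x := by
    ext y
    have hs : IsSymmSndFDerivAt ℝ f 0 := by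
      refine ContDiffAt.isSymmSndFDerivAt (n := ∞) (hf 0 (mem_ball_self hR)).1 ?_
      simpa using two_le_infty
    exact hs.eq _ _
  rw [hsymm, ← two_smul ℝ (B x), smul_smul]
  norm_num

end Taylor

variable {n j : ℕ} {Λ : DiffOp n j}

/-- By the mean value inequality for every derivative, a difference gains a factor `A`, just as the
subtraction of a Taylor term does. -/
lemma Tame.difference {R : ℝ} {v : V n} {f : V n → Cl n} {s A : ℝ} (hA : 0 ≤ A)
    (hf : Tame Λ (ball 0 (R + ‖v‖)) f s A) :
    Tame Λ (ball 0 R) (fun x => f (x + v) - f x) (s * A * ‖v‖) (2 * A) := by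
  have hmem : ∀ x ∈ ball (0 : V n) R, ∀ t ∈ Set.Icc (0 : ℝ) 1, x + t • v ∈ ball 0 (R + ‖v‖) := by
    intro x hx t ht
    rw [mem_ball_zero_iff] at hx ⊢
    refine (norm_add_le _ _).trans_lt ?_
    rw [norm_smul, Real.norm_of_nonneg ht.1]
    nlinarith [norm_nonneg v, ht.2]
  have hm0 : ∀ x ∈ ball (0 : V n) R, x ∈ ball 0 (R + ‖v‖) := fun x hx => by
    simpa using hmem x hx 0 (by simp)
  have hm1 : ∀ x ∈ ball (0 : V n) R, x + v ∈ ball 0 (R + ‖v‖) := fun x hx => by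
    simpa using hmem x hx 1 (by simp)
  have hD : ∀ k : ℕ, ∀ x ∈ ball (0 : V n) R, iteratedFDeriv ℝ k (fun x => f (x + v) - f x) x =
      iteratedFDeriv ℝ k f (x + v) - iteratedFDeriv ℝ k f x := by
    intro k x hx
    rw [fun_iteratedFDeriv_sub_apply, iteratedFDeriv_comp_add_right]
    · exact ((hf.bound _ (hm1 x hx)).1.comp x (contDiffAt_id.add contDiffAt_const)).of_le
        (by exact_mod_cast le_top)
    · exact (hf.bound _ (hm0 x hx)).1.of_le (by exact_mod_cast le_top)
  refine ⟨fun x hx => ⟨((hf.bound _ (hm1 x hx)).1.comp x (contDiffAt_id.add contDiffAt_const)).sub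
    (hf.bound _ (hm0 x hx)).1, fun k => ?_⟩, fun x hx => ?_⟩
  · rw [hD k x hx]
    have h0 := hf.bound.nonneg ⟨x, hm0 x hx⟩
    have h1 := Convex.norm_image_sub_le_of_norm_fderiv_le (𝕜 := ℝ) (f := iteratedFDeriv ℝ k f)
      (C := s * A ^ (k + 1) * ((k + 1)! : ℝ)) (fun y hy =>
        (hf.bound y hy).1.differentiableAt_iteratedFDeriv (by exact_mod_cast WithTop.coe_lt_top k))
      (fun y hy => by rw [norm_fderiv_iteratedFDeriv]; exact (hf.bound y hy).2 (k + 1))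
      (convex_ball (0 : V n) (R + ‖v‖)) (hm0 x hx) (hm1 x hx)
    rw [add_sub_cancel_left] at h1
    refine h1.trans ?_
    have h2 := pow_succ_mul_factorial_succ_le hA k
    calc _ = s * (A ^ (k + 1) * ((k + 1)! : ℝ)) * ‖v‖ := by ring
      _ ≤ s * (A * (2 * A) ^ k * (k ! : ℝ)) * ‖v‖ := by gcongr
      _ = _ := by ring
  · rw [hD j x hx, map_sub, hf.null _ (hm1 x hx), hf.null _ (hm0 x hx), sub_zero]

end CliffordCylinder

open scoped Topology
namespace CliffordCylinder
open Metric Filter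

/-! ### Convergent lattice sums -/

section LatticeSum

variable {n k j : ℕ} {Λ : DiffOp n j} {ω : Fin k → V n} {l M : ℕ}

variable (Λ ω M) in
/-- The terms of a lattice sum are null solutions near any given point, up to finitely many, and
decay with order `M`. -/
def TameTail (t : (Fin k → ℤ) → V n → Cl n) : Prop :=
  ∀ r > 0, ∃ C A ρ : ℝ, 1 ≤ A ∧ ∀ m, ρ ≤ ‖latPt ω m‖ →
    Tame Λ (ball 0 r) (t m) (C * ‖latPt ω m‖⁻¹ ^ M) A

section Tail

variable (hω : LinearIndependent ℝ ω) (hM : k < M) {t : (Fin k → ℤ) → V n → Cl n}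
  (ht : TameTail Λ ω M t)
include hω hM ht

lemma TameTail.tameAt_and_summable {x : V n} (hx : ∀ m, TameAt Λ (t m) x) :
    TameAt Λ (fun y => ∑' m, t m y) x ∧ ∀ᶠ y in 𝓝 x, Summable fun m => t m y := by
  obtain ⟨C, A, ρ, hA, h⟩ := ht (‖x‖ + 1) (by positivity)
  refine tameAt_tsum hx one_pos hA ((summable_norm_latPt hω hM).mul_left C)
    (finite_norm_latPt_lt hω ρ).toFinset fun m hm => ?_
  simp only [Set.Finite.mem_toFinset, Set.mem_ofPred_eq, not_lt] at hm
  refine (h m hm).mono (fun y hy => ?_) le_rfl (by linarith) le_rfl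
  rw [mem_ball_zero_iff]
  rw [mem_ball_iff_norm] at hy
  linarith [norm_le_norm_add_norm_sub' y x]

lemma TameTail.summable (x : V n) : Summable fun m => t m x := by
  obtain ⟨C, A, ρ, hA, h⟩ := ht (‖x‖ + 1) (by positivity)
  refine Summable.of_norm_bounded_eventually ((summable_norm_latPt hω hM).mul_left C) ?_
  refine (finite_norm_latPt_lt hω ρ).subset fun m hm => ?_
  by_contra hm'
  simp only [Set.mem_ofPred_eq, not_lt] at hm'
  exact hm ((h m hm').bound.norm_le (by rw [mem_ball_zero_iff]; linarith))

end Tail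

variable (T : Kernel Λ)

/-- Null solutions `p z` which approximate `K (z + ·)` up to order `M`. -/
structure SubPoly (M : ℕ) where
  /-- The approximation. -/
  p : V n → V n → Cl n
  zero : p 0 = 0
  tame : ∀ z x, TameAt Λ (p z) x
  bound : ∀ r > 0, ∃ C ρ : ℝ, ∀ z, ρ ≤ ‖z‖ →
    DerivBound (ball 0 r) (fun x => T.K (x + z) - p z x) (C * ‖z‖⁻¹ ^ M) 1

variable {T} (P : SubPoly T M)

variable (ω l) in
/-- The terms of a convergent lattice sum. -/
noncomputable def SubPoly.term (m : Fin k → ℤ) (x : V n) : Cl n :=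
  sgn l m • (T.K (x + latPt ω m) - P.p (latPt ω m) x)

variable (ω l) in
/-- The convergent lattice sum with the terms `P.p` subtracted. -/
noncomputable def SubPoly.sum (x : V n) : Cl n := ∑' m, P.term ω l m x

lemma SubPoly.tameAt_term {m : Fin k → ℤ} {x : V n} (h : x + latPt ω m ≠ 0) :
    TameAt Λ (P.term ω l m) x :=
  ((T.tameAt_shift h).sub (P.tame _ x)).const_smul _

lemma SubPoly.tameTail : TameTail Λ ω M (P.term ω l) := by
  intro r hr
  obtain ⟨C, ρ, h⟩ := P.bound r hr
  -- A lattice point of norm at least `r` has its pole outside the open ball.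
  refine ⟨C, 1, max ρ r, le_rfl, fun m hm => ⟨?_, fun x hx => (P.tameAt_term ?_).null⟩⟩
  · have := (h _ ((le_max_left _ _).trans hm)).const_smul (sgn l m)
    rwa [abs_sgn, one_mul] at this
  · intro h0
    rw [mem_ball_zero_iff, eq_neg_of_add_eq_zero_left h0, norm_neg] at hx
    linarith [le_max_right ρ r]

variable (hω : LinearIndependent ℝ ω) (hM : k < M)
include hω hM

lemma SubPoly.summable (x : V n) : Summable fun m => P.term ω l m x :=
  P.tameTail.summable hω hM x

omit hω hM in
lemma add_latPt_ne_zero {x : V n} (hx : x ∉ lattice ω) (m : Fin k → ℤ) : x + latPt ω m ≠ 0 :=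
  fun h => hx (by rw [eq_neg_of_add_eq_zero_left h]; exact neg_mem (latPt_mem_lattice ω m))

lemma SubPoly.tameAt_sum {x : V n} (hx : x ∉ lattice ω) : TameAt Λ (P.sum ω l) x :=
  (P.tameTail.tameAt_and_summable hω hM fun m => P.tameAt_term (add_latPt_ne_zero hx m)).1

/-- As `P.p 0 = 0`, the term at the origin is `K` itself, and the other terms have no pole at `0`.
-/
lemma SubPoly.exists_eq_add : ∃ r, TameAt Λ r 0 ∧ ∀ x, P.sum ω l x = T.K x + r x := by
  classical
  have htail : TameTail Λ ω M (fun m x => if m = 0 then 0 else P.term ω l m x) := by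
    intro r hr
    obtain ⟨C, A, ρ, hA, h⟩ := P.tameTail (ω := ω) (l := l) r hr
    refine ⟨C, A, max ρ 1, hA, fun m hm => ?_⟩
    have hm0 : m ≠ 0 := by
      rintro rfl
      rw [latPt_zero, norm_zero] at hm
      linarith [le_max_right ρ 1]
    simpa only [hm0, if_false] using h m ((le_max_left _ _).trans hm)
  refine ⟨fun x => ∑' m, if m = 0 then 0 else P.term ω l m x,
    (htail.tameAt_and_summable hω hM fun m => ?_).1, fun x => ?_⟩
  · by_cases hm : m = 0
    · simpa only [hm, if_true] using tameAt_zero 0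
    · simp only [hm, if_false]
      refine P.tameAt_term ?_
      rw [zero_add]
      exact latPt_ne_zero hω hm
  · rw [SubPoly.sum, (P.summable hω hM x).tsum_eq_add_tsum_ite 0]
    congr 1
    simp [SubPoly.term, P.zero]

end LatticeSum

/-! ### Increments of lattice sums -/

section Increments

variable {k : ℕ} {E : Type*} [NormedAddCommGroup E] [CompleteSpace E]

/-- Telescoping along the lines in one direction. -/
lemma tsum_eq_zero_of_telescope {i : Fin k} {s h h' : (Fin k → ℤ) → E} (hs : Summable s)
    (hh : Tendsto h cofinite (𝓝 0)) (hh' : Tendsto h' cofinite (𝓝 0))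
    (he : ∀ m, s m = (h (m + Pi.single i 1) - h m) + (h' (m + Pi.single i 1) - h' m)) :
    ∑' m, s m = 0 := by
  classical
  set f : (Fin k → ℤ) → E := fun m => h m + h' m with hf
  have hf0 : Tendsto f cofinite (𝓝 0) := by simpa using hh.add hh'
  have he' : ∀ m, s m = f (m + Pi.single i 1) - f m := fun m => by
    simp only [he, hf]; abel
  -- The sum is evaluated line by line in the direction `i`; on each line the symmetric partial sums
  -- telescope to boundary terms tending to zero. Neither `h` nor `h'` has to be summable.
  set e := (Equiv.funSplitAt i ℤ).symm with hee
  have hsum : Summable fun q : ℤ × ({a // a ≠ i} → ℤ) => s (e q) := (e.summable_iff).2 hs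
  have hsum' : Summable fun q : ({a // a ≠ i} → ℤ) × ℤ => s (e q.swap) :=
    (Equiv.prodComm _ _).summable_iff.2 hsum
  rw [← e.tsum_eq s, ← (Equiv.prodComm _ _).tsum_eq fun q => s (e q)]
  change ∑' q : ({a // a ≠ i} → ℤ) × ℤ, s (e q.swap) = 0
  rw [hsum'.tsum_prod]
  refine (tsum_congr fun q => ?_).trans tsum_zero
  have hline := hsum'.prod_factor q
  simp only [Prod.swap_prod_mk] at hline ⊢
  have hstep : ∀ t : ℤ, e (t, q) + Pi.single i 1 = e (t + 1, q) := by
    intro t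
    funext a
    by_cases ha : a = i
    · subst ha; simp [hee]
    · simp [hee, ha]
  have hinj : Function.Injective fun t : ℤ => e (t, q) := fun t t' htt => by
    simpa using e.injective htt
  have hg : Tendsto (fun t : ℤ => f (e (t, q))) cofinite (𝓝 0) := hf0.comp hinj.tendsto_cofinite
  rw [Int.cofinite_eq] at hg
  have hat : Tendsto (fun N : ℕ => f (e ((N : ℤ), q))) atTop (𝓝 0) :=
    (hg.mono_left le_sup_right).comp tendsto_natCast_atTop_atTop
  have hab : Tendsto (fun N : ℕ => f (e (-(N : ℤ), q))) atTop (𝓝 0) :=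
    (hg.mono_left le_sup_left).comp (tendsto_neg_atTop_atBot.comp tendsto_natCast_atTop_atTop)
  have htel : ∀ N : ℕ, ∑ t ∈ Finset.Ico (-(N : ℤ)) N, s (e (t, q)) =
      f (e ((N : ℤ), q)) - f (e (-(N : ℤ), q)) := by
    intro N
    simp only [he', hstep]
    have := Finset.sum_Ico_int_sub N (fun t => f (e (t, q)))
    rw [← neg_inj, ← Finset.sum_neg_distrib, neg_sub, ← this]
    simp only [neg_sub]
  have hlim := hat.sub hab
  rw [sub_zero] at hlim
  have hset : Tendsto (fun N : ℕ => Finset.Ico (-(N : ℤ)) N) atTop atTop :=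
    Finset.tendsto_Ico_neg
  have h3 := hline.hasSum.comp hset
  refine tendsto_nhds_unique h3 ?_
  refine hlim.congr fun N => ?_
  exact (htel N).symm

variable [NormedSpace ℝ E]

/-- Adding the terms at `m` and `-m` removes `B`, and the reflected differences telescope again,
with `-h (-m + Pi.single i 1)`. -/
lemma tsum_eq_zero_of_increments {i : Fin k} {s h B : (Fin k → ℤ) → E} (hs : Summable s)
    (hh : Tendsto h cofinite (𝓝 0)) (hB : ∀ m, B (-m) = -B m)
    (he : ∀ m, s m = (h (m + Pi.single i 1) - h m) + B m) :
    ∑' m, s m = 0 := by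
  have hneg : Summable fun m => s (-m) := (Equiv.neg _).summable_iff.2 hs
  have h1 : ∑' m, (s m + s (-m)) = 0 := by
    refine tsum_eq_zero_of_telescope (i := i) (h := h) (h' := fun m => -h (-m + Pi.single i 1))
      (hs.add hneg) hh ?_ fun m => ?_
    · have h2 : Tendsto (fun m : Fin k → ℤ => h (-m + Pi.single i 1)) cofinite (𝓝 0) :=
        hh.comp ((add_left_injective _).comp neg_injective).tendsto_cofinite
      simpa using h2.neg
    · rw [he m, he (-m), hB m, neg_add, neg_add_cancel_right]
      abel
  have h2 : ∑' m, s (-m) = ∑' m, s m := (Equiv.neg _).tsum_eq s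
  rw [hs.tsum_add hneg, h2, ← two_smul ℝ] at h1
  exact (smul_eq_zero.1 h1).resolve_left two_ne_zero

end Increments

-- Translations of lattice sums with subtracted polynomials.

section Quasi

variable {n k j : ℕ} {Λ : DiffOp n j} {ω : Fin k → V n} {l M : ℕ} {T : Kernel Λ} (P : SubPoly T M)
  (hω : LinearIndependent ℝ ω) (hM : k < M)
include hω

lemma Kernel.tendsto_lattice (T : Kernel Λ) (x : V n) :
    Tendsto (fun m => sgn l m • T.K (x + latPt ω m)) cofinite (𝓝 0) := by
  have hC := T.C_nonneg
  have h0 : Tendsto (fun m => ‖latPt ω m‖) cofinite atTop := by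
    rw [Filter.tendsto_atTop]
    intro b
    have := finite_norm_latPt_lt hω b
    simpa [Filter.eventually_cofinite] using this
  have h1 : Tendsto (fun m => ‖x + latPt ω m‖) cofinite atTop := by
    refine tendsto_atTop_mono (fun m => ?_) (tendsto_atTop_add_const_right _ (-‖x‖) h0)
    have := norm_sub_le (x + latPt ω m) x
    rw [add_sub_cancel_left] at this
    linarith
  have h2 : Tendsto (fun m => T.C * (‖x + latPt ω m‖ ^ T.N)⁻¹) cofinite (𝓝 (T.C * 0)) :=
    ((tendsto_inv_atTop_zero.comp ((tendsto_pow_atTop (by have := T.one_le; omega)).comp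
      h1))).const_mul _
  rw [mul_zero] at h2
  refine squeeze_zero_norm' ?_ h2
  filter_upwards [h1.eventually_gt_atTop 0] with m hm
  rw [norm_smul, Real.norm_eq_abs, abs_sgn, one_mul]
  simpa using T.norm_iteratedFDeriv_le (norm_pos_iff.1 hm) 0

variable (ω l) in
/-- The increments of the polynomials subtracted from the terms. -/
noncomputable def SubPoly.incr (i : Fin k) (m : Fin k → ℤ) (x : V n) : Cl n :=
  sgn l m • (sgn l (Pi.single i 1 : Fin k → ℤ) • P.p (latPt ω m) x - P.p (latPt ω m) (x + ω i))

include hM in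
-- Translation by `ω i` moves the kernels by one lattice place, so they telescope and only the
-- increments of the subtracted polynomials remain. Combinations over several base points are
-- allowed because on the torus with trivial bundle the increments cancel only in suitable
-- combinations.
lemma SubPoly.sum_increments_eq_zero (i : Fin k) {r : ℕ} (x : Fin r → V n) (a : Fin r → ℝ)
    (hodd : ∀ m, ∑ b, a b • P.incr ω l i (-m) (x b) = -∑ b, a b • P.incr ω l i m (x b)) :
    ∑ b, a b • (P.sum ω l (x b + ω i) - sgn l (Pi.single i 1 : Fin k → ℤ) • P.sum ω l (x b)) =
      0 := by
  set σ := sgn l (Pi.single i 1 : Fin k → ℤ) with hσ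
  have hs : ∀ b, HasSum (fun m => a b • (P.term ω l m (x b + ω i) - σ • P.term ω l m (x b)))
      (a b • (P.sum ω l (x b + ω i) - σ • P.sum ω l (x b))) := fun b =>
    (((P.summable hω hM _).hasSum).sub ((P.summable hω hM _).hasSum.const_smul σ)).const_smul _
  have hS := hasSum_sum fun b (_ : b ∈ Finset.univ) => hs b
  rw [← hS.tsum_eq]
  refine tsum_eq_zero_of_increments (i := i)
    (B := fun m => ∑ b, a b • P.incr ω l i m (x b)) (h := fun m => ∑ b, a b • σ • sgn l m • T.K (x b + latPt ω m)) hS.summable ?_ hodd fun m => ?_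
  · have : Tendsto (fun m => ∑ b, a b • σ • sgn l m • T.K (x b + latPt ω m)) cofinite
        (𝓝 (∑ b : Fin r, a b • σ • (0 : Cl n))) :=
      tendsto_finsetSum _ fun b _ => ((T.tendsto_lattice hω (x b)).const_smul σ).const_smul (a b)
    simpa using this
  · rw [← Finset.sum_sub_distrib, ← Finset.sum_add_distrib]
    refine Finset.sum_congr rfl fun b _ => ?_
    rw [← smul_sub, ← smul_add]
    congr 1
    have h1 : σ * σ = 1 := sgn_mul_self _
    have h2 : x b + latPt ω (m + Pi.single i 1) = x b + ω i + latPt ω m := by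
      rw [latPt_add, latPt_single]; abel
    have h3 : σ * (sgn l m * σ) = sgn l m := by rw [mul_comm, mul_assoc, h1, mul_one]
    rw [sgn_add, h2, ← hσ, SubPoly.term, SubPoly.term, SubPoly.incr, ← hσ]
    simp only [smul_sub, smul_smul, h3]
    rw [mul_comm σ]
    abel

end Quasi

end CliffordCylinder

open scoped Topology
namespace CliffordCylinder
open Metric Filter

/-! ### Subtracted Taylor polynomials -/

section SubTaylor

variable {n j : ℕ} {Λ : DiffOp n j} (T : Kernel Λ)

/-- Far away the rate is proportional to `‖z‖⁻¹`, so every further factor of the rate is one more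
order of decay. The margin `16` permits four doublings, as needed for fourth differences. -/
lemma Kernel.exists_derivBound_far {r : ℝ} (hr : 0 < r) : ∃ ρ > 0, ∀ z, ρ ≤ ‖z‖ →
    Tame Λ (ball 0 r) (fun x => T.K (x + z)) (T.C * 2 ^ T.N * ‖z‖⁻¹ ^ T.N) (2 * T.A * ‖z‖⁻¹) ∧
      16 * (2 * T.A * ‖z‖⁻¹) ≤ 1 := by
  have hA := T.one_le_A
  refine ⟨max (2 * r) (32 * T.A), by positivity, fun z hz => ?_⟩
  have h1 : 2 * r ≤ ‖z‖ := (le_max_left _ _).trans hz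
  have h2 : 32 * T.A ≤ ‖z‖ := (le_max_right _ _).trans hz
  have hz0 : 0 < ‖z‖ := by linarith
  constructor
  · have := T.tame_shift (U := ball 0 r) (δ := ‖z‖ / 2) (by positivity) (v := z) (fun x hx => by
      rw [mem_ball_zero_iff] at hx
      have := norm_sub_le (x + z) x
      rw [add_sub_cancel_left] at this
      linarith)
    convert this using 1
    · rw [div_pow, inv_div, inv_pow]; ring
    · rw [inv_div]; ring
  · rw [← div_eq_mul_inv, ← mul_div_assoc, div_le_one hz0]
    linarith

/-- Smoothness of order `⊤` is analyticity, which provides the bounds; the polynomials subtracted in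
the lattice sums are treated in this way. -/
lemma tameAt_of_contDiffAt {f : V n → Cl n} {x : V n} (hf : ContDiff ℝ ⊤ f)
    (h0 : ∀ y, Λ.app f y = 0) : TameAt Λ f x := by
  obtain ⟨δ, hδ, s, A, hA, h, -⟩ :=
    exists_derivBound_of_analyticAt (x := x) (hf.contDiffAt (x := x)).analyticAt
  exact ⟨δ, hδ, s, A, hA, h, fun y _ => h0 y⟩

/-- No subtraction. -/
noncomputable def Kernel.subZero : SubPoly T T.N where
  p := 0
  zero := rfl
  tame _ x := tameAt_zero x
  bound r hr := by
    obtain ⟨ρ, hρ, h⟩ := T.exists_derivBound_far hr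
    refine ⟨T.C * 2 ^ T.N, ρ, fun z hz => ?_⟩
    have hz0 : 0 < ‖z‖ := hρ.trans_le hz
    have hA := T.one_le_A
    have hp : 0 ≤ 2 * T.A * ‖z‖⁻¹ := by positivity
    simpa using (h z hz).1.bound.mono subset_rfl le_rfl (by positivity) (by linarith [(h z hz).2])

lemma taylor2_eq {K : V n → Cl n} {z : V n} (hK : ContDiffAt ℝ 2 K z) (x : V n) :
    taylor2 K z x = K z + fderiv ℝ K z x + (1 / 2 : ℝ) • fderiv ℝ (fderiv ℝ K) z x x := by
  have : HasFDerivAt (fderiv ℝ K) (fderiv ℝ (fderiv ℝ K) z) z :=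
    ((hK.fderiv_right (m := 1) (by norm_num)).differentiableAt (by norm_num)).hasFDerivAt
  rw [taylor2, (this.clm_apply (hasFDerivAt_const x z)).fderiv]
  simp

lemma Kernel.contDiffAt_two {z : V n} (hz : z ≠ 0) : ContDiffAt ℝ 2 T.K z :=
  (T.contDiffAt hz).of_le two_le_infty

lemma fderiv_fderiv_comp_add (K : V n → Cl n) (z : V n) :
    fderiv ℝ (fun x => K (x + z)) 0 = fderiv ℝ K z ∧
      fderiv ℝ (fderiv ℝ fun x => K (x + z)) 0 = fderiv ℝ (fderiv ℝ K) z := by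
  have h : ∀ x, fderiv ℝ (fun x => K (x + z)) x = fderiv ℝ K (x + z) := fun x =>
    fderiv_comp_add_right z
  refine ⟨by rw [h, zero_add], ?_⟩
  rw [funext h, fderiv_comp_add_right, zero_add]

lemma contDiff_bilin (B : V n →L[ℝ] V n →L[ℝ] Cl n) (m : WithTop ℕ∞) :
    ContDiff ℝ m fun x => B x x := B.contDiff.clm_apply contDiff_id

lemma hasFDerivAt_quadratic (c : Cl n) (L : V n →L[ℝ] Cl n) (B : V n →L[ℝ] V n →L[ℝ] Cl n)
    (hB : ∀ x y, B x y = B y x) (x : V n) :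
    HasFDerivAt (fun x => c + L x + (1 / 2 : ℝ) • B x x) (L + B x) x := by
  have hq : HasFDerivAt (fun x => B x x) (B x + B.flip x) x := by
    have := (B.hasFDerivAt (x := x)).clm_apply (hasFDerivAt_id x)
    simpa using! this
  have h := (L.hasFDerivAt (x := x) |>.const_add c).add (hq.const_smul (1 / 2 : ℝ))
  have h1 : B.flip x = B x := by ext y; exact hB y x
  have h2 : (1 / 2 : ℝ) • (B x + B.flip x) = B x := by
    rw [h1, ← two_smul ℝ (B x), smul_smul]
    norm_num
  rw [h2] at h
  exact h

lemma Kernel.symm_fderiv_fderiv {z : V n} (hz : z ≠ 0) (x y : V n) :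
    fderiv ℝ (fderiv ℝ T.K) z x y = fderiv ℝ (fderiv ℝ T.K) z y x := by
  have hs : IsSymmSndFDerivAt ℝ T.K z :=
    (T.contDiffAt_two hz).isSymmSndFDerivAt (by simp)
  exact hs.eq _ _

end SubTaylor

section First

variable {n : ℕ} {Λ : DiffOp n 1} (T : Kernel Λ)

/-- Subtraction of the values at the centre, for first order operators. -/
noncomputable def Kernel.subConst : SubPoly T (T.N + 1) where
  p z _ := if z = 0 then 0 else T.K z
  zero := by simp; rfl
  tame z x := tameAt_of_contDiffAt contDiff_const fun y => by
    rw [DiffOp.app, iteratedFDeriv_const_of_ne one_ne_zero]; simp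
  bound r hr := by
    obtain ⟨ρ, hρ, h⟩ := T.exists_derivBound_far hr
    refine ⟨T.C * 2 ^ T.N * (2 * T.A) * (r + 1), ρ, fun z hz => ?_⟩
    have hz0 : 0 < ‖z‖ := hρ.trans_le hz
    have hA := T.one_le_A
    have hp : 0 ≤ 2 * T.A * ‖z‖⁻¹ := by positivity
    have := (h z hz).1.bound.sub_zero_apply hr hp (by linarith [(h z hz).2])
    simp only [zero_add] at this
    simp only [norm_pos_iff.1 hz0, if_false]
    convert this using 1
    ring

/-- The differential of the second Taylor polynomial at `z` is the first Taylor polynomial of the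
differential of `K`. Applying the operator gives the first Taylor polynomial of `Λ K`, which
vanishes near `z`. -/
lemma Kernel.app_taylor2_first {z : V n} (hz : z ≠ 0) (x : V n) : Λ.app (taylor2 T.K z) x = 0 := by
  have hd := hasFDerivAt_quadratic (T.K z) (fderiv ℝ T.K z) (fderiv ℝ (fderiv ℝ T.K) z)
    (T.symm_fderiv_fderiv hz)
  have h1 : iteratedFDeriv ℝ 1 (taylor2 T.K z) x =
      iteratedFDeriv ℝ 1 T.K z + fderiv ℝ (iteratedFDeriv ℝ 1 T.K) z x := by
    ext m
    have h2 : iteratedFDeriv ℝ 2 T.K z ![x, m 0] = fderiv ℝ (iteratedFDeriv ℝ 1 T.K) z x m := by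
      rw [iteratedFDeriv_succ_apply_left]
      congr 1
      ext i
      fin_cases i; rfl
    rw [_root_.add_apply, ← h2, iteratedFDeriv_two_apply, iteratedFDeriv_one_apply,
      iteratedFDeriv_one_apply, funext (taylor2_eq (T.contDiffAt_two hz)), (hd x).fderiv]
    rfl
  have h3 : HasFDerivAt (fun y => Λ.op (iteratedFDeriv ℝ 1 T.K y))
      (Λ.op.comp (fderiv ℝ (iteratedFDeriv ℝ 1 T.K) z)) z :=
    Λ.op.hasFDerivAt.comp z (((T.contDiffAt hz).differentiableAt_iteratedFDeriv
      (by exact_mod_cast WithTop.coe_lt_top 1)).hasFDerivAt)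
  have h4 : (fun y => Λ.op (iteratedFDeriv ℝ 1 T.K y)) =ᶠ[𝓝 z] fun _ => 0 := by
    filter_upwards [isOpen_compl_singleton.mem_nhds hz] with y hy using T.null y hy
  have h5 := (h4.hasFDerivAt_iff.1 h3).unique (hasFDerivAt_const 0 z)
  have h6 := congrArg (fun L => L x) h5
  rw [DiffOp.app, h1, map_add, T.null z hz, zero_add]
  exact h6

end First

section Second

variable {n : ℕ} {Λ : DiffOp n 2} (T : Kernel Λ)

/-- Subtraction of the first Taylor polynomial, for second order operators. -/
noncomputable def Kernel.subLinear : SubPoly T (T.N + 2) where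
  p z x := if z = 0 then 0 else T.K z + fderiv ℝ T.K z x
  zero := by funext x; simp
  tame z x := by
    by_cases hz : z = 0
    · simpa [hz] using tameAt_zero x
    · simp only [hz, if_false]
      refine tameAt_of_contDiffAt (contDiff_const.add (ContinuousLinearMap.contDiff _)) fun y => ?_
      have h1 : iteratedFDeriv ℝ 2 (fun x => T.K z + fderiv ℝ T.K z x) y = 0 := by
        ext m
        have h2 : fderiv ℝ (fun x => T.K z + fderiv ℝ T.K z x) = fun _ => fderiv ℝ T.K z := by
          funext x
          exact ((fderiv ℝ T.K z).hasFDerivAt.const_add _).fderiv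
        rw [iteratedFDeriv_two_apply, h2]
        simp
      rw [DiffOp.app, h1, map_zero]
  bound r hr := by
    obtain ⟨ρ, hρ, h⟩ := T.exists_derivBound_far hr
    refine ⟨T.C * 2 ^ T.N * (2 * T.A) * (2 * (2 * T.A)) * (r + 1) * (r + 1), ρ, fun z hz => ?_⟩
    have hz0 : 0 < ‖z‖ := hρ.trans_le hz
    have hA := T.one_le_A
    have hp : 0 ≤ 2 * T.A * ‖z‖⁻¹ := by positivity
    have := (h z hz).1.bound.sub_taylor_one hr hp (by linarith [(h z hz).2])
    simp only [zero_add, (fderiv_fderiv_comp_add T.K z).1] at this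
    simp only [norm_pos_iff.1 hz0, if_false]
    convert this using 1
    ring

/-- The second derivative of the polynomial is constant, with the value of that of `K` at `z`. -/
lemma Kernel.app_taylor2_second {z : V n} (hz : z ≠ 0) (x : V n) :
    Λ.app (taylor2 T.K z) x = 0 := by
  have hd := hasFDerivAt_quadratic (T.K z) (fderiv ℝ T.K z) (fderiv ℝ (fderiv ℝ T.K) z)
    (T.symm_fderiv_fderiv hz)
  have h1 : iteratedFDeriv ℝ 2 (taylor2 T.K z) x = iteratedFDeriv ℝ 2 T.K z := by
    ext m
    rw [iteratedFDeriv_two_apply, iteratedFDeriv_two_apply,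
      funext (taylor2_eq (T.contDiffAt_two hz)), funext fun y => (hd y).fderiv,
      ((ContinuousLinearMap.hasFDerivAt _).const_add _).fderiv]
  rw [DiffOp.app, h1, T.null z hz]

end Second

section Third

variable {n j : ℕ} {Λ : DiffOp n j} (T : Kernel Λ)

/-- Subtraction of the second Taylor polynomial. -/
noncomputable def Kernel.subQuadratic (hT : ∀ z ≠ 0, ∀ x, Λ.app (taylor2 T.K z) x = 0) :
    SubPoly T (T.N + 3) where
  p z x := if z = 0 then 0 else taylor2 T.K z x
  zero := by funext x; simp
  tame z x := by
    by_cases hz : z = 0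
    · simpa [hz] using tameAt_zero x
    · simp only [hz, if_false]
      refine tameAt_of_contDiffAt ?_ (hT z hz)
      rw [funext (taylor2_eq (T.contDiffAt_two hz))]
      exact (contDiff_const.add (ContinuousLinearMap.contDiff _)).add
        ((contDiff_bilin _ _).const_smul _)
  bound r hr := by
    obtain ⟨ρ, hρ, h⟩ := T.exists_derivBound_far hr
    refine ⟨T.C * 2 ^ T.N * (2 * T.A) * (2 * (2 * T.A)) * (2 * (2 * (2 * T.A))) * (r + 1) * (r + 1)
      * (r + 1), ρ, fun z hz => ?_⟩
    have hz0 : 0 < ‖z‖ := hρ.trans_le hz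
    have hA := T.one_le_A
    have hp : 0 ≤ 2 * T.A * ‖z‖⁻¹ := by positivity
    have := (h z hz).1.bound.sub_taylor_two hr hp (by linarith [(h z hz).2])
    simp only [zero_add, (fderiv_fderiv_comp_add T.K z).1, (fderiv_fderiv_comp_add T.K z).2] at this
    simp only [norm_pos_iff.1 hz0, if_false, taylor2_eq (T.contDiffAt_two (norm_pos_iff.1 hz0))]
    convert this using 1
    ring

end Third

end CliffordCylinder

open scoped Topology
namespace CliffordCylinder
open Metric Filter

/-! ### Generalized cotangents -/

section Cot

variable {n k j : ℕ} {Λ : DiffOp n j} (T : Kernel Λ) (ω : Fin k → V n) (l : ℕ)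

/-- Quasi-periodic null solutions with the singularity of the kernel at the lattice points. -/
structure CotLike (w : V n → Cl n) : Prop where
  tameAt : ∀ x ∉ lattice ω, TameAt Λ w x
  eq_add : ∃ r, TameAt Λ r 0 ∧ ∀ x, w x = T.K x + r x
  quasi : ∀ x ∉ lattice ω, ∀ m, w (x + latPt ω m) = sgn l m • w x

variable {T ω l}

lemma add_mem_lattice_iff {x y : V n} (hy : y ∈ lattice ω) : x + y ∈ lattice ω ↔ x ∈ lattice ω :=
  AddSubgroup.add_mem_cancel_right _ hy

lemma add_latPt_mem_iff {x : V n} (m : Fin k → ℤ) : x + latPt ω m ∈ lattice ω ↔ x ∈ lattice ω :=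
  add_mem_lattice_iff (latPt_mem_lattice ω m)

/-- Quasi-periodicity follows from that for the generators of the lattice. -/
lemma quasi_of_generators {w : V n → Cl n} {S : Set (V n)}
    (hS : ∀ x ∈ S, ∀ m, x + latPt ω m ∈ S)
    (h : ∀ i, ∀ x ∈ S, w (x + ω i) = sgn l (Pi.single i 1 : Fin k → ℤ) • w x) :
    ∀ m, ∀ x ∈ S, w (x + latPt ω m) = sgn l m • w x := by
  classical
  set H : AddSubgroup (Fin k → ℤ) :=
    { carrier := {m | ∀ x ∈ S, w (x + latPt ω m) = sgn l m • w x}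
      zero_mem' := fun x _ => by simp
      add_mem' := fun {a b} ha hb x hx => by
        rw [latPt_add, ← add_assoc, hb _ (hS x hx a), ha x hx, smul_smul, sgn_add, mul_comm]
      neg_mem' := fun {a} ha x hx => by
        have h1 := ha (x + latPt ω (-a)) (hS x hx _)
        rw [add_assoc, ← latPt_add, neg_add_cancel, latPt_zero, add_zero] at h1
        rw [h1, sgn_neg, smul_smul, sgn_mul_self, one_smul] } with hH
  intro m
  have hm : m = ∑ i, m i • (Pi.single i 1 : Fin k → ℤ) := by
    funext a
    simp [Finset.sum_apply, Pi.single_apply]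
  have : m ∈ H := by
    rw [hm]
    refine AddSubgroup.sum_mem _ fun i _ => AddSubgroup.zsmul_mem _ ?_ _
    intro x hx
    rw [latPt_single]
    exact h i x hx
  exact this

variable {M : ℕ} (P : SubPoly T M) (hω : LinearIndependent ℝ ω) (hM : k < M)
include hω hM

lemma SubPoly.cotLike (hodd : ∀ i m x, P.incr ω l i (-m) x = -P.incr ω l i m x) :
    CotLike T ω l (P.sum ω l) := by
  refine ⟨fun x hx => P.tameAt_sum hω hM hx, P.exists_eq_add hω hM, fun x hx m => ?_⟩
  refine quasi_of_generators (S := {x | x ∉ lattice ω}) (fun x hx m => ?_) (fun i x hx => ?_) m x hx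
  · simpa [add_latPt_mem_iff] using hx
  · have := P.sum_increments_eq_zero (l := l) hω hM i (r := 1) (fun _ => x) (fun _ => 1)
      (by simpa using fun m => hodd i m x)
    simpa [sub_eq_zero] using this

omit hω hM in
lemma directSum_eq : directSum T.K ω l = T.subZero.sum ω l := by
  funext x
  simp [directSum, SubPoly.sum, SubPoly.term, Kernel.subZero]

omit hM in
lemma cotLike_directSum (hN : k < T.N) : CotLike T ω l (directSum T.K ω l) := by
  rw [directSum_eq]
  exact T.subZero.cotLike hω hN fun i m x => by simp [SubPoly.incr, Kernel.subZero]

/-- Coupling antipodal lattice points. -/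
lemma coupledSum_eq (hp : ∀ z ≠ 0, ∀ x, P.p z x + P.p (-z) x = T.K z + T.K (-z)) :
    coupledSum T.K ω l = P.sum ω l := by
  funext x
  have hs : HasSum (fun m => P.term ω l m x) (P.sum ω l x) := (P.summable hω hM x).hasSum
  have hneg : HasSum (fun m => P.term ω l (-m) x) (P.sum ω l x) :=
    (Equiv.neg (Fin k → ℤ)).hasSum_iff (f := fun m => P.term ω l m x) |>.2 hs
  -- The series is averaged with its reflection `m ↦ -m`; by `hp` only the constants of the
  -- subtracted polynomials survive.
  have h1 : P.sum ω l x = ∑' m, (1 / 2 : ℝ) • (P.term ω l m x + P.term ω l (-m) x) := by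
    rw [((hs.add hneg).const_smul (1 / 2 : ℝ)).tsum_eq, ← two_smul ℝ, smul_smul]
    norm_num
  rw [h1, coupledSum]
  refine tsum_congr fun m => ?_
  split_ifs with hm
  · subst hm
    simp only [SubPoly.term, neg_zero, sgn_zero, latPt_zero, P.zero, one_smul, add_zero]
    rw [← two_smul ℝ, smul_smul]
    simp
  · simp only [SubPoly.term, sgn_neg, latPt_neg]
    rw [← smul_add, smul_smul, ← sub_eq_add_neg x]
    congr 1
    have := hp _ (latPt_ne_zero hω hm) x
    rw [sub_sub, ← this]
    abel

end Cot

section Parity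

variable {n : ℕ} {E : Type*} [NormedAddCommGroup E] [NormedSpace ℝ E]

lemma fderiv_parity {f : V n → E} {s : ℝ} (h : ∀ z, f (-z) = s • f z) (z : V n) :
    fderiv ℝ f (-z) = (-s) • fderiv ℝ f z := by
  have h1 : (fun z => f (-z)) = s • f := funext h
  have h2 : fderiv ℝ (fun z => f (-z)) z = -fderiv ℝ f (-z) := by
    have := (ContinuousLinearEquiv.neg ℝ (M := V n)).comp_right_fderiv (f := f) (x := z)
    ext v
    simpa using! congrArg (fun L => L v) this
  rw [h1] at h2
  have h3 : fderiv ℝ (s • f) z = s • fderiv ℝ f z := by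
    rw [fderiv_const_smul_field]; rfl
  rw [h3] at h2
  rw [neg_smul, h2, neg_neg]

end Parity

section Coupled

variable {n k : ℕ} {ω : Fin k → V n} {l : ℕ} (hω : LinearIndependent ℝ ω)
include hω

/-- The increments are multiples of the subtracted constants `K ω`, which are odd in `ω`. The terms
decay with order `N + 1 = n > k`. -/
lemma cotLike_coupledSum_first {Λ : DiffOp n 1} (T : Kernel Λ) (hodd : ∀ z, T.K (-z) = -T.K z)
    (hk : k < n) : CotLike T ω l (coupledSum T.K ω l) := by
  have hM : k < T.N + 1 := by rw [T.add_eq]; exact hk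
  rw [coupledSum_eq T.subConst hω hM fun z hz x => by simp [Kernel.subConst, hz]]
  refine T.subConst.cotLike hω hM fun i m x => ?_
  simp only [SubPoly.incr, Kernel.subConst, latPt_neg, sgn_neg, neg_eq_zero]
  by_cases h : latPt ω m = 0
  · simp [h]
  · simp only [h, if_false, hodd]
    module

/-- The constants `K ω` are even, but they drop out of the increments since all signs are `1`; what
remains is the derivative of an even function, which is odd in `ω`. -/
lemma cotLike_coupledSum_second {Λ : DiffOp n 2} (T : Kernel Λ) (heven : ∀ z, T.K (-z) = T.K z)
    (hk : k < n) : CotLike T ω 0 (coupledSum T.K ω 0) := by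
  have hM : k < T.N + 2 := by rw [T.add_eq]; exact hk
  have hd : ∀ z, fderiv ℝ T.K (-z) = -fderiv ℝ T.K z := fun z => by
    rw [fderiv_parity (s := 1) (by simpa using heven), neg_one_smul]
  rw [coupledSum_eq T.subLinear hω hM fun z hz x => by simp [Kernel.subLinear, hz, hd]; abel]
  refine T.subLinear.cotLike hω hM fun i m x => ?_
  simp only [SubPoly.incr, Kernel.subLinear, latPt_neg, sgn_zero_left, neg_eq_zero]
  by_cases h : latPt ω m = 0
  · simp [h]
  · simp only [h, if_false, heven, hd, map_add, one_smul, _root_.neg_apply]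
    abel

end Coupled

/-! ### Regrouped sums -/

section Regroup

variable {k : ℕ} {E : Type*} [NormedAddCommGroup E] [NormedSpace ℝ E]

/-- The three weights add up to one. -/
lemma tsum_regroup {u : (Fin k → ℤ) → E} (hu : Summable u) :
    Summable (regroup u) ∧ ∑' m, regroup u m = ∑' m, u m := by
  have h1 : HasSum (fun m => u (m - firstIdx)) (∑' m, u m) :=
    (Equiv.subRight firstIdx).hasSum_iff.2 hu.hasSum
  have h2 : HasSum (fun m => u (m + firstIdx)) (∑' m, u m) :=
    (Equiv.addRight firstIdx).hasSum_iff.2 hu.hasSum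
  have h3 := ((h1.const_smul (1 / 4 : ℝ)).add (hu.hasSum.const_smul (1 / 2 : ℝ))).add
    (h2.const_smul (1 / 4 : ℝ))
  refine ⟨h3.summable, h3.tsum_eq.trans ?_⟩
  rw [← add_smul, ← add_smul]
  norm_num

lemma regroup_add (u v : (Fin k → ℤ) → E) : regroup (u + v) = regroup u + regroup v := by
  funext m
  simp only [regroup, Pi.add_apply, smul_add]
  abel

/-- The nesting is the one produced by four applications of `Tame.difference`. -/
lemma fourth_difference (a b c d e : E) : a - (4 : ℝ) • b + (6 : ℝ) • c - (4 : ℝ) • d + e =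
    e - d - (d - c) - (d - c - (c - b)) - (d - c - (c - b) - (c - b - (b - a))) := by
  module

lemma regroup_shift (c : ℝ) (a : Fin k → ℤ) (u : (Fin k → ℤ) → E) (m : Fin k → ℤ) :
    regroup (fun m' => c • u (m' + a)) m = c • regroup u (m + a) := by
  simp only [regroup, sub_add_eq_add_sub, add_right_comm m _ a]
  module

variable {n j l : ℕ} {ω : Fin k → V n}

lemma firstIdx_eq_single (hk : 0 < k) : (firstIdx : Fin k → ℤ) = Pi.single ⟨0, hk⟩ 1 := by
  funext i
  simp [firstIdx, Pi.single_apply, Fin.ext_iff]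

lemma sgn_firstIdx (hl : 0 < l) (hlk : l ≤ k) : sgn l (firstIdx : Fin k → ℤ) = -1 := by
  have : ∑ i ∈ Finset.univ.filter (fun i : Fin k => (i : ℕ) < l), (firstIdx : Fin k → ℤ) i = 1 := by
    rw [firstIdx_eq_single (hl.trans_le hlk), Finset.sum_pi_single']
    simp [hl]
  rw [sgn, this]; norm_num

variable (hl : 0 < l) (hlk : l ≤ k)
include hl hlk

/-- Neighbouring terms in the direction of `ω_1` have opposite signs, so one regrouping is `-1/4`
times a second difference, and two make `1/16` times a fourth difference. -/
lemma regroup_regroup_sgn (f : V n → E) (x : V n) (m : Fin k → ℤ) :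
    regroup (regroup fun m' => sgn l m' • f (x + latPt ω m')) m = ((1 / 16 : ℝ) * sgn l m) •
      (f (x + latPt ω m - (2 : ℝ) • latPt ω firstIdx) - (4 : ℝ) • f (x + latPt ω m - latPt ω firstIdx)
        + (6 : ℝ) • f (x + latPt ω m) - (4 : ℝ) • f (x + latPt ω m + latPt ω firstIdx)
        + f (x + latPt ω m + (2 : ℝ) • latPt ω firstIdx)) := by
  have h1 := sgn_firstIdx hl hlk
  have hs : ∀ m : Fin k → ℤ, sgn l (m - firstIdx) = -sgn l m := fun m => by
    rw [sub_eq_add_neg, sgn_add, sgn_neg, h1, mul_neg_one]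
  have ha : ∀ m : Fin k → ℤ, sgn l (m + firstIdx) = -sgn l m := fun m => by
    rw [sgn_add, h1, mul_neg_one]
  have hps : ∀ m : Fin k → ℤ, latPt ω (m - firstIdx) = latPt ω m - latPt ω firstIdx := fun m => by
    rw [sub_eq_add_neg, latPt_add, latPt_neg, ← sub_eq_add_neg]
  simp only [regroup, sub_add_cancel, add_sub_cancel_right, hs, ha, hps, latPt_add]
  have e1 : x + (latPt ω m - latPt ω firstIdx - latPt ω firstIdx) =
      x + latPt ω m - (2 : ℝ) • latPt ω firstIdx := by rw [two_smul]; abel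
  have e2 : x + (latPt ω m + latPt ω firstIdx + latPt ω firstIdx) =
      x + latPt ω m + (2 : ℝ) • latPt ω firstIdx := by rw [two_smul]; abel
  have e3 : x + (latPt ω m - latPt ω firstIdx) = x + latPt ω m - latPt ω firstIdx := by abel
  have e4 : x + (latPt ω m + latPt ω firstIdx) = x + latPt ω m + latPt ω firstIdx := by abel
  rw [e1, e2, e3, e4]
  module

end Regroup

section Regrouped

variable {n k j l : ℕ} {Λ : DiffOp n j} {ω : Fin k → V n} (T : Kernel Λ)
  (hω : LinearIndependent ℝ ω) (hl : 0 < l) (hlk : l ≤ k)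
include hl hlk

lemma Kernel.tameTail_regroup : TameTail Λ ω (T.N + 4)
    (fun m x => regroup (regroup fun m' => sgn l m' • T.K (x + latPt ω m')) m) := by
  intro r hr
  set v := latPt ω (firstIdx : Fin k → ℤ) with hv
  -- The differences start at `x - 2v`, which costs the last summand of the radius; each of the four
  -- applications of `Tame.difference` costs `‖v‖`.
  obtain ⟨ρ, hρ, h⟩ := T.exists_derivBound_far (r := r + ‖v‖ + ‖v‖ + ‖v‖ + ‖v‖ + ‖(2 : ℝ) • v‖)
    (by positivity)
  refine ⟨T.C * 2 ^ T.N * (2 * T.A) * ‖v‖ * (2 * (2 * T.A)) * ‖v‖ * (2 * (2 * (2 * T.A))) * ‖v‖ *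
    (2 * (2 * (2 * (2 * T.A)))) * ‖v‖ * (1 / 16), 1, ρ, le_rfl, fun m hm => ?_⟩
  obtain ⟨h1, h2⟩ := h _ hm
  have hA := T.one_le_A
  have hp : 0 ≤ 2 * T.A * ‖latPt ω m‖⁻¹ := by positivity
  have h3 := (h1.comp_add_right (-((2 : ℝ) • v))).mono (U' := ball 0 (r + ‖v‖ + ‖v‖ + ‖v‖ + ‖v‖))
    (fun x hx => by
      rw [mem_ball_zero_iff] at hx
      rw [Set.mem_preimage, mem_ball_zero_iff, ← sub_eq_add_neg]
      exact (norm_sub_le _ _).trans_lt (by linarith)) le_rfl hp le_rfl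
  have h4 := ((((h3.difference hp).difference (by positivity)).difference
    (by positivity)).difference (by positivity)).const_smul ((1 / 16 : ℝ) * sgn l m)
  rw [abs_mul, abs_sgn, mul_one] at h4
  refine (h4.mono subset_rfl (le_of_eq ?_) (by positivity) ?_).congr isOpen_ball fun x hx => ?_
  · rw [abs_of_pos (by norm_num)]; ring
  · linarith
  · simp only
    rw [regroup_regroup_sgn hl hlk]
    congr 1
    have e1 : x + latPt ω m - (2 : ℝ) • v = x + -((2 : ℝ) • v) + latPt ω m := by abel
    have e2 : x + latPt ω m - v = x + v + -((2 : ℝ) • v) + latPt ω m := by rw [two_smul]; abel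
    have e3 : x + latPt ω m = x + v + v + -((2 : ℝ) • v) + latPt ω m := by rw [two_smul]; abel
    have e4 : x + latPt ω m + v = x + v + v + v + -((2 : ℝ) • v) + latPt ω m := by
      rw [two_smul]; abel
    have e5 : x + latPt ω m + (2 : ℝ) • v = x + v + v + v + v + -((2 : ℝ) • v) + latPt ω m := by
      rw [two_smul]; abel
    rw [e1, e2, e4, e5, e3]
    exact fourth_difference _ _ _ _ _

/-- Four additional orders of decay make the series absolutely convergent. Quasi-periodicity is then
a reindexing, and no telescoping is needed. -/
lemma cotLike_regroupedSum (hk : k < T.N + 4) (hω : LinearIndependent ℝ ω) :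
    CotLike T ω l (regroupedSum T.K ω l) := by
  classical
  have htail := T.tameTail_regroup (ω := ω) hl hlk
  have htame : ∀ {x : V n} {u : (Fin k → ℤ) → V n → Cl n}, (∀ m, TameAt Λ (u m) x) →
      ∀ m, TameAt Λ (fun y => regroup (fun m' => u m' y) m) x := fun hu m =>
    (((hu _).const_smul _).add ((hu _).const_smul _)).add ((hu _).const_smul _)
  refine ⟨fun x hx => ?_, ?_, fun x _ m => ?_⟩
  · refine (htail.tameAt_and_summable hω hk fun m => ?_).1
    exact htame (htame fun m' => (T.tameAt_shift (add_latPt_ne_zero hx m')).const_smul _) m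
  -- The term at the origin is separated before regrouping. The regrouping of a sequence with one
  -- nonzero entry still has that entry as its sum, so this part contributes exactly `K x`.
  · set t : (Fin k → ℤ) → V n → Cl n := fun m x => regroup (regroup fun m' =>
      if m' = 0 then 0 else sgn l m' • T.K (x + latPt ω m')) m with ht
    have hsplit : ∀ x, (fun m => regroup (regroup fun m' => sgn l m' • T.K (x + latPt ω m')) m) =
        (fun m => t m x) + regroup (regroup (Pi.single 0 (T.K x))) := by
      intro x
      have : (fun m' => sgn l m' • T.K (x + latPt ω m')) =
          (fun m' => if m' = 0 then 0 else sgn l m' • T.K (x + latPt ω m')) +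
            Pi.single 0 (T.K x) := by
        funext m'
        by_cases hm : m' = 0
        · subst hm; simp
        · simp [hm]
      rw [ht]
      simp only
      rw [this, regroup_add, regroup_add]
    have hK : ∀ x, Summable (regroup (regroup (Pi.single 0 (T.K x) : (Fin k → ℤ) → Cl n))) ∧
        ∑' m, regroup (regroup (Pi.single 0 (T.K x) : (Fin k → ℤ) → Cl n)) m = T.K x := by
      intro x
      have h1 : Summable (Pi.single 0 (T.K x) : (Fin k → ℤ) → Cl n) :=
        (hasSum_pi_single _ _).summable
      have h2 := tsum_regroup h1
      have h3 := tsum_regroup h2.1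
      refine ⟨h3.1, ?_⟩
      rw [h3.2, h2.2, tsum_pi_single]
    refine ⟨fun x => ∑' m, t m x, ?_, fun x => ?_⟩
    · have htail' : TameTail Λ ω (T.N + 4) t := by
        intro r hr
        obtain ⟨C, A, ρ, hA, h⟩ := htail r hr
        -- Two regroupings reach two places to either side, so beyond this distance the removal of
        -- the origin is not felt.
        refine ⟨C, A, max ρ (2 * ‖latPt ω firstIdx‖ + 1), hA, fun m hm => ?_⟩
        have hm2 : 2 * ‖latPt ω firstIdx‖ + 1 ≤ ‖latPt ω m‖ := (le_max_right _ _).trans hm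
        have hne : ∀ m' : Fin k → ℤ, ‖latPt ω m'‖ ≤ 2 * ‖latPt ω firstIdx‖ → m + m' ≠ 0 := by
          intro m' hm' h0
          rw [eq_neg_of_add_eq_zero_left h0, latPt_neg, norm_neg] at hm2
          linarith
        have h0 := norm_nonneg (latPt ω (firstIdx : Fin k → ℤ))
        have hb1 : ‖latPt ω (-firstIdx : Fin k → ℤ)‖ ≤ 2 * ‖latPt ω firstIdx‖ := by
          rw [latPt_neg, norm_neg]; linarith
        have hb2 : ‖latPt ω (firstIdx + firstIdx : Fin k → ℤ)‖ ≤ 2 * ‖latPt ω firstIdx‖ := by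
          rw [latPt_add, two_mul]; exact norm_add_le _ _
        have n0 := hne 0 (by simp)
        have n1 := hne firstIdx (by linarith)
        have n2 := hne (-firstIdx) hb1
        have n3 := hne (firstIdx + firstIdx) hb2
        have n4 := hne (-(firstIdx + firstIdx)) (by rwa [latPt_neg, norm_neg])
        rw [add_zero] at n0
        rw [← sub_eq_add_neg] at n2
        rw [← add_assoc] at n3
        rw [← sub_eq_add_neg, ← sub_sub] at n4
        have : t m = fun x => regroup (regroup fun m' => sgn l m' • T.K (x + latPt ω m')) m := by
          funext x
          simp only [ht, regroup, sub_add_cancel, add_sub_cancel_right, n0, n1, n2, n3, n4, if_false]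
        rw [this]
        exact h m ((le_max_left _ _).trans hm)
      refine (htail'.tameAt_and_summable hω hk fun m => ?_).1
      refine htame (u := fun m'' y => regroup (fun m' =>
        if m' = 0 then 0 else sgn l m' • T.K (y + latPt ω m')) m'') (htame (u := fun m' y =>
        if m' = 0 then 0 else sgn l m' • T.K (y + latPt ω m')) fun m' => ?_) m
      by_cases hm : m' = 0
      · simpa only [hm, if_true] using tameAt_zero 0
      · simp only [hm, if_false]
        refine (T.tameAt_shift ?_).const_smul _
        rw [zero_add]
        exact latPt_ne_zero hω hm
    · have h1 := htail.summable hω hk x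
      rw [hsplit x] at h1
      have h2 : Summable fun m => t m x := by simpa using h1.sub (hK x).1
      change ∑' m, (fun m => regroup (regroup fun m' => sgn l m' • T.K (x + latPt ω m')) m) m = _
      rw [hsplit x, add_comm (T.K x)]
      exact (h2.tsum_add (hK x).1).trans (by rw [(hK x).2])
  · rw [regroupedSum, regroupedSum]
    have : ∀ m', regroup (regroup fun m' => sgn l m' • T.K (x + latPt ω m + latPt ω m')) m' =
        sgn l m • regroup (regroup fun m' => sgn l m' • T.K (x + latPt ω m')) (m' + m) := by
      intro m'
      have h1 : (fun m' => sgn l m' • T.K (x + latPt ω m + latPt ω m')) = fun m' => sgn l m •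
          (sgn l (m' + m) • T.K (x + latPt ω (m' + m))) := by
        funext m'
        rw [smul_smul, sgn_add, mul_left_comm, sgn_mul_self, mul_one, latPt_add,
          add_comm (latPt ω m'), add_assoc]
      rw [h1, funext (regroup_shift (sgn l m) m fun m' => sgn l m' • T.K (x + latPt ω m')),
        regroup_shift]
    simp only [this]
    rw [((((htail.summable hω hk x).hasSum).const_smul (sgn l m)).tsum_eq).symm]
    exact (Equiv.addRight m).tsum_eq fun m' =>
      sgn l m • regroup (regroup fun m' => sgn l m' • T.K (x + latPt ω m')) m'

end Regrouped

end CliffordCylinder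

open scoped Topology
namespace CliffordCylinder
open Metric Filter

/-! ### Families of functions with poles of all orders -/

section Family

variable {n k j : ℕ} {Λ : DiffOp n j} {T : Kernel Λ} {ω : Fin k → V n} {l : ℕ}

lemma multiDeriv_add {f g : V n → Cl n} {x : V n} (hf : TameAt Λ f x) (hg : TameAt Λ g x)
    (m : Fin n → ℕ) :
    multiDeriv m (fun y => f y + g y) x = multiDeriv m f x + multiDeriv m g x := by
  simp only [multiDeriv_eq_iterD]
  suffices h : ∀ L : List (Fin n), ∀ᶠ y in 𝓝 x,
      iterD L (fun y => f y + g y) y = iterD L f y + iterD L g y from (h _).self_of_nhds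
  intro L
  induction L with
  | nil => exact Eventually.of_forall fun y => rfl
  | cons i L ih =>
    filter_upwards [ih.eventually_nhds, hf.eventually, hg.eventually] with y hy hfy hgy
    have h1 := ((contDiffAt_iterD hfy.contDiffAt L).differentiableAt (by simp)).hasFDerivAt.add
      ((contDiffAt_iterD hgy.contDiffAt L).differentiableAt (by simp)).hasFDerivAt
    simp only [iterD_cons, partialDeriv]
    have hy' : (fun y => iterD L (fun y => f y + g y) y) =ᶠ[𝓝 y]
      fun y => iterD L f y + iterD L g y := hy
    rw [hy'.fderiv_eq]
    exact congrArg (fun L => L (stdVec i)) h1.fderiv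

lemma multiDeriv_sgn {w : V n → Cl n} {x v : V n} {c : ℝ}
    (h : ∀ᶠ y in 𝓝 x, w (y + v) = c • w y) (m : Fin n → ℕ) :
    multiDeriv m w (x + v) = c • multiDeriv m w x := by
  have h1 := (multiDeriv_congr h m).eq_of_nhds
  simp only [multiDeriv_eq_iterD, iterD_comp_add_right, iterD_const_smul] at h1 ⊢
  exact h1

/-- Nonzero lattice points have norm bounded below, so the subgroup is discrete. -/
lemma isClosed_lattice (hω : LinearIndependent ℝ ω) : IsClosed (lattice ω : Set (V n)) := by
  have h0 : ∀ᶠ x in 𝓝 (0 : V n), x ∈ lattice ω → x = 0 := by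
    obtain ⟨c, hc, h⟩ := exists_norm_latPt_ge hω
    filter_upwards [ball_mem_nhds 0 hc] with x hx hL
    obtain ⟨m, rfl⟩ := (mem_lattice_iff ω).1 hL
    by_contra hm
    have hm0 : m ≠ 0 := by rintro rfl; exact hm (latPt_zero ω)
    have h1 : 1 ≤ ‖m‖ := by
      obtain ⟨i, hi⟩ := Function.ne_iff.1 hm0
      refine le_trans ?_ (norm_le_pi_norm m i)
      rw [Int.norm_eq_abs]
      exact_mod_cast Int.one_le_abs hi
    rw [mem_ball_zero_iff] at hx
    nlinarith [h m]
  have : DiscreteTopology (lattice ω) := by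
    rw [discreteTopology_iff_isOpen_singleton_zero, isOpen_iff_mem_nhds]
    intro x hx
    rw [Set.mem_singleton_iff] at hx
    subst hx
    have h1 : Tendsto (fun y : lattice ω => (y : V n)) (𝓝 0) (𝓝 0) :=
      continuous_subtype_val.tendsto' _ _ rfl
    filter_upwards [h1.eventually h0] with y hy
    exact Subtype.ext (hy y.2)
  exact AddSubgroup.isClosed_of_discrete

lemma eventually_notMem_lattice (hω : LinearIndependent ℝ ω) {x : V n} (hx : x ∉ lattice ω) :
    ∀ᶠ y in 𝓝 x, y ∉ lattice ω :=
  (isClosed_lattice hω).isOpen_compl.mem_nhds hx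

lemma eventually_notMem_lattice_zero (hω : LinearIndependent ℝ ω) :
    ∃ δ > 0, ∀ x : V n, ‖x‖ < δ → x ≠ 0 → x ∉ lattice ω := by
  obtain ⟨c, hc, h⟩ := exists_norm_latPt_ge hω
  refine ⟨c, hc, fun x hx hx0 hL => ?_⟩
  obtain ⟨m, rfl⟩ := (mem_lattice_iff ω).1 hL
  have hm0 : m ≠ 0 := by rintro rfl; exact hx0 (latPt_zero ω)
  have h1 : 1 ≤ ‖m‖ := by
    obtain ⟨i, hi⟩ := Function.ne_iff.1 hm0
    refine le_trans ?_ (norm_le_pi_norm m i)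
    rw [Int.norm_eq_abs]
    exact_mod_cast Int.one_le_abs hi
  nlinarith [h m]

variable (T ω l) in
/-- Families of quasi-periodic null solutions with poles of all orders at the lattice points, and
possibly additional poles of the first one in the set `S`. -/
structure EpsFamily (S : Set (V n)) (ε : (Fin n → ℕ) → V n → Cl n) : Prop where
  tameAt : ∀ m, ∀ x ∉ lattice ω, (m = 0 → x ∉ S) → TameAt Λ (ε m) x
  quasi : ∀ m, ∀ x ∉ lattice ω, (m = 0 → x ∉ S) → ∀ μ, ε m (x + latPt ω μ) = sgn l μ • ε m x
  add_mem : ∀ x μ, x + latPt ω μ ∈ S ↔ x ∈ S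
  isolated : ∀ᶠ x in 𝓝 0, x ∉ S
  eq_add : ∀ m, ∃ r, TameAt Λ r 0 ∧ ∀ᶠ x in 𝓝[≠] 0, ε m x = multiDeriv m T.K x + r x
  eq_multiDeriv : ∃ w r, (∀ x ∉ lattice ω, TameAt Λ w x) ∧ TameAt Λ r 0 ∧ (∀ x, w x = T.K x + r x) ∧
    ∃ F : Finset (Fin n → ℕ), ∀ m ∉ F, ε m = multiDeriv m w

lemma multiDeriv_eq_add {w r : V n → Cl n} (hr : TameAt Λ r 0) (h : ∀ x, w x = T.K x + r x)
    (m : Fin n → ℕ) :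
    ∀ᶠ x in 𝓝[≠] 0, multiDeriv m w x = multiDeriv m T.K x + multiDeriv m r x := by
  filter_upwards [self_mem_nhdsWithin, nhdsWithin_le_nhds hr.eventually] with x hx hrx
  rw [funext h]
  refine multiDeriv_add ?_ hrx m
  simpa using T.tameAt_shift (x := x) (v := 0) (by simpa using hx)

lemma CotLike.epsFamily (hω : LinearIndependent ℝ ω) {w : V n → Cl n} (h : CotLike T ω l w) :
    EpsFamily T ω l ∅ fun m => multiDeriv m w := by
  obtain ⟨r, hr, hwr⟩ := h.eq_add
  refine ⟨fun m x hx _ => (h.tameAt x hx).multiDeriv m, fun m x hx _ μ => multiDeriv_sgn ?_ m,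
    fun x μ => Iff.rfl, by simp, fun m => ⟨_, hr.multiDeriv m, multiDeriv_eq_add hr hwr m⟩,
    w, r, h.tameAt, hr, hwr, ∅, fun m _ => rfl⟩
  filter_upwards [eventually_notMem_lattice hω hx] with y hy using h.quasi y hy μ

end Family

/-! ### The Weierstrass sum -/

section Torus

variable {n j : ℕ} {Λ : DiffOp n j} {T : Kernel Λ} {ω : Fin n → V n}

lemma iterD_increment (hω : LinearIndependent ℝ ω) {f : V n → Cl n} {v : V n}
    {c : Cl n} (h : ∀ x ∉ lattice ω, f (x + v) = f x + c)
    (L : List (Fin n)) : ∀ x ∉ lattice ω,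
      iterD L f (x + v) = iterD L f x + if L = [] then c else 0 := by
  induction L with
  | nil => simpa using h
  | cons i L ih =>
    intro x hx
    have h1 : (fun y => iterD L f (y + v)) =ᶠ[𝓝 x] fun y => iterD L f y + if L = [] then c else 0 := by
      filter_upwards [eventually_notMem_lattice hω hx] with y hy using ih y hy
    have h2 : fderiv ℝ (fun y => iterD L f (y + v)) x = fderiv ℝ (iterD L f) (x + v) :=
      fderiv_comp_add_right v
    have h3 : fderiv ℝ (fun y => iterD L f y + if L = [] then c else 0) x =
        fderiv ℝ (iterD L f) x := fderiv_add_const _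
    simp [partialDeriv, ← h2, h1.fderiv_eq, h3]

/-- The linear function with prescribed increments. -/
noncomputable def periodPart (ω : Fin n → V n) (F : V n → Cl n) : V n →L[ℝ] Cl n :=
  LinearMap.toContinuousLinearMap
    (∑ i, ((LinearMap.proj i).comp (latCoord ω)).smulRight
      (F ((1 / 2 : ℝ) • ω i) - F (-((1 / 2 : ℝ) • ω i))))

lemma removePeriods_eq (F : V n → Cl n) (x : V n) :
    removePeriods ω F x = F x - periodPart ω F x := by
  simp [removePeriods, periodPart]

lemma latCoord_latPt (hω : LinearIndependent ℝ ω) (m : Fin n → ℤ) :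
    latCoord ω (latPt ω m) = fun i => (m i : ℝ) := by
  have hinj := hω.fintypeLinearCombination_injective
  have h2 : Fintype.linearCombination ℝ ω (fun i => (m i : ℝ)) = latPt ω m := by
    simp [Fintype.linearCombination_apply, latPt, Int.cast_smul_eq_zsmul]
  rw [← h2, latCoord]
  exact LinearMap.leftInverse_apply_of_inj (LinearMap.ker_eq_bot.2 hinj) _

/-- Increments are known off the lattice only, and `removePeriods` reads them off between `-ω i / 2`
and `ω i / 2`. -/
lemma half_notMem_lattice (hω : LinearIndependent ℝ ω) (i : Fin n) :
    -((1 / 2 : ℝ) • ω i) ∉ lattice ω := by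
  intro h
  obtain ⟨m, hm⟩ := (mem_lattice_iff ω).1 h
  have h1 := latCoord_latPt hω m
  have h2 := latCoord_latPt hω (Pi.single i 1)
  rw [latPt_single] at h2
  rw [hm, map_neg, map_smul, h2] at h1
  have h3 := congrFun h1 i
  simp only [Pi.neg_apply, Pi.smul_apply, Pi.single_eq_same, smul_eq_mul] at h3
  have h4 : (2 * m i : ℤ) = -1 := by
    have : (2 * m i : ℝ) = -1 := by rw [← h3]; norm_num
    exact_mod_cast this
  omega

lemma half_add (i : Fin n) : -((1 / 2 : ℝ) • ω i) + ω i = (1 / 2 : ℝ) • ω i := by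
  module

/-- Removing the periods of a function with constant increments. -/
lemma removePeriods_add (hω : LinearIndependent ℝ ω) {F : V n → Cl n}
    (h : ∀ i, ∃ c, ∀ x ∉ lattice ω, F (x + ω i) = F x + c) {x : V n} (hx : x ∉ lattice ω)
    (μ : Fin n → ℤ) : removePeriods ω F (x + latPt ω μ) = sgn 0 μ • removePeriods ω F x := by
  refine quasi_of_generators (S := {x | x ∉ lattice ω}) (fun x hx m => ?_) (fun i x hx => ?_) μ x hx
  · simpa [add_latPt_mem_iff] using hx
  · obtain ⟨c, hc⟩ := h i
    have h1 := hc _ (half_notMem_lattice hω i)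
    rw [half_add] at h1
    have h2 : latCoord ω (ω i) = Pi.single i 1 := by
      rw [← latPt_single ω i, latCoord_latPt hω]
      funext a
      by_cases ha : a = i
      · subst ha; simp
      · simp [ha]
    have h3 : periodPart ω F (ω i) = c := by
      simp only [periodPart, LinearMap.coe_toContinuousLinearMap', LinearMap.sum_apply,
        LinearMap.smulRight_apply, LinearMap.comp_apply, LinearMap.proj_apply, h2]
      rw [Finset.sum_eq_single i]
      · rw [Pi.single_eq_same, one_smul, h1, add_sub_cancel_left]
      · intro b _ hb; simp [hb]
      · simp
    rw [sgn_zero_left, one_smul, removePeriods_eq, removePeriods_eq, hc x hx, map_add, h3]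
    abel

lemma periodPart_eq_zero (hω : LinearIndependent ℝ ω) {F : V n → Cl n}
    (h : ∀ i, ∀ x ∉ lattice ω, F (x + ω i) = F x) : periodPart ω F = 0 := by
  ext x
  simp only [periodPart, LinearMap.coe_toContinuousLinearMap', LinearMap.sum_apply,
    LinearMap.smulRight_apply]
  refine Finset.sum_eq_zero fun i _ => ?_
  have h1 := h i _ (half_notMem_lattice hω i)
  rw [half_add] at h1
  rw [h1, sub_self, smul_zero]

variable (hT : ∀ z ≠ 0, ∀ x, Λ.app (taylor2 T.K z) x = 0)

include hT in
lemma weierstrassSum_eq (hω : LinearIndependent ℝ ω) :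
    weierstrassSum T.K ω = (T.subQuadratic hT).sum ω 0 := by
  funext x
  rw [weierstrassSum, SubPoly.sum]
  refine tsum_congr fun m => ?_
  by_cases hm : m = 0
  · simp [hm, SubPoly.term, Kernel.subQuadratic]
  · simp [hm, SubPoly.term, Kernel.subQuadratic, latPt_ne_zero hω hm, sgn_zero_left]

/-- The increment is affine in `x`, and its linear part involves only the second derivative of `K`
at the lattice point; both torus cases rest on this. -/
lemma incr_subQuadratic (i : Fin n) (m : Fin n → ℤ) (x : V n) :
    (T.subQuadratic hT).incr ω 0 i m x = if latPt ω m = 0 then 0 else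
      -(fderiv ℝ T.K (latPt ω m) (ω i) + fderiv ℝ (fderiv ℝ T.K) (latPt ω m) x (ω i) +
        (1 / 2 : ℝ) • fderiv ℝ (fderiv ℝ T.K) (latPt ω m) (ω i) (ω i)) := by
  by_cases h : latPt ω m = 0
  · simp [SubPoly.incr, Kernel.subQuadratic, h]
  · simp only [SubPoly.incr, Kernel.subQuadratic, h, if_false, sgn_zero_left, one_smul,
      taylor2_eq (T.contDiffAt_two h), map_add, _root_.add_apply,
      T.symm_fderiv_fderiv h (ω i) x]
    module

/-- A family of increments obtained by removing the periods of derivatives. -/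
lemma epsFamily_of_increments (hω : LinearIndependent ℝ ω) {w r : V n → Cl n}
    (hw : ∀ x ∉ lattice ω, TameAt Λ w x) (hr : TameAt Λ r 0) (hwr : ∀ x, w x = T.K x + r x)
    {S : Set (V n)} (hS : ∀ x μ, x + latPt ω μ ∈ S ↔ x ∈ S) (hS0 : ∀ᶠ x in 𝓝 0, x ∉ S)
    {ε₀ : V n → Cl n} (h0 : ∀ x ∉ lattice ω, x ∉ S → TameAt Λ ε₀ x)
    (hq : ∀ x ∉ lattice ω, x ∉ S → ∀ μ, ε₀ (x + latPt ω μ) = ε₀ x)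
    (hr0 : ∃ r, TameAt Λ r 0 ∧ ∀ x, ε₀ x = T.K x + r x)
    (hinc : ∀ m ≠ 0, ∀ i, ∃ c, ∀ x ∉ lattice ω, multiDeriv m w (x + ω i) = multiDeriv m w x + c)
    (hinc' : ∀ m : Fin n → ℕ, j ≤ ∑ a, m a → m ≠ 0 → ∀ i, ∀ x ∉ lattice ω,
      multiDeriv m w (x + ω i) = multiDeriv m w x) (hj : j ≤ 2) :
    EpsFamily T ω 0 S fun m => if m = 0 then ε₀ else removePeriods ω (multiDeriv m w) := by
  have hper : ∀ m ≠ 0, ∀ x, TameAt Λ (periodPart ω (multiDeriv m w)) x := by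
    intro m hm x
    by_cases hj' : j ≤ ∑ a, m a
    · rw [periodPart_eq_zero hω (hinc' m hj' hm)]
      exact tameAt_zero x
    · have hm1 : 1 ≤ ∑ a, m a := by
        by_contra hlt
        apply hm
        funext a
        have := Finset.single_le_sum (f := m) (fun _ _ => Nat.zero_le _) (Finset.mem_univ a)
        simp only [Pi.zero_apply]
        omega
      -- What is left is `|m| = 1` for a second order operator, and such an operator annihilates
      -- linear functions.
      obtain rfl : j = 2 := by omega
      refine tameAt_of_contDiffAt (ContinuousLinearMap.contDiff _) fun y => ?_
      have h1 : iteratedFDeriv ℝ 2 (periodPart ω (multiDeriv m w)) y = 0 := by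
        ext v
        have h2 : fderiv ℝ (periodPart ω (multiDeriv m w)) = fun _ => periodPart ω (multiDeriv m w) :=
          funext fun y => ContinuousLinearMap.fderiv _
        rw [iteratedFDeriv_two_apply, h2]
        simp
      rw [DiffOp.app, h1, map_zero]
  have hrem : ∀ m, removePeriods ω (multiDeriv m w) =
      fun x => multiDeriv m w x - periodPart ω (multiDeriv m w) x :=
    fun m => funext fun x => removePeriods_eq _ x
  refine ⟨fun m x hx hxS => ?_, fun m x hx hxS μ => ?_, hS, hS0, fun m => ?_, w, r, hw, hr, hwr,
    Finset.Iic (fun _ => 1), fun m hm => ?_⟩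
  · by_cases hm : m = 0
    · simpa only [hm, if_true] using h0 x hx (hxS hm)
    · simp only [hm, if_false, hrem]
      exact ((hw x hx).multiDeriv m).sub (hper m hm x)
  · by_cases hm : m = 0
    · simpa only [hm, if_true, sgn_zero_left, one_smul] using hq x hx (hxS hm) μ
    · simp only [hm, if_false]
      exact removePeriods_add hω (hinc m hm) hx μ
  · by_cases hm : m = 0
    · obtain ⟨r', hr', h⟩ := hr0
      refine ⟨r', hr', Eventually.of_forall fun x => ?_⟩
      simp only [hm, if_true, multiDeriv_zero, h]
    · refine ⟨_, (hr.multiDeriv m).sub (hper m hm 0), ?_⟩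
      filter_upwards [multiDeriv_eq_add hr hwr m] with x hx
      simp only [hm, if_false, hrem, hx]
      abel
  -- Outside the finite set of multi-indices with all entries at most `1` one has `|m| ≥ 2 ≥ j`, and
  -- there is no period to remove.
  · have hex : ∃ a, 1 < m a := by simpa [Pi.le_def] using hm
    obtain ⟨a, ha⟩ := hex
    have hm0 : m ≠ 0 := by rintro rfl; simp at ha
    have h2 : j ≤ ∑ a, m a := by
      have := Finset.single_le_sum (f := m) (fun _ _ => Nat.zero_le _) (Finset.mem_univ a)
      omega
    simp only [hm0, if_false, hrem, periodPart_eq_zero hω (hinc' m h2 hm0)]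
    simp

end Torus

end CliffordCylinder

open scoped Topology
namespace CliffordCylinder
open Metric Filter

/-! ### Increments of the Weierstrass sum -/

section Weierstrass

variable {n : ℕ} {ω : Fin n → V n} (hω : LinearIndependent ℝ ω)

include hω

section First

variable {Λ : DiffOp n 1} {T : Kernel Λ}
  (hT : ∀ z ≠ 0, ∀ x, Λ.app (taylor2 T.K z) x = 0) (hodd : ∀ z, T.K (-z) = -T.K z)

include hT hodd

/-- In the difference of the increments at two base points only the part linear in the base point
survives. It involves the second derivative of the odd function `K`, which is odd in `ω`. -/
lemma weierstrassSum_add_first (i : Fin n) (x y : V n) :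
    weierstrassSum T.K ω (x + ω i) - weierstrassSum T.K ω x =
      weierstrassSum T.K ω (y + ω i) - weierstrassSum T.K ω y := by
  have hd : ∀ z, fderiv ℝ T.K (-z) = fderiv ℝ T.K z := fun z => by
    rw [fderiv_parity (s := -1) (by simpa using hodd), neg_neg, one_smul]
  have hd2 : ∀ z, fderiv ℝ (fderiv ℝ T.K) (-z) = -fderiv ℝ (fderiv ℝ T.K) z := fun z => by
    rw [fderiv_parity (s := 1) (by simpa using hd), neg_one_smul]
  have h := (T.subQuadratic hT).sum_increments_eq_zero (l := 0) hω
    (by have := T.add_eq; omega) i ![x, y] ![1, -1] fun m => by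
      simp only [Fin.sum_univ_two, Matrix.cons_val_zero, Matrix.cons_val_one,
        incr_subQuadratic, latPt_neg, neg_eq_zero]
      by_cases h : latPt ω m = 0
      · simp [h]
      · simp only [h, if_false, hd, hd2, _root_.neg_apply]
        module
  rw [← weierstrassSum_eq hT hω] at h
  simp only [Fin.sum_univ_two, Matrix.cons_val_zero, Matrix.cons_val_one, sgn_zero_left,
    one_smul, neg_smul] at h
  exact eq_of_sub_eq_zero (by rw [sub_eq_add_neg]; exact h)

/-- The increments of the Weierstrass sum are constant. Hence its derivatives are periodic, and in
`ε_0` the constants of the two summands cancel. -/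
lemma epsFamily_torus_first {b : V n} (hb : b ∉ lattice ω) :
    EpsFamily T ω 0 {x | x - b ∈ lattice ω} fun m =>
      if m = 0 then fun x => weierstrassSum T.K ω x - weierstrassSum T.K ω (x - b)
      else removePeriods ω (multiDeriv m (weierstrassSum T.K ω)) := by
  have hM : n < T.N + 3 := by have := T.add_eq; omega
  have hW : ∀ x ∉ lattice ω, TameAt Λ (weierstrassSum T.K ω) x := fun x hx => by
    rw [weierstrassSum_eq hT hω]
    exact (T.subQuadratic hT).tameAt_sum hω hM hx
  obtain ⟨r, hr, hWr⟩ := (T.subQuadratic hT).exists_eq_add (l := 0) hω hM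
  rw [← weierstrassSum_eq hT hω] at hWr
  have hWb : ∀ x, x - b ∉ lattice ω → TameAt Λ (fun x => weierstrassSum T.K ω (x - b)) x := by
    intro x hx
    simpa only [sub_eq_add_neg] using
      (show TameAt Λ (weierstrassSum T.K ω) (x + -b) by
        rw [← sub_eq_add_neg]; exact hW _ hx).comp_add_right
  have hinc : ∀ m : Fin n → ℕ, m ≠ 0 → ∀ i, ∀ x ∉ lattice ω,
      multiDeriv m (weierstrassSum T.K ω) (x + ω i) = multiDeriv m (weierstrassSum T.K ω) x := by
    intro m hm i x hx
    have h1 := iterD_increment hω (v := ω i)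
      (c := weierstrassSum T.K ω (0 + ω i) - weierstrassSum T.K ω 0)
      (fun x _ => by rw [← weierstrassSum_add_first hω hT hodd i x 0]; abel) (multiList m) x hx
    have h2 : multiList m ≠ [] := fun h => by
      apply hm
      funext a
      have := count_multiList m a
      simpa [h] using this.symm
    simpa [multiDeriv_eq_iterD, h2] using h1
  refine epsFamily_of_increments hω hW hr hWr (fun x μ => ?_) ?_ (fun x hx hxb => ?_)
    (fun x hx hxb μ => ?_) ⟨fun x => r x - weierstrassSum T.K ω (x - b), hr.sub (hWb 0 ?_),
      fun x => ?_⟩ (fun m hm i => ⟨0, fun x hx => by rw [hinc m hm i x hx, add_zero]⟩)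
    (fun m _ hm => hinc m hm) one_le_two
  · show x + latPt ω μ - b ∈ lattice ω ↔ x - b ∈ lattice ω
    rw [add_sub_right_comm, add_latPt_mem_iff]
  · have h1 : Tendsto (fun x : V n => x - b) (𝓝 0) (𝓝 (0 - b)) :=
      (continuous_id.sub continuous_const).tendsto 0
    exact h1.eventually (eventually_notMem_lattice hω (by simpa using hb))
  · exact (hW x hx).sub (hWb x hxb)
  · have := quasi_of_generators (l := 0) (ω := ω) (S := Set.univ)
      (w := fun x => weierstrassSum T.K ω x - weierstrassSum T.K ω (x - b))
      (fun _ _ _ => trivial) (fun i x _ => ?_) μ x trivial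
    · simpa only [sgn_zero_left, one_smul] using this
    · have h1 := weierstrassSum_add_first hω hT hodd i x (x - b)
      rw [sgn_zero_left, one_smul, add_sub_right_comm]
      rw [sub_eq_sub_iff_add_eq_add] at h1 ⊢
      rw [h1, add_comm]
  · simpa using hb
  · simp only [hWr x]
    abel

end First

section Second

variable {Λ : DiffOp n 2} {T : Kernel Λ} (hT : ∀ z ≠ 0, ∀ x, Λ.app (taylor2 T.K z) x = 0)

include hT

/-- Increments of the subtracted polynomials are affine in the base point, so the combination
vanishes for each lattice point separately, without any parity. -/
lemma weierstrassSum_add_second (i : Fin n) {x y x' y' : V n} (h : x + y = x' + y') :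
    (weierstrassSum T.K ω (x + ω i) - weierstrassSum T.K ω x) +
      (weierstrassSum T.K ω (y + ω i) - weierstrassSum T.K ω y) =
    (weierstrassSum T.K ω (x' + ω i) - weierstrassSum T.K ω x') +
      (weierstrassSum T.K ω (y' + ω i) - weierstrassSum T.K ω y') := by
  have h := (T.subQuadratic hT).sum_increments_eq_zero (l := 0) hω
    (by have := T.add_eq; omega) i ![x, y, x', y'] ![1, 1, -1, -1] fun m => by
      have h0 : ∀ m, ∑ b, (![1, 1, -1, -1] : Fin 4 → ℝ) b •
          (T.subQuadratic hT).incr ω 0 i m ((![x, y, x', y'] : Fin 4 → V n) b) = 0 := by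
        intro m
        simp only [incr_subQuadratic]
        by_cases hm : latPt ω m = 0
        · simp [hm]
        · have hy : y = x' + y' - x := by rw [← h]; abel
          simp only [Fin.sum_univ_four, hm, if_false, Matrix.cons_val, hy, map_add, map_sub,
            _root_.add_apply, _root_.sub_apply]
          module
      rw [h0, h0, neg_zero]
  rw [← weierstrassSum_eq hT hω] at h
  simp only [Fin.sum_univ_four, Matrix.cons_val, sgn_zero_left, one_smul, neg_smul] at h
  rw [← sub_eq_zero]
  rw [← h]
  abel

/-- The preceding relation, applied to `(x + z) + y = (y + z) + x`, is differentiated in `z`. -/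
lemma fderiv_weierstrassSum_add (i : Fin n) {x y : V n} (hx : x ∉ lattice ω) (hy : y ∉ lattice ω) :
    fderiv ℝ (weierstrassSum T.K ω) (x + ω i) - fderiv ℝ (weierstrassSum T.K ω) x =
      fderiv ℝ (weierstrassSum T.K ω) (y + ω i) - fderiv ℝ (weierstrassSum T.K ω) y := by
  have hM : n < T.N + 3 := by have := T.add_eq; omega
  have hW : ∀ x ∉ lattice ω, DifferentiableAt ℝ (weierstrassSum T.K ω) x := fun x hx => by
    rw [weierstrassSum_eq hT hω]
    exact ((T.subQuadratic hT).tameAt_sum hω hM hx).contDiffAt.differentiableAt (by simp)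
  have hd : ∀ x ∉ lattice ω, fderiv ℝ (fun z =>
      weierstrassSum T.K ω (x + z + ω i) - weierstrassSum T.K ω (x + z)) 0 =
      fderiv ℝ (weierstrassSum T.K ω) (x + ω i) - fderiv ℝ (weierstrassSum T.K ω) x := by
    intro x hx
    have hx' : x + ω i ∉ lattice ω := by
      have := add_latPt_mem_iff (ω := ω) (x := x) (m := Pi.single i 1)
      rw [latPt_single] at this
      rwa [this]
    have h1 : HasFDerivAt (fun z : V n => x + z + ω i) (ContinuousLinearMap.id ℝ (V n)) 0 :=
      ((hasFDerivAt_id (0 : V n)).const_add x).add_const _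
    have h2 : HasFDerivAt (fun z : V n => x + z) (ContinuousLinearMap.id ℝ (V n)) 0 :=
      (hasFDerivAt_id (0 : V n)).const_add x
    have h3 := HasFDerivAt.comp (g := weierstrassSum T.K ω) (0 : V n)
      (by simpa using (hW _ hx').hasFDerivAt) h1
    have h4 := HasFDerivAt.comp (g := weierstrassSum T.K ω) (0 : V n)
      (by simpa using (hW _ hx).hasFDerivAt) h2
    exact (h3.sub h4).fderiv
  rw [← hd x hx, ← hd y hy]
  have : (fun z => weierstrassSum T.K ω (x + z + ω i) - weierstrassSum T.K ω (x + z)) =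
      fun z => (weierstrassSum T.K ω (y + z + ω i) - weierstrassSum T.K ω (y + z)) +
        ((weierstrassSum T.K ω (x + ω i) - weierstrassSum T.K ω x) -
        (weierstrassSum T.K ω (y + ω i) - weierstrassSum T.K ω y)) := by
    funext z
    have := weierstrassSum_add_second hω hT i (x := x + z) (y := y) (x' := y + z) (y' := x)
      (by abel)
    rw [add_sub, eq_sub_iff_add_eq, this]
  rw [this]
  exact fderiv_add_const _

/-- First derivatives of the Weierstrass sum have constant increments and higher ones have none,
while the relation `b₂ = b₃ + b₄` makes the affine increments cancel in `ε_0`. -/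
lemma epsFamily_torus_second {b₂ b₃ b₄ : V n} (hb₂ : b₂ ∉ lattice ω) (hb₃ : b₃ ∉ lattice ω)
    (hb₄ : b₄ ∉ lattice ω) (hb : b₂ = b₃ + b₄) :
    EpsFamily T ω 0 {x | x - b₂ ∈ lattice ω ∨ x - b₃ ∈ lattice ω ∨ x - b₄ ∈ lattice ω} fun m =>
      if m = 0 then fun x => weierstrassSum T.K ω x + weierstrassSum T.K ω (x - b₂)
        - weierstrassSum T.K ω (x - b₃) - weierstrassSum T.K ω (x - b₄)
      else removePeriods ω (multiDeriv m (weierstrassSum T.K ω)) := by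
  have hM : n < T.N + 3 := by have := T.add_eq; omega
  have hW : ∀ x ∉ lattice ω, TameAt Λ (weierstrassSum T.K ω) x := fun x hx => by
    rw [weierstrassSum_eq hT hω]
    exact (T.subQuadratic hT).tameAt_sum hω hM hx
  obtain ⟨r, hr, hWr⟩ := (T.subQuadratic hT).exists_eq_add (l := 0) hω hM
  rw [← weierstrassSum_eq hT hω] at hWr
  have hWb : ∀ b x, x - b ∉ lattice ω → TameAt Λ (fun x => weierstrassSum T.K ω (x - b)) x := by
    intro b x hx
    simpa only [sub_eq_add_neg] using
      (show TameAt Λ (weierstrassSum T.K ω) (x + -b) by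
        rw [← sub_eq_add_neg]; exact hW _ hx).comp_add_right
  have hinc : ∀ m : Fin n → ℕ, m ≠ 0 → ∀ i, ∃ c, (2 ≤ ∑ a, m a → c = 0) ∧ ∀ x ∉ lattice ω,
      multiDeriv m (weierstrassSum T.K ω) (x + ω i) =
        multiDeriv m (weierstrassSum T.K ω) x + c := by
    intro m hm i
    have h2 : multiList m ≠ [] := fun h => by
      apply hm
      funext a
      have := count_multiList m a
      simpa [h] using this.symm
    -- The last entry of the list is the derivative applied first; its increments are constant, and
    -- any further derivative kills them.
    obtain ⟨L, a, hL⟩ := List.eq_nil_or_concat' (multiList m) |>.resolve_left h2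
    have hz := half_notMem_lattice hω i
    set z := -((1 / 2 : ℝ) • ω i) with hzdef
    have h1 := iterD_increment hω (v := ω i) (f := partialDeriv a (weierstrassSum T.K ω))
      (c := partialDeriv a (weierstrassSum T.K ω) (z + ω i) -
        partialDeriv a (weierstrassSum T.K ω) z)
      (fun x hx => by
        have := congrArg (fun L => L (stdVec a)) (fderiv_weierstrassSum_add hω hT i hx hz)
        simp only [_root_.sub_apply] at this
        rw [← sub_eq_iff_eq_add']
        exact this) L
    refine ⟨if L = [] then partialDeriv a (weierstrassSum T.K ω) (z + ω i) -
      partialDeriv a (weierstrassSum T.K ω) z else 0, fun hm2 => ?_, fun x hx => ?_⟩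
    rotate_left
    · have h3 := h1 x hx
      simp only [multiDeriv_eq_iterD, hL, iterD_append]
      exact h3
    · have : L ≠ [] := by
        rintro rfl
        have := length_multiList m
        rw [hL] at this
        simp at this
        omega
      simp [this]
  refine epsFamily_of_increments hω hW hr hWr (fun x μ => ?_) ?_ (fun x hx hxb => ?_)
    (fun x hx hxb μ => ?_) ⟨fun x => r x + weierstrassSum T.K ω (x - b₂)
        - weierstrassSum T.K ω (x - b₃) - weierstrassSum T.K ω (x - b₄),
      ((hr.add (hWb _ 0 (by simpa using hb₂))).sub (hWb _ 0 (by simpa using hb₃))).sub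
        (hWb _ 0 (by simpa using hb₄)),
      fun x => ?_⟩ (fun m hm i => (hinc m hm i).imp fun c hc => hc.2)
    (fun m hm2 hm i x hx => ?_) le_rfl
  · show (x + latPt ω μ - b₂ ∈ lattice ω ∨ x + latPt ω μ - b₃ ∈ lattice ω ∨
      x + latPt ω μ - b₄ ∈ lattice ω) ↔ _
    rw [add_sub_right_comm, add_sub_right_comm, add_sub_right_comm, add_latPt_mem_iff,
      add_latPt_mem_iff, add_latPt_mem_iff]
    rfl
  · have h1 : ∀ b ∉ lattice ω, ∀ᶠ x in 𝓝 (0 : V n), x - b ∉ lattice ω := fun b hb =>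
      ((continuous_id.sub continuous_const).tendsto (0 : V n)).eventually
        (eventually_notMem_lattice hω (by simpa using hb))
    filter_upwards [h1 _ hb₂, h1 _ hb₃, h1 _ hb₄] with x h2 h3 h4
    rintro (h | h | h)
    exacts [h2 h, h3 h, h4 h]
  · replace hxb : ¬(x - b₂ ∈ lattice ω ∨ x - b₃ ∈ lattice ω ∨ x - b₄ ∈ lattice ω) := hxb
    simp only [not_or] at hxb
    exact (((hW x hx).add (hWb _ x hxb.1)).sub (hWb _ x hxb.2.1)).sub (hWb _ x hxb.2.2)
  · have := quasi_of_generators (l := 0) (ω := ω) (S := Set.univ)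
      (w := fun x => weierstrassSum T.K ω x + weierstrassSum T.K ω (x - b₂)
        - weierstrassSum T.K ω (x - b₃) - weierstrassSum T.K ω (x - b₄))
      (fun _ _ _ => trivial) (fun i x _ => ?_) μ x trivial
    · simpa only [sgn_zero_left, one_smul] using this
    · have h1 := weierstrassSum_add_second hω hT i (x := x) (y := x - b₂) (x' := x - b₃)
        (y' := x - b₄) (by rw [hb]; abel)
      rw [sgn_zero_left, one_smul, add_sub_right_comm x, add_sub_right_comm x,
        add_sub_right_comm x]
      rw [← sub_eq_zero] at h1 ⊢
      rw [← h1]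
      abel
  · simp only [hWr x]
    abel
  · obtain ⟨c, hc, h⟩ := hinc m hm i
    rw [h x hx, hc hm2, add_zero]

end Second

end Weierstrass

end CliffordCylinder

open scoped Topology
namespace CliffordCylinder
open Metric Filter
open scoped Nat

/-! ### Summation of Laurent expansions -/

section Laurent

variable {n j : ℕ} {Λ : DiffOp n j}

/-- Near `x` the derivatives of order `p` of `w` are tame with constant `s * (2 * A) ^ p * p!`.
Coefficients taken at `r = q / (2 * A)` leave `q ^ p` with `q * n < 1`, which is summable over all
multi-indices. -/
lemma exists_tame_multiDeriv_mul {w : V n → Cl n} {x : V n} (hw : TameAt Λ w x)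
    {c : (Fin n → ℕ) → Cl n}
    (hc : ∀ r : ℝ, 0 < r → ∃ C : ℝ, 0 ≤ C ∧ ∀ m,
      ‖c m‖ ≤ C * r ^ (∑ a, m a) * ((∑ a, m a)! : ℝ)⁻¹) :
    ∃ δ > 0, ∃ A : ℝ, 1 ≤ A ∧ ∃ s : (Fin n → ℕ) → ℝ, Summable s ∧
      ∀ m, Tame Λ (ball x δ) (fun y => multiDeriv m w y * c m) (s m) A := by
  obtain ⟨δ, hδ, s, A, hA, h⟩ := hw
  have hs : 0 ≤ s := h.bound.nonneg ⟨x, mem_ball_self hδ⟩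
  have hA0 : (0 : ℝ) < 2 * A := by linarith
  set q : ℝ := ((n : ℝ) + 1)⁻¹ with hq
  have hq0 : 0 < q := by positivity
  obtain ⟨C, hC, hb⟩ := hc (q / (2 * A)) (by positivity)
  have hsum : Summable fun m : Fin n → ℕ => ‖mulR (n := n)‖ * C * s * q ^ (∑ a, m a) := by
    refine (summable_pow_sum hq0.le ?_).mul_left _
    rw [hq, inv_mul_lt_iff₀ (by positivity)]
    linarith
  refine ⟨δ, hδ, 2 * A, by linarith, _, hsum, fun m => ?_⟩
  refine ((h.multiDeriv isOpen_ball (by linarith) m).mul_right (c m)).mono subset_rfl ?_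
    (by linarith) le_rfl
  have h1 : ‖mulR (c m)‖ ≤ ‖mulR (n := n)‖ *
      (C * (q / (2 * A)) ^ (∑ a, m a) * ((∑ a, m a)! : ℝ)⁻¹) :=
    ((mulR (n := n)).le_opNorm (c m)).trans (mul_le_mul_of_nonneg_left (hb m) (norm_nonneg _))
  have hf : ((∑ a, m a)! : ℝ) ≠ 0 := by positivity
  calc ‖mulR (c m)‖ * (s * (2 * A) ^ (∑ a, m a) * ((∑ a, m a)! : ℝ))
      ≤ ‖mulR (n := n)‖ * (C * (q / (2 * A)) ^ (∑ a, m a) * ((∑ a, m a)! : ℝ)⁻¹) *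
        (s * (2 * A) ^ (∑ a, m a) * ((∑ a, m a)! : ℝ)) :=
        mul_le_mul_of_nonneg_right h1 (by positivity)
    _ = ‖mulR (n := n)‖ * C * s * q ^ (∑ a, m a) := by
        rw [div_pow]
        field_simp

/-- A function which has a null solution as continuation near each point of a set extends to a null
solution. -/
lemma exists_extension [Nonempty (Fin n)] {h : V n → Cl n} {O : Set (V n)}
    (hO : ∀ x ∈ O, ∃ ψ, TameAt Λ ψ x ∧ h =ᶠ[𝓝[≠] x] ψ) :
    ∃ Φ : V n → Cl n, (∀ x ∈ O, TameAt Λ Φ x ∧ h =ᶠ[𝓝[≠] x] Φ) ∧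
      ∀ x, TameAt Λ h x → Φ x = h x := by
  -- The extension is the limit in punctured neighbourhoods, which are nontrivial because the
  -- dimension is positive.
  have hlim : ∀ {x : V n} {ψ : V n → Cl n}, TameAt Λ ψ x → h =ᶠ[𝓝[≠] x] ψ →
      limUnder (𝓝[≠] x) h = ψ x := fun {x ψ} hψ he =>
    Tendsto.limUnder_eq ((hψ.contDiffAt.continuousAt.tendsto.mono_left
      nhdsWithin_le_nhds).congr' he.symm)
  refine ⟨fun x => limUnder (𝓝[≠] x) h, fun x hx => ?_,
    fun x hx => hlim hx EventuallyEq.rfl⟩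
  obtain ⟨ψ, hψ, he⟩ := hO x hx
  have h1 : ∀ᶠ y in 𝓝[≠] x, limUnder (𝓝[≠] y) h = ψ y := by
    filter_upwards [eventually_eventually_nhdsWithin.2 he, self_mem_nhdsWithin,
      nhdsWithin_le_nhds hψ.eventually] with y hy hyx hψy
    rw [isOpen_compl_singleton.nhdsWithin_eq hyx] at hy
    exact hlim hψy (nhdsWithin_le_nhds hy)
  refine ⟨hψ.congr ?_, ?_⟩
  · rw [eventually_nhdsWithin_iff] at h1
    filter_upwards [h1] with y hy
    by_cases hyx : y = x
    · subst hyx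
      exact hlim hψ he
    · exact hy hyx
  · filter_upwards [h1, he] with y h2 h3
    rw [h3, h2]

variable {k l : ℕ} {ω : Fin k → V n} {S : Set (V n)} {ε : (Fin n → ℕ) → V n → Cl n}

/-- The finitely many exceptional indices do not affect convergence, and at a point of `S` the only
singular term is that of `m = 0`, whose coefficient vanishes. -/
lemma EpsFamily.tameAt_tsum {T : Kernel Λ} (hε : EpsFamily T ω l S ε) {c : (Fin n → ℕ) → Cl n}
    (hc : ∀ r : ℝ, 0 < r → ∃ C : ℝ, 0 ≤ C ∧ ∀ m,
      ‖c m‖ ≤ C * r ^ (∑ a, m a) * ((∑ a, m a)! : ℝ)⁻¹) {x : V n} (hx : x ∉ lattice ω)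
    (hS : x ∈ S → c 0 = 0) :
    TameAt Λ (fun y => ∑' m, ε m y * c m) x ∧ ∃ t ∈ 𝓝 x,
      HasSumUniformlyOn (fun m y => ε m y * c m) (fun y => ∑' m, ε m y * c m) t := by
  obtain ⟨w, r, hw, -, -, F, hF⟩ := hε.eq_multiDeriv
  obtain ⟨δ, hδ, A, hA, s, hs, h⟩ := exists_tame_multiDeriv_mul (hw x hx) hc
  have hF' : ∀ m ∉ F, Tame Λ (ball x δ) (fun y => ε m y * c m) (s m) A := fun m hm => by
    rw [hF m hm]; exact h m
  refine ⟨(CliffordCylinder.tameAt_tsum (fun m => ?_) hδ hA hs F hF').1, ball x δ,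
    ball_mem_nhds x hδ, ?_⟩
  · by_cases hmc : m = 0 → x ∉ S
    · exact (hε.tameAt m x hx hmc).mul_right _
    · push Not at hmc
      simp only [hmc.1, hS hmc.2, mul_zero]
      exact tameAt_zero x
  · rw [hasSumUniformlyOn_iff_tendstoUniformlyOn]
    refine tendstoUniformlyOn_tsum_of_cofinite_eventually hs ?_
    filter_upwards [F.finite_toSet.compl_mem_cofinite] with m hm y hy
    simpa using ((hF' m (by simpa using hm)).bound y hy).2 0

/-- Near `0` the singular part of `g` is the series of `∂^m K * c_m`. Replacing `∂^m K` by `ε m`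
changes it by a convergent series of functions regular at `0`. -/
lemma EpsFamily.exists_regular {T : FundSol Λ} (hε : EpsFamily T.toKernel ω l S ε) {g : V n → Cl n}
    {R : ℝ} (hR : 0 < R) (hg : ∀ x, 0 < ‖x‖ → ‖x‖ < R → TameAt Λ g x) :
    ∃ ψ, TameAt Λ ψ 0 ∧
      (fun x => g x - ∑' m, ε m x * T.laurentCoeff hR g m) =ᶠ[𝓝[≠] 0] ψ := by
  classical
  set c := T.laurentCoeff hR g with hcdef
  have hc : ∀ r : ℝ, 0 < r → ∃ C : ℝ, 0 ≤ C ∧ ∀ m,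
      ‖c m‖ ≤ C * r ^ (∑ a, m a) * ((∑ a, m a)! : ℝ)⁻¹ := fun r hr => by
    obtain ⟨C, hC, -, h⟩ := T.exists_norm_laurentCoeff_le hR hg hr
    exact ⟨C, hC, h⟩
  obtain ⟨w, r, hw, hr, hwr, F, hF⟩ := hε.eq_multiDeriv
  choose ρ hρ hερ using hε.eq_add
  set ρ' : (Fin n → ℕ) → V n → Cl n := fun m => if m ∈ F then ρ m else multiDeriv m r with hρ'
  obtain ⟨δ, hδ, A, hA, s, hs, h⟩ := exists_tame_multiDeriv_mul hr hc
  have hF' : ∀ m ∉ F, Tame Λ (ball 0 δ) (fun y => ρ' m y * c m) (s m) A := fun m hm => by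
    simp only [hρ', hm, if_false]; exact h m
  obtain ⟨h1, h2⟩ := CliffordCylinder.tameAt_tsum (f := fun m y => ρ' m y * c m) (fun m => by
    refine TameAt.mul_right ?_ _
    by_cases hm : m ∈ F
    · simp only [hρ', hm, if_true]; exact hρ m
    · simp only [hρ', hm, if_false]; exact hr.multiDeriv m) hδ hA hs F hF'
  obtain ⟨s', A', hA', hreg⟩ := T.tame_regularPart hR hg
  refine ⟨_, (hreg.tameAt isOpen_ball hA' (mem_ball_self (by linarith))).sub h1, ?_⟩
  have hall : ∀ᶠ x in 𝓝[≠] (0 : V n), ∀ m, ε m x = multiDeriv m T.K x + ρ' m x := by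
    have h3 : ∀ᶠ x in 𝓝[≠] (0 : V n), ∀ m ∈ F, ε m x = multiDeriv m T.K x + ρ m x :=
      (eventually_all_finset F).2 fun m _ => hερ m
    filter_upwards [h3, self_mem_nhdsWithin, nhdsWithin_le_nhds hr.eventually] with x hx hx0 hrx m
    by_cases hm : m ∈ F
    · simp only [hρ', hm, if_true, hx m hm]
    · simp only [hρ', hm, if_false, hF m hm]
      rw [funext hwr]
      refine multiDeriv_add ?_ hrx m
      simpa using T.tameAt_shift (x := x) (v := 0) (by simpa using hx0)
  filter_upwards [hall, nhdsWithin_le_nhds h2, self_mem_nhdsWithin,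
    nhdsWithin_le_nhds (ball_mem_nhds (0 : V n) (half_pos hR))] with x hx hsum hx0 hxR
  have h3 := T.hasSum_laurent hR hg (norm_pos_iff.2 hx0) (by simpa using hxR)
  have h4 := h3.add hsum.hasSum
  have h5 : (fun m => ε m x * c m) = fun m => multiDeriv m T.K x * c m + ρ' m x * c m :=
    funext fun m => by rw [hx m, add_mul]
  rw [h5, h4.tsum_eq]
  abel

/-- Global Laurent expansions of quasi-periodic null solutions. -/
lemma EpsFamily.exists_laurent {T : FundSol Λ} (hω : LinearIndependent ℝ ω)
    (hε : EpsFamily T.toKernel ω l S ε) {O : Set (V n)} (hO : IsOpen O)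
    (hOL : ∀ x ∈ O, ∀ μ, x + latPt ω μ ∈ O) {g : V n → Cl n}
    (hg : ∀ x ∈ O, x ∉ lattice ω → TameAt Λ g x)
    (hq : ∀ x ∈ O, x ∉ lattice ω → ∀ μ, g (x + latPt ω μ) = sgn l μ • g x)
    {R : ℝ} (hR : 0 < R) (hgR : ∀ x, 0 < ‖x‖ → ‖x‖ < R → TameAt Λ g x)
    (hS : ∀ x ∈ O, x ∉ lattice ω → x ∈ S → T.laurentCoeff hR g 0 = 0) :
    ∃ (c : (Fin n → ℕ) → Cl n) (Φ : V n → Cl n), (∀ x ∈ O, TameAt Λ Φ x) ∧ (∀ x ∈ O, ∀ μ, Φ (x + latPt ω μ) = sgn l μ • Φ x) ∧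
      HasSumLocallyUniformlyOn (fun m x => ε m x * c m) (fun x => g x - Φ x)
        (O \ lattice ω) := by
  have hn : 0 < n := by have := T.add_eq; have := T.one_le; omega
  have : Nonempty (Fin n) := ⟨⟨0, hn⟩⟩
  have hc : ∀ r : ℝ, 0 < r → ∃ C : ℝ, 0 ≤ C ∧ ∀ m,
      ‖T.laurentCoeff hR g m‖ ≤ C * r ^ (∑ a, m a) * ((∑ a, m a)! : ℝ)⁻¹ := fun r hr => by
    obtain ⟨C, hC, -, h⟩ := T.exists_norm_laurentCoeff_le hR hgR hr
    exact ⟨C, hC, h⟩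
  set c := T.laurentCoeff hR g with hcdef
  set h : V n → Cl n := fun x => g x - ∑' m, ε m x * c m with hh
  have htame : ∀ x ∈ O, x ∉ lattice ω → TameAt Λ h x := fun x hx hxL =>
    (hg x hx hxL).sub (hε.tameAt_tsum hc hxL (hS x hx hxL)).1
  have hquasi : ∀ x ∈ O, x ∉ lattice ω → ∀ μ, h (x + latPt ω μ) = sgn l μ • h x := by
    intro x hx hxL μ
    simp only [hh, hq x hx hxL μ, smul_sub]
    congr 1
    rw [← tsum_const_smul'']
    refine tsum_congr fun m => ?_
    by_cases hmc : m = 0 → x ∉ S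
    · rw [hε.quasi m x hxL hmc μ, smul_mul_assoc]
    · push Not at hmc
      simp only [hmc.1, hS x hx hxL hmc.2, mul_zero, smul_zero]
  obtain ⟨ψ, hψ, hψh⟩ := hε.exists_regular hR hgR
  have hpunct : ∀ x ∈ O, ∀ᶠ y in 𝓝[≠] x, y ∈ O ∧ y ∉ lattice ω := by
    intro x hx
    have h1 : ∀ᶠ y in 𝓝[≠] x, y ∈ O := nhdsWithin_le_nhds (hO.mem_nhds hx)
    refine h1.and ?_
    by_cases hxL : x ∈ lattice ω
    · obtain ⟨δ, hδ, hd⟩ := eventually_notMem_lattice_zero hω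
      filter_upwards [self_mem_nhdsWithin, nhdsWithin_le_nhds (ball_mem_nhds x hδ)] with y hy hyx hL
      exact hd (y - x) (by rwa [← dist_eq_norm]) (sub_ne_zero.2 hy) (sub_mem hL hxL)
    · exact nhdsWithin_le_nhds (eventually_notMem_lattice hω hxL)
  obtain ⟨Φ, hΦ, hΦh⟩ := exists_extension (Λ := Λ) (h := h) (O := O) fun x hx => by
    by_cases hxL : x ∈ lattice ω
    -- At a lattice point the continuation is the translate, up to sign, of the one at the origin.
    · obtain ⟨μ, rfl⟩ := (mem_lattice_iff ω).1 hxL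
      have h0 : latPt ω μ + latPt ω (-μ) = 0 := by rw [latPt_neg]; abel
      refine ⟨fun y => sgn l μ • ψ (y + latPt ω (-μ)), (TameAt.comp_add_right
        (by rwa [h0])).const_smul _, ?_⟩
      have h1 : Tendsto (fun y => y + latPt ω (-μ)) (𝓝[≠] (latPt ω μ)) (𝓝[≠] 0) := by
        refine tendsto_nhdsWithin_of_tendsto_nhds_of_eventually_within _ ?_ ?_
        · rw [← h0]
          exact ((continuous_id.add continuous_const).tendsto _).mono_left nhdsWithin_le_nhds
        · filter_upwards [self_mem_nhdsWithin] with y hy hy'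
          apply hy
          rw [Set.mem_singleton_iff] at hy' ⊢
          rw [← sub_eq_zero, ← hy', latPt_neg]
          abel
      filter_upwards [h1.eventually hψh, hpunct _ hx] with y hy hyO
      rw [← hy]
      have h2 := hquasi y hyO.1 hyO.2 (-μ)
      show h y = sgn l μ • h (y + latPt ω (-μ))
      rw [h2, sgn_neg, smul_smul, sgn_mul_self, one_smul]
    · exact ⟨h, htame x hx hxL, EventuallyEq.rfl⟩
  refine ⟨c, Φ, fun x hx => (hΦ x hx).1, fun x hx μ => ?_, ?_⟩
  -- Quasi-periodicity extends to the lattice points by continuity.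
  · have h1 : Tendsto (fun y => Φ (y + latPt ω μ)) (𝓝[≠] x) (𝓝 (Φ (x + latPt ω μ))) := by
      have h2 : ContinuousAt Φ (x + latPt ω μ) := (hΦ _ (hOL x hx μ)).1.contDiffAt.continuousAt
      exact (h2.comp (f := fun y => y + latPt ω μ) (by fun_prop)).tendsto.mono_left
        nhdsWithin_le_nhds
    have h2 : Tendsto (fun y => sgn l μ • Φ y) (𝓝[≠] x) (𝓝 (sgn l μ • Φ x)) :=
      ((hΦ x hx).1.contDiffAt.continuousAt.tendsto.mono_left nhdsWithin_le_nhds).const_smul _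
    refine tendsto_nhds_unique_of_eventuallyEq h1 h2 ?_
    filter_upwards [hpunct x hx] with y hy
    have h3 : y + latPt ω μ ∉ lattice ω := by rw [add_latPt_mem_iff]; exact hy.2
    rw [hΦh y (htame y hy.1 hy.2), hΦh _ (htame _ (hOL y hy.1 μ) h3), hquasi y hy.1 hy.2]
  · refine hasSumLocallyUniformlyOn_of_of_forall_exists_nhds fun x hx => ?_
    obtain ⟨t, ht, hs⟩ := (hε.tameAt_tsum hc hx.2 (hS x hx.1 hx.2)).2
    refine ⟨t ∩ (O \ lattice ω), inter_mem (nhdsWithin_le_nhds ht) self_mem_nhdsWithin,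
      (hs.mono Set.inter_subset_left).congr_right fun y hy => ?_⟩
    simp only [hΦh y (htame y hy.2.1 hy.2.2), hh]
    abel

end Laurent

end CliffordCylinder

open scoped Topology
namespace CliffordCylinder
open Metric Filter MeasureTheory

/-! ### Residues on the torus -/

section Residue

variable {n j : ℕ} {Λ : DiffOp n j}

/-- A divergence form of the differential operator. -/
structure Flux (Λ : DiffOp n j) where
  /-- The flux of a function. -/
  flux : (V n → Cl n) → Fin n → V n → Cl n
  congr : ∀ {f g : V n → Cl n} {x : V n} (i : Fin n), f =ᶠ[𝓝 x] g → flux f i x = flux g i x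
  comp_add : ∀ (f : V n → Cl n) (v x : V n) (i : Fin n),
    flux (fun y => f (y + v)) i x = flux f i (x + v)
  smooth : ∀ {f : V n → Cl n} {x : V n} (i : Fin n), ContDiffAt ℝ ((⊤ : ℕ∞) : WithTop ℕ∞) f x →
    ContDiffAt ℝ ((⊤ : ℕ∞) : WithTop ℕ∞) (flux f i) x
  div : ∀ {f : V n → Cl n} {x : V n}, ContDiffAt ℝ ((⊤ : ℕ∞) : WithTop ℕ∞) f x →
    Λ.app f x = ∑ i, partialDeriv i (flux f i) x

/-- The image of Lebesgue measure under a linear isomorphism is a positive multiple of Lebesgue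
measure. Since only vanishing matters, the determinant is not needed. -/
lemma integral_eq_zero_of_integral_comp (L : (Fin n → ℝ) ≃L[ℝ] V n) {ψ : V n → Cl n}
    (h : ∫ t, ψ (L t) = 0) : ∫ x, ψ x = 0 := by
  have h1 := (L.toHomeomorph.measurableEmbedding).integral_map (μ := volume) ψ
  have h2 : Measure.IsAddHaarMeasure (Measure.map L (volume : Measure (Fin n → ℝ))) :=
    ContinuousLinearEquiv.isAddHaarMeasure_map L volume
  have h3 := Measure.isAddLeftInvariant_eq_smul (Measure.map L (volume : Measure (Fin n → ℝ))) volume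
  have h4 := Measure.addHaarScalarFactor_pos_of_isAddHaarMeasure
    (Measure.map L (volume : Measure (Fin n → ℝ))) (volume : Measure (V n))
  change ∫ y, ψ y ∂(Measure.map L volume) = ∫ t, ψ (L t) at h1
  rw [h, h3, integral_smul_nnreal_measure] at h1
  exact (smul_eq_zero.1 h1).resolve_left h4.ne'

variable {ω : Fin n → V n}

lemma exists_lattice_coordinates (hω : LinearIndependent ℝ ω) :
    ∃ L : (Fin n → ℝ) ≃L[ℝ] V n, ∀ i, L (Pi.single i 1) = ω i := by
  rcases isEmpty_or_nonempty (Fin n) with h | h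
  · have : n = 0 := by
      by_contra hn
      exact h.false ⟨0, by omega⟩
    subst this
    exact ⟨(EuclideanSpace.equiv (Fin 0) ℝ).symm, fun i => i.elim0⟩
  · let B := basisOfLinearIndependentOfCardEqFinrank hω (by simp)
    refine ⟨B.equivFun.symm.toContinuousLinearEquiv, fun i => ?_⟩
    show B.equivFun.symm (Pi.single i 1) = ω i
    rw [Module.Basis.equivFun_symm_apply, Finset.sum_eq_single i]
    · simp [B]
    · intro b _ hb; simp [hb]
    · simp

lemma lattice_coordinates {L : (Fin n → ℝ) ≃L[ℝ] V n} (hL : ∀ i, L (Pi.single i 1) = ω i)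
    {t : Fin n → ℝ} (ht : L t ∈ lattice ω) (h : ∀ i, |t i| ≤ 1 / 2) : t = 0 := by
  obtain ⟨m, hm⟩ := (mem_lattice_iff ω).1 ht
  have h1 : L (fun i => (m i : ℝ)) = latPt ω m := by
    have h2 : (fun i => (m i : ℝ)) = ∑ i, (m i : ℝ) • (Pi.single i 1 : Fin n → ℝ) := by
      funext a; simp [Finset.sum_apply, Pi.single_apply]
    rw [h2, map_sum]
    simp only [Int.cast_smul_eq_zsmul, map_zsmul, hL, latPt]
  rw [← h1] at hm
  have h3 := L.injective hm
  funext i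
  have h4 := h i
  rw [← h3] at h4 ⊢
  have h5 : |m i| < 1 := by
    have : |(m i : ℝ)| < 1 := by linarith
    exact_mod_cast this
  simp [Int.abs_lt_one_iff.1 h5]

/-- The integral of the operator over a cell of the torus vanishes. -/
lemma Flux.integral_eq_zero (Fl : Flux Λ) (hn : 1 ≤ n) {L : (Fin n → ℝ) ≃L[ℝ] V n}
    (hL : ∀ i, L (Pi.single i 1) = ω i) {F g : V n → Cl n} {ρ : ℝ}
    (hρ : ∀ x, ‖x‖ ≤ ρ → ∀ i, |L.symm x i| < 1 / 2) (hρ0 : 0 < ρ)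
    (hF : ∀ x, (x ∈ lattice ω → x = 0) → ContDiffAt ℝ ((⊤ : ℕ∞) : WithTop ℕ∞) F x)
    (hFg : ∀ x, ρ < ‖x‖ → F =ᶠ[𝓝 x] g)
    (hg0 : ∀ x ∉ lattice ω, Λ.app g x = 0)
    (hg : ∀ x ∉ lattice ω, ∀ i, (fun y => g (y + ω i)) =ᶠ[𝓝 x] g) :
    ∫ x in closedBall (0 : V n) ρ, Λ.app F x = 0 := by
  set I : Set (Fin n → ℝ) := Set.Icc (fun _ => -(1 / 2)) (fun _ => 1 / 2) with hI
  have hIabs : ∀ t, t ∈ I ↔ ∀ i, |t i| ≤ 1 / 2 := fun t =>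
    ⟨fun h i => abs_le.2 ⟨h.1 i, h.2 i⟩, fun h => ⟨fun i => (abs_le.1 (h i)).1,
      fun i => (abs_le.1 (h i)).2⟩⟩
  have hIL : ∀ t ∈ I, L t ∈ lattice ω → L t = 0 := fun t ht h => by
    rw [lattice_coordinates hL h ((hIabs t).1 ht), map_zero]
  -- The components of the standard basis with respect to the `ω k`: they rewrite the flux in
  -- lattice coordinates with the same divergence.
  set a : Fin n → Fin n → ℝ := fun k i => L.symm (stdVec i) k with ha
  have hsum : ∀ i, ∑ k, a k i • ω k = (stdVec i : V n) := fun i => by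
    have h2 : L.symm (stdVec i) = ∑ k, a k i • (Pi.single k 1 : Fin n → ℝ) := by
      funext b; simp [ha, Finset.sum_apply, Pi.single_apply]
    rw [← L.apply_symm_apply (stdVec i), h2, map_sum]
    simp only [map_smul, hL]
  have hsm : ∀ t ∈ I, ∀ i, ContDiffAt ℝ ((⊤ : ℕ∞) : WithTop ℕ∞) (Fl.flux F i) (L t) :=
    fun t ht i => Fl.smooth i (hF _ (hIL t ht))
  have hdiv : ∀ t ∈ I, ∑ k, (∑ i, a k i • (fderiv ℝ (Fl.flux F i) (L t)).comp
      (L : (Fin n → ℝ) →L[ℝ] V n)) (Pi.single k 1) = Λ.app F (L t) := by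
    intro t ht
    rw [Fl.div (hF _ (hIL t ht))]
    simp only [_root_.sum_apply, _root_.smul_apply,
      ContinuousLinearMap.comp_apply, ContinuousLinearEquiv.coe_coe, hL]
    rw [Finset.sum_comm]
    refine Finset.sum_congr rfl fun i _ => ?_
    rw [partialDeriv, ← hsum i, map_sum]
    simp only [map_smul]
  have hcube := integral_divergence_eq_zero hn (a := fun _ => -(1 / 2)) (b := fun _ => 1 / 2)
    (fun _ => by norm_num) (fun k t => ∑ i, a k i • Fl.flux F i (L t))
    (fun k t => ∑ i, a k i • (fderiv ℝ (Fl.flux F i) (L t)).comp (L : (Fin n → ℝ) →L[ℝ] V n))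
    (fun t ht k => HasFDerivAt.fun_sum fun i _ => HasFDerivAt.fun_const_smul
      (HasFDerivAt.comp t ((hsm t ht i).differentiableAt (by simp)).hasFDerivAt
        L.hasFDerivAt) _) ?_ ?_
  · rw [setIntegral_congr_fun measurableSet_Icc hdiv] at hcube
    have h1 : ∫ t, (closedBall (0 : V n) ρ).indicator (Λ.app F) (L t) = 0 := by
      rw [← setIntegral_eq_integral_of_forall_compl_eq_zero (s := I), ← hcube]
      · refine setIntegral_congr_fun measurableSet_Icc fun t ht => ?_
        by_cases hb : L t ∈ closedBall (0 : V n) ρ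
        · simp [hb]
        · simp only [Set.indicator_of_notMem hb]
          rw [mem_closedBall_zero_iff, not_le] at hb
          rw [DiffOp.app_congr (hFg _ hb), hg0]
          intro hmem
          rw [hIL t ht hmem, norm_zero] at hb
          linarith
      · intro t ht
        refine Set.indicator_of_notMem (fun hb => ht ?_) _
        rw [mem_closedBall_zero_iff] at hb
        exact (hIabs t).2 fun i => by simpa using (hρ _ hb i).le
    rw [← integral_indicator measurableSet_closedBall]
    exact integral_eq_zero_of_integral_comp L h1
  · refine ContinuousOn.integrableOn_Icc fun t ht => ContinuousAt.continuousWithinAt ?_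
    refine tendsto_finsetSum _ fun k _ => ?_
    have hc : ∀ i, ContinuousAt (fun t => (fderiv ℝ (Fl.flux F i) (L t)) (ω k)) t := fun i => by
      have h1 : ContinuousAt (fderiv ℝ (Fl.flux F i)) (L t) :=
        ((hsm t ht i).fderiv_right (m := 0) (by simp)).continuousAt
      exact (h1.comp L.continuous.continuousAt).clm_apply continuousAt_const
    simp only [_root_.sum_apply, _root_.smul_apply,
      ContinuousLinearMap.comp_apply, ContinuousLinearEquiv.coe_coe, hL]
    exact tendsto_finsetSum _ fun i _ => (hc i).tendsto.const_smul _
  -- The faces of the cell lie outside the ball of radius `ρ`, where `F` agrees with the periodic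
  -- function `g`.
  · intro k s hs t ht hsk htk hst
    have hts : t = s + Pi.single k 1 := by
      funext q
      by_cases hq : q = k
      · subst hq; simp [hsk, htk]; norm_num
      · simp [hq, hst q hq]
    have hLts : L t = L s + ω k := by rw [hts, map_add, hL]
    have hfar : ∀ t : Fin n → ℝ, |t k| = 1 / 2 → ρ < ‖L t‖ := fun t h => by
      by_contra hlt
      have := hρ _ (not_lt.1 hlt) k
      simp [h] at this
    have hs2 : |s k| = 1 / 2 := by rw [hsk]; norm_num
    have ht2 : |t k| = 1 / 2 := by rw [htk]; norm_num
    have hsL : L s ∉ lattice ω := fun h => by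
      have h1 := hfar s hs2
      rw [hIL s hs h, norm_zero] at h1
      linarith
    refine Finset.sum_congr rfl fun i _ => ?_
    congr 1
    rw [Fl.congr i (hFg _ (hfar s hs2)), Fl.congr i (hFg _ (hfar t ht2)), hLts, ← Fl.comp_add,
      Fl.congr i (hg _ hsL k)]

/-- This coefficient is an integral of `Λ` of the cut-off function over a small ball. Continued by
`g` outside, that function is smooth on the period cell and periodic across its faces, so the
divergence theorem gives zero. -/
lemma laurentCoeff_zero_eq_zero (T : FundSol Λ) (Fl : Flux Λ) (hω : LinearIndependent ℝ ω)
    {g : V n → Cl n} (hg : ∀ x ∉ lattice ω, TameAt Λ g x)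
    (hq : ∀ x ∉ lattice ω, ∀ i, g (x + ω i) = g x) :
    ∃ R₀ > 0, ∀ R (hR : 0 < R), R ≤ R₀ → T.laurentCoeff hR g 0 = 0 := by
  have hn : 1 ≤ n := by have := T.add_eq; have := T.one_le; omega
  obtain ⟨L, hL⟩ := exists_lattice_coordinates hω
  obtain ⟨δ, hδ, hd⟩ := eventually_notMem_lattice_zero hω
  have h1 : ∀ᶠ x in 𝓝 (0 : V n), ∀ i, |L.symm x i| < 1 / 2 := by
    refine eventually_all.2 fun i => ?_
    have : Tendsto (fun x => |L.symm x i|) (𝓝 0) (𝓝 0) := by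
      have hc : Continuous fun x => |L.symm x i| := by fun_prop
      simpa using hc.tendsto 0
    exact this.eventually_lt_const (by norm_num)
  obtain ⟨η, hη, hh⟩ := Metric.eventually_nhds_iff_ball.1 h1
  refine ⟨min δ η, lt_min hδ hη, fun R hR hRle => ?_⟩
  have hRδ : R ≤ δ := hRle.trans (min_le_left _ _)
  have hRη : R ≤ η := hRle.trans (min_le_right _ _)
  have hgR : ∀ x, 0 < ‖x‖ → ‖x‖ < R → TameAt Λ g x := fun x h0 hx =>
    hg x (hd x (hx.trans_le hRδ) (norm_pos_iff.1 h0))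
  classical
  -- The cutoff also vanishes far out and is therefore used only inside radius `R / 2`; it equals
  -- one from `R / 4` on, so the two pieces fit smoothly.
  set F : V n → Cl n := fun y => if ‖y‖ < R / 2 then cutoff hR 0 y • g y else g y with hF
  have hnear : ∀ x, ‖x‖ < R / 2 → F =ᶠ[𝓝 x] fun y => cutoff hR 0 y • g y := fun x hx => by
    filter_upwards [(isOpen_lt continuous_norm continuous_const).mem_nhds hx] with y hy
    exact if_pos hy
  have hfar : ∀ x, R / 4 < ‖x‖ → F =ᶠ[𝓝 x] g := fun x hx => by
    filter_upwards [(isOpen_lt continuous_const continuous_norm).mem_nhds hx] with y hy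
    by_cases hy2 : ‖y‖ < R / 2
    · simp only [hF, hy2, if_true]
      rw [cutoff_eq_one hR 0 (by simpa using le_of_lt hy) hy2.le, one_smul]
    · simp only [hF, hy2, if_false]
  rw [FundSol.laurentCoeff_zero, setIntegral_congr_fun measurableSet_closedBall
    (g := Λ.app F) (fun y hy => (DiffOp.app_congr (hnear y (by
      rw [mem_closedBall_zero_iff] at hy; linarith))).symm),
    Fl.integral_eq_zero hn hL (g := g) (fun x hx => hh x (by
      rw [mem_ball_zero_iff]; linarith)) (by linarith) ?_ hfar (fun x hx => (hg x hx).null) ?_,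
    smul_zero]
  · intro x hx
    rcases lt_or_ge ‖x‖ (R / 2) with h | h
    · exact (contDiff_cutoff_smul hR 0 hgR).contDiffAt.congr_of_eventuallyEq (hnear x h)
    · refine (hg x fun hL => ?_).contDiffAt.congr_of_eventuallyEq (hfar x (by linarith))
      rw [hx hL, norm_zero] at h
      linarith
  · intro x hx i
    filter_upwards [eventually_notMem_lattice hω hx] with y hy using hq y hy i

end Residue

end CliffordCylinder

open scoped Topology
namespace CliffordCylinder
open Metric Filter MeasureTheory

/-! ### Laurent expansions of sections -/

section Sections

variable {n k j l : ℕ} {Λ : DiffOp n j} {T : FundSol Λ} {ω : Fin k → V n} {S : Set (V n)}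
  {ε : (Fin n → ℕ) → V n → Cl n}

lemma proj_add_latPt (x : V n) (μ : Fin k → ℤ) : proj ω (x + latPt ω μ) = proj ω x := by
  rw [proj, proj, QuotientAddGroup.mk_add,
    (QuotientAddGroup.eq_zero_iff (latPt ω μ)).2 (latPt_mem_lattice ω μ), add_zero]

lemma proj_add_eq_iff (x a : V n) : proj ω (x + a) = proj ω a ↔ x ∈ lattice ω := by
  rw [proj, proj, QuotientAddGroup.mk_add, add_eq_right, QuotientAddGroup.eq_zero_iff]

lemma tendsto_sub_of_tameAt {Φ : V n → Cl n} (h : TameAt Λ Φ 0) (a : V n) :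
    Tendsto (fun x => Φ (x - a)) (𝓝[≠] a) (𝓝 (Φ 0)) := by
  have h1 : Tendsto (fun x : V n => x - a) (𝓝 a) (𝓝 0) :=
    (continuous_id.sub continuous_const).tendsto' _ _ (sub_self a)
  exact (h.contDiffAt.continuousAt.tendsto.comp h1).mono_left nhdsWithin_le_nhds

lemma laurentOn_of_hasSum {c : (Fin n → ℕ) → Cl n} {Φ f : V n → Cl n} {a : V n}
    {O S' : Set (V n)}
    (h : HasSumLocallyUniformlyOn (fun m x => ε m x * c m) (fun x => f (x + a) - Φ x) O)
    (hS' : ∀ x ∈ S', x - a ∈ O) : LaurentOn ε a c Φ f S' := by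
  have h1 := h.comp (fun x => x - a) hS' (continuous_id.sub continuous_const).continuousOn
  have h2 : (fun x => f (x + a) - Φ x) ∘ (fun x => x - a) = fun x => f x - Φ (x - a) := by
    funext x; simp
  rw [h2] at h1
  exact h1

/-- The radius is taken so small that the ball contains neither a nonzero lattice point nor a point
of `S`; as `S` is invariant under the lattice, the whole preimage of `N'` avoids it. -/
lemma EpsFamily.laurent_local (hω : LinearIndependent ℝ ω) (hε : EpsFamily T.toKernel ω l S ε)
    (a : V n) {U' : Set (Cylinder ω)} {f : V n → Cl n} (hU' : IsOpen U') (ha : proj ω a ∈ U')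
    (hf : ∀ x, proj ω x ∈ U' \ {proj ω a} → TameAt Λ f x)
    (hq : IsSection ω l (U' \ {proj ω a}) f) :
    ∃ (c : (Fin n → ℕ) → Cl n) (N' : Set (Cylinder ω)) (Φ : V n → Cl n),
      IsOpen N' ∧ 0 ∈ N' ∧ (∀ y' ∈ N', y' + proj ω a ∈ U') ∧
      (IsSection ω l N' Φ ∧ ∀ x, proj ω x ∈ N' → TameAt Λ Φ x) ∧
      Tendsto (fun x => Φ (x - a)) (𝓝[≠] a) (𝓝 (Φ 0)) ∧
      LaurentOn ε a c Φ f {x | proj ω (x - a) ∈ N' \ {0}} := by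
  obtain ⟨δ, hδ, hd⟩ := eventually_notMem_lattice_zero hω
  have hcont : Continuous fun x : V n => proj ω (x + a) :=
    QuotientAddGroup.continuous_mk.comp (continuous_id.add continuous_const)
  have h1 : ∀ᶠ x in 𝓝 (0 : V n), proj ω (x + a) ∈ U' ∧ x ∉ S := by
    refine Eventually.and ?_ hε.isolated
    exact hcont.continuousAt.eventually_mem (hU'.mem_nhds (by simpa using ha))
  obtain ⟨η, hη, hh⟩ := Metric.eventually_nhds_iff_ball.1 h1
  set R := min δ η with hRdef
  have hR : 0 < R := lt_min hδ hη
  set N' : Set (Cylinder ω) := proj ω '' ball 0 R with hN'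
  have hN'o : IsOpen N' := QuotientAddGroup.isOpenMap_coe _ isOpen_ball
  have hbase : ∀ x, proj ω x ∈ N' → ∃ y ∈ ball (0 : V n) R, ∃ μ, x = y + latPt ω μ := by
    rintro x ⟨y, hy, hxy⟩
    obtain ⟨μ, hμ⟩ := (mem_lattice_iff ω).1 (QuotientAddGroup.eq.1 hxy)
    exact ⟨y, hy, μ, by rw [hμ]; abel⟩
  have hb : ∀ y ∈ ball (0 : V n) R, proj ω (y + a) ∈ U' ∧ y ∉ S := fun y hy =>
    hh y (ball_subset_ball (min_le_right _ _) hy)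
  have hU : ∀ x, proj ω x ∈ N' → proj ω (x + a) ∈ U' ∧ x ∉ S := by
    intro x hx
    obtain ⟨y, hy, μ, rfl⟩ := hbase x hx
    rw [hε.add_mem, add_right_comm, proj_add_latPt]
    exact hb y hy
  have hmem : ∀ x, proj ω x ∈ N' → x ∉ lattice ω → proj ω (x + a) ∈ U' \ {proj ω a} :=
    fun x hx hxL => ⟨(hU x hx).1, fun h => hxL ((proj_add_eq_iff x a).1 h)⟩
  have h0 : proj ω (0 : V n) ∈ N' := ⟨0, mem_ball_self hR, rfl⟩
  have htame : ∀ x, proj ω x ∈ N' → x ∉ lattice ω → TameAt Λ (fun x => f (x + a)) x :=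
    fun x hx hxL => (hf _ (hmem x hx hxL)).comp_add_right
  obtain ⟨c, Φ, hΦ, hΦq, hsum⟩ := hε.exists_laurent hω (O := proj ω ⁻¹' N')
    (hN'o.preimage QuotientAddGroup.continuous_mk)
    (fun x hx μ => by rwa [Set.mem_preimage, proj_add_latPt]) htame
    (fun x hx hxL μ => by
      have := hq (x + a) (hmem x hx hxL) μ
      rwa [add_right_comm] at this) hR
    (fun x hx0 hxR => htame x ⟨x, by simpa using hxR, rfl⟩
      (hd x (hxR.trans_le (min_le_left _ _)) (norm_pos_iff.1 hx0)))
    (fun x hx _ hxS => absurd hxS (hU x hx).2)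
  refine ⟨c, N', Φ, hN'o, h0, ?_, ⟨hΦq, hΦ⟩, tendsto_sub_of_tameAt (hΦ 0 h0) a,
    laurentOn_of_hasSum hsum fun x hx => ⟨hx.1, fun h => hx.2 ?_⟩⟩
  · rintro _ ⟨y, hy, rfl⟩
    exact (hb y hy).1
  · exact (QuotientAddGroup.eq_zero_iff _).2 h

/-- Here `S` cannot be avoided by shrinking the domain. It does no harm if it is empty or if `c_0`
vanishes, for which the radius of the punctured ball has to be small. -/
lemma EpsFamily.laurent_global (hω : LinearIndependent ℝ ω) (hε : EpsFamily T.toKernel ω l S ε)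
    (a : V n) {f : V n → Cl n} (hf : ∀ x, proj ω x ∈ ({proj ω a}ᶜ : Set (Cylinder ω)) → TameAt Λ f x)
    (hq : IsSection ω l {proj ω a}ᶜ f)
    (hS : S = ∅ ∨ ∃ R₀ > 0, ∀ R (hR : 0 < R), R ≤ R₀ →
      T.laurentCoeff hR (fun x => f (x + a)) 0 = 0) :
    ∃ (c : (Fin n → ℕ) → Cl n) (Φ : V n → Cl n),
      (IsSection ω l Set.univ Φ ∧ ∀ x, TameAt Λ Φ x) ∧
      Tendsto (fun x => Φ (x - a)) (𝓝[≠] a) (𝓝 (Φ 0)) ∧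
      LaurentOn ε a c Φ f {x | proj ω x ≠ proj ω a} := by
  obtain ⟨δ, hδ, hd⟩ := eventually_notMem_lattice_zero hω
  obtain ⟨R, hR, hRδ, hRS⟩ : ∃ (R : ℝ) (hR : 0 < R), R ≤ δ ∧
      (S = ∅ ∨ T.laurentCoeff hR (fun x => f (x + a)) 0 = 0) := by
    rcases hS with hS | ⟨R₀, hR₀, h⟩
    · exact ⟨δ, hδ, le_rfl, Or.inl hS⟩
    · exact ⟨min δ R₀, lt_min hδ hR₀, min_le_left _ _, Or.inr (h _ _ (min_le_right _ _))⟩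
  have hmem : ∀ x ∉ lattice ω, proj ω (x + a) ∈ ({proj ω a}ᶜ : Set (Cylinder ω)) :=
    fun x hxL h => hxL ((proj_add_eq_iff x a).1 h)
  have htame : ∀ x ∉ lattice ω, TameAt Λ (fun x => f (x + a)) x :=
    fun x hxL => (hf _ (hmem x hxL)).comp_add_right
  obtain ⟨c, Φ, hΦ, hΦq, hsum⟩ := hε.exists_laurent hω (O := Set.univ) isOpen_univ
    (fun x _ μ => trivial) (fun x _ hx => htame x hx)
    (fun x _ hxL μ => by
      have := hq (x + a) (hmem x hxL) μ
      rwa [add_right_comm] at this) hR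
    (fun x hx0 hxR => htame x (hd x (hxR.trans_le hRδ) (norm_pos_iff.1 hx0)))
    (fun x _ _ hxS => hRS.resolve_left (by rintro rfl; exact hxS))
  refine ⟨c, Φ, ⟨fun x _ => hΦq x trivial, fun x => hΦ x trivial⟩,
    tendsto_sub_of_tameAt (hΦ 0 trivial) a,
    laurentOn_of_hasSum hsum fun x hx => ⟨trivial, fun h => hx ?_⟩⟩
  have := (proj_add_eq_iff (x - a) a).2 h
  rwa [sub_add_cancel] at this

end Sections

end CliffordCylinder

open scoped Topology
namespace CliffordCylinder
open Metric Filter MeasureTheory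

/-! ### Regularity of null solutions -/

section Regularity

variable {n j : ℕ} {Λ : DiffOp n j}

/-- The density is supported in a shell, so near the centre `f` is a potential off its density. -/
lemma Kernel.tameAt_of_representation (T : Kernel Λ) {κ R : ℝ} (hκ : κ ≠ 0) (hR : 0 < R)
    {f g : V n → Cl n} (hg : Continuous g) (hg1 : ∀ y, ‖y‖ < R / 2 → g y = 0)
    (hg2 : ∀ y, R < ‖y‖ → g y = 0)
    (h : ∀ x, ‖x‖ < R / 2 → κ • f x = ∫ y, T.K (x - y) * g y) : TameAt Λ f 0 := by
  obtain ⟨s, A, hA, ht⟩ := T.tame_potential (R := R / 2) (r := R / 4) (by linarith)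
    (isCompact_shell R) (fun y hy => by simpa using hy.2) hg
  refine ((ht.const_smul κ⁻¹).congr isOpen_ball fun x hx => ?_).tameAt isOpen_ball hA
    (mem_ball_self (by linarith))
  have h1 := h x (by rw [mem_ball_zero_iff] at hx; linarith)
  rw [setIntegral_eq_integral_of_forall_compl_eq_zero, ← h1, smul_smul, inv_mul_cancel₀ hκ,
    one_smul]
  intro y hy
  by_cases hy1 : ‖y‖ < R / 2
  · rw [hg1 y hy1, mul_zero]
  · rw [hg2 y, mul_zero]
    by_contra hlt
    exact hy ⟨by simpa using hlt, by simpa using hy1⟩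

/-- A smooth function which is one near the origin. -/
noncomputable def bump {n : ℕ} {R : ℝ} (hR : 0 < R) : ContDiffBump (0 : V n) :=
  ⟨R / 2, 3 * R / 4, by positivity, by linarith⟩

variable {R : ℝ} (hR : 0 < R)

lemma bump_eventually_one {y : V n} (hy : ‖y‖ < R / 2) : ∀ᶠ z in 𝓝 y, bump hR z = 1 := by
  filter_upwards [(isOpen_lt continuous_norm continuous_const).mem_nhds hy] with z hz
  exact ContDiffBump.one_of_mem_closedBall _ (by simpa using! le_of_lt hz)

lemma bump_eventually_zero {y : V n} (hy : 3 * R / 4 < ‖y‖) : ∀ᶠ z in 𝓝 y, bump hR z = 0 := by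
  filter_upwards [(isOpen_lt continuous_const continuous_norm).mem_nhds hy] with z hz
  exact ContDiffBump.zero_of_le_dist _ (by simpa using! le_of_lt hz)

lemma hasCompactSupport_bump_smul (f : V n → Cl n) :
    HasCompactSupport fun y => bump (n := n) hR y • f y := by
  refine HasCompactSupport.intro (isCompact_closedBall (0 : V n) R) fun y hy => ?_
  rw [mem_closedBall_zero_iff, not_le] at hy
  rw [(bump_eventually_zero hR (by linarith)).self_of_nhds, zero_smul]

end Regularity

/-! ### The Dirac operator -/

section Dirac

variable {n : ℕ}

/-- The Dirac operator. -/
noncomputable def diracOp (n : ℕ) : DiffOp n 1 where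
  op := ∑ i, (mulL (e i)).comp
    (ContinuousMultilinearMap.apply ℝ (fun _ : Fin 1 => V n) (Cl n) fun _ => stdVec i)
  op_mul T c := by
    simp [Finset.sum_mul, mul_assoc]

lemma diracOp_app (f : V n → Cl n) (x : V n) : (diracOp n).app f x = dirac f x := by
  simp [DiffOp.app, diracOp, dirac, partialDeriv, iteratedFDeriv_one_apply]

lemma diracOp_op (f : V n → Cl n) (x : V n) :
    (diracOp n).op (iteratedFDeriv ℝ 1 f x) = dirac f x := diracOp_app f x

lemma dirac_congr {f g : V n → Cl n} {x : V n} (h : f =ᶠ[𝓝 x] g) : dirac f x = dirac g x := by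
  simp only [dirac, partialDeriv, h.fderiv_eq]

lemma dirac_G {z : V n} (hz : z ≠ 0) : dirac G z = 0 := by
  have h := (rdirac_regG (c := 0) (x := z) (by have := norm_pos_iff.2 hz; positivity)).2
  rw [funext regG_zero] at h
  simpa using h

lemma analyticAt_G {z : V n} (hz : z ≠ 0) : AnalyticAt ℝ (G : V n → Cl n) z := by
  have h1 : ContDiffAt ℝ ⊤ (fun x : V n => (‖x‖ ^ n)⁻¹) z :=
    ((contDiffAt_norm ℝ hz).pow n).inv (pow_ne_zero _ (norm_ne_zero_iff.2 hz))
  exact (h1.smul (vecL (n := n)).contDiff.contDiffAt).analyticAt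

lemma G_neg (z : V n) : (G (-z) : Cl n) = -G z := by
  simp [G]

lemma G_smul {t : ℝ} (ht : 0 < t) (hn : 1 ≤ n) (z : V n) :
    (G (t • z) : Cl n) = (t ^ (n - 1))⁻¹ • G z := by
  obtain ⟨m, rfl⟩ : ∃ m, n = m + 1 := ⟨n - 1, by omega⟩
  simp only [G, norm_smul, Real.norm_eq_abs, abs_of_pos ht, vec, map_smul, smul_smul,
    Nat.add_sub_cancel]
  congr 1
  rw [mul_pow, mul_inv, pow_succ t m]
  field_simp

/-- The Cauchy kernel. -/
noncomputable def cauchyKernel (hn : 2 ≤ n) : FundSol (diracOp n) where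
  K := G
  N := n - 1
  one_le := by omega
  add_eq := by omega
  analytic z hz := analyticAt_G hz
  hom t ht z := G_smul ht (by omega) z
  null z hz := by rw [diracOp_op, dirac_G hz]
  κ := -poissonMass n
  κ_ne := neg_ne_zero.2 (poissonMass_pos (by omega)).ne'
  rep F hF hc x hx := by
    have h1 : (diracOp n).app F = dirac F := funext (diracOp_app F)
    rw [h1] at hx ⊢
    refine dirac_representation hn (hF.differentiable (by simp)) hc ?_ hx
    rw [← h1]
    exact DiffOp.continuous_app hF

/-- The divergence form of the Dirac operator. -/
noncomputable def diracFlux (n : ℕ) : Flux (diracOp n) where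
  flux f i x := e i * f x
  congr i h := by rw [h.self_of_nhds]
  comp_add f v x i := rfl
  smooth i hf := (mulL (e i)).contDiff.contDiffAt.comp _ hf
  div {f x} hf := by
    rw [diracOp_app, dirac]
    refine Finset.sum_congr rfl fun i _ => ?_
    have h := (mulL (e i)).hasFDerivAt.comp x (hf.differentiableAt (by simp)).hasFDerivAt
    exact (congrArg (fun L => L (stdVec i)) h.fderiv).symm

lemma dirac_smul {θ : V n → ℝ} {f : V n → Cl n} {x : V n} (hθ : DifferentiableAt ℝ θ x)
    (hf : DifferentiableAt ℝ f x) : dirac (fun y => θ y • f y) x =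
      (∑ i, fderiv ℝ θ x (stdVec i) • (e i * f x)) + θ x • dirac f x := by
  have h : fderiv ℝ (fun y => θ y • f y) x = θ x • fderiv ℝ f x + (fderiv ℝ θ x).smulRight (f x) :=
    fderiv_fun_smul hθ hf
  simp only [dirac, partialDeriv, h, Finset.smul_sum, ← Finset.sum_add_distrib]
  refine Finset.sum_congr rfl fun i _ => ?_
  simp [mul_add, add_comm]

/-- For a bump function `θ`, the Dirac operator of `θ f` involves only derivatives of `θ` and values
of `f`. It is therefore continuous although nothing is known about continuity of the derivative of
`f`, and the representation formula applies. -/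
lemma tameAt_of_monogenic_zero (hn : 2 ≤ n) {f : V n → Cl n}
    (hf : ∀ᶠ x in 𝓝 0, DifferentiableAt ℝ f x ∧ dirac f x = 0) : TameAt (diracOp n) f 0 := by
  obtain ⟨R, hR, hb⟩ := Metric.eventually_nhds_iff_ball.1 hf
  have hθ : ContDiff ℝ 1 (bump (n := n) hR) := ContDiffBump.contDiff _
  have hzero : ∀ {y : V n}, 3 * R / 4 < ‖y‖ →
      (fun y => bump (n := n) hR y • f y) =ᶠ[𝓝 y] fun _ => 0 := fun {y} hy => by
    filter_upwards [bump_eventually_zero hR hy] with z hz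
    rw [hz, zero_smul]
  have hone : ∀ {y : V n}, ‖y‖ < R / 2 →
      (fun y => bump (n := n) hR y • f y) =ᶠ[𝓝 y] f := fun {y} hy => by
    filter_upwards [bump_eventually_one hR hy] with z hz
    rw [hz, one_smul]
  have hball : ∀ {y : V n}, ‖y‖ < R → DifferentiableAt ℝ f y ∧ dirac f y = 0 := fun {y} hy =>
    hb y (by simpa using hy)
  have hdiff : Differentiable ℝ fun y => bump (n := n) hR y • f y := by
    intro y
    rcases lt_or_ge ‖y‖ R with hy | hy
    · exact ((hθ.differentiable one_ne_zero) y).smul (hball hy).1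
    · exact (differentiableAt_const (0 : Cl n)).congr_of_eventuallyEq (hzero (by linarith))
  have hcont : Continuous (dirac fun y => bump (n := n) hR y • f y) := by
    rw [continuous_iff_continuousAt]
    intro y
    rcases lt_or_ge ‖y‖ R with hy | hy
    · have h1 : dirac (fun y => bump (n := n) hR y • f y) =ᶠ[𝓝 y]
          fun y => ∑ i, fderiv ℝ (bump (n := n) hR) y (stdVec i) • (e i * f y) := by
        filter_upwards [(isOpen_lt continuous_norm continuous_const).mem_nhds hy] with z hz
        rw [dirac_smul ((hθ.differentiable one_ne_zero) z) (hball hz).1, (hball hz).2, smul_zero,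
          add_zero]
      refine ContinuousAt.congr ?_ h1.symm
      refine tendsto_finsetSum _ fun i _ => ContinuousAt.smul
        ((hθ.continuous_fderiv one_ne_zero).clm_apply continuous_const).continuousAt ?_
      exact (mulL (e i)).continuous.continuousAt.comp (hball hy).1.continuousAt
    · have h1 : dirac (fun y => bump (n := n) hR y • f y) =ᶠ[𝓝 y] fun _ => 0 := by
        have hy2 : 3 * R / 4 < ‖y‖ := by linarith
        filter_upwards [(isOpen_lt continuous_const continuous_norm).mem_nhds hy2] with z hz
        rw [dirac_congr (hzero hz)]
        simp [dirac, partialDeriv]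
      exact continuousAt_const.congr h1.symm
  have hnull : ∀ {y : V n}, ‖y‖ < R / 2 → dirac (fun y => bump (n := n) hR y • f y) y = 0 :=
    fun {y} hy => by rw [dirac_congr (hone hy), (hball (by linarith)).2]
  refine (cauchyKernel hn).tameAt_of_representation (κ := -poissonMass n) (R := R)
    (neg_ne_zero.2 (poissonMass_pos (by omega)).ne') hR hcont (fun y hy => hnull hy)
    (fun y hy => ?_) fun x hx => ?_
  · rw [dirac_congr (hzero (by linarith))]
    simp [dirac, partialDeriv]
  · rw [← (hone hx).self_of_nhds]
    refine dirac_representation hn hdiff (hasCompactSupport_bump_smul hR f) hcont ?_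
    filter_upwards [(isOpen_lt continuous_norm continuous_const).mem_nhds hx] with z hz
    exact hnull hz

lemma tameAt_of_monogenic (hn : 2 ≤ n) {f : V n → Cl n} {x : V n}
    (hf : ∀ᶠ y in 𝓝 x, DifferentiableAt ℝ f y ∧ dirac f y = 0) : TameAt (diracOp n) f x := by
  have h1 : Tendsto (fun y : V n => y + x) (𝓝 0) (𝓝 x) :=
    (continuous_id.add continuous_const).tendsto' _ _ (zero_add x)
  have h2 : TameAt (diracOp n) (fun y => f (y + x)) 0 := by
    refine tameAt_of_monogenic_zero hn ?_
    filter_upwards [h1.eventually hf] with y hy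
    refine ⟨DifferentiableAt.comp (g := f) y hy.1 (differentiableAt_id.add_const x), ?_⟩
    simp only [dirac, partialDeriv, fderiv_comp_add_right (𝕜 := ℝ) (f := f) x] at hy ⊢
    exact hy.2
  have h3 : TameAt (diracOp n) (fun y => f (y + x)) (x + -x) := by rwa [add_neg_cancel]
  simpa using h3.comp_add_right

lemma TameAt.monogenic {f : V n → Cl n} {x : V n} (h : TameAt (diracOp n) f x) :
    DifferentiableAt ℝ f x ∧ dirac f x = 0 :=
  ⟨h.contDiffAt.differentiableAt (by simp), by rw [← diracOp_op]; exact h.null⟩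

end Dirac

end CliffordCylinder

open scoped Topology
namespace CliffordCylinder
open Metric Filter MeasureTheory

/-! ### The Laplacian -/

section Laplace

variable {n : ℕ}

/-- The Laplacian. -/
noncomputable def laplaceOp (n : ℕ) : DiffOp n 2 where
  op := ∑ i, ContinuousMultilinearMap.apply ℝ (fun _ : Fin 2 => V n) (Cl n) fun _ => stdVec i
  op_mul T c := by
    simp [Finset.sum_mul]

lemma laplaceOp_app (f : V n → Cl n) (x : V n) :
    (laplaceOp n).app f x = ∑ i, fderiv ℝ (fderiv ℝ f) x (stdVec i) (stdVec i) := by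
  simp [DiffOp.app, laplaceOp, iteratedFDeriv_two_apply]

lemma laplaceOp_app_eq_laplacian (f : V n → Cl n) (x : V n) :
    (laplaceOp n).app f x = Laplacian.laplacian f x := by
  rw [laplaceOp_app, InnerProductSpace.laplacian_eq_iteratedFDeriv_orthonormalBasis f
    (EuclideanSpace.basisFun (Fin n) ℝ)]
  simp [iteratedFDeriv_two_apply, stdVec]

lemma hasFDerivAt_partialDeriv {f : V n → Cl n} {x : V n} (hf : ContDiffAt ℝ 2 f x) (i : Fin n) :
    HasFDerivAt (partialDeriv i f) ((ContinuousLinearMap.apply ℝ (Cl n) (stdVec i)).comp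
      (fderiv ℝ (fderiv ℝ f) x)) x :=
  (ContinuousLinearMap.apply ℝ (Cl n) (stdVec i)).hasFDerivAt.comp x
    ((hf.fderiv_right (m := 1) (by norm_num)).differentiableAt one_ne_zero).hasFDerivAt

/-- The second derivative is symmetric and the generators anticommute, so adding the double sum to
its transpose leaves the diagonal only. -/
lemma dirac_dirac {f : V n → Cl n} {x : V n} (hf : ContDiffAt ℝ 2 f x) :
    dirac (dirac f) x = -(laplaceOp n).app f x := by
  have hD : HasFDerivAt (dirac f) (∑ i, (mulL (e i)).comp
      ((ContinuousLinearMap.apply ℝ (Cl n) (stdVec i)).comp (fderiv ℝ (fderiv ℝ f) x))) x :=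
    HasFDerivAt.fun_sum fun i _ => (mulL (e i)).hasFDerivAt.comp x (hasFDerivAt_partialDeriv hf i)
  have hsymm : ∀ i k, fderiv ℝ (fderiv ℝ f) x (stdVec i) (stdVec k) =
      fderiv ℝ (fderiv ℝ f) x (stdVec k) (stdVec i) := fun i k =>
    (hf.isSymmSndFDerivAt (by simp)).eq _ _
  set s : Fin n → Fin n → Cl n := fun i k => fderiv ℝ (fderiv ℝ f) x (stdVec i) (stdVec k) with hs
  have h1 : dirac (dirac f) x = ∑ i, ∑ k, e i * (e k * s i k) := by
    change ∑ i, e i * fderiv ℝ (dirac f) x (stdVec i) = _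
    rw [hD.fderiv]
    refine Finset.sum_congr rfl fun i _ => ?_
    simp [Finset.mul_sum, hs, _root_.sum_apply]
  have h2 : dirac (dirac f) x = ∑ i, ∑ k, e k * (e i * s i k) := by
    rw [h1, Finset.sum_comm]
    refine Finset.sum_congr rfl fun i _ => Finset.sum_congr rfl fun k _ => ?_
    simp only [hs, hsymm i k]
  have h3 : dirac (dirac f) x + dirac (dirac f) x = ∑ i, -(s i i + s i i) := by
    nth_rewrite 1 [h1]
    rw [h2, ← Finset.sum_add_distrib]
    refine Finset.sum_congr rfl fun i _ => ?_
    rw [← Finset.sum_add_distrib, Finset.sum_eq_single i]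
    · rw [← mul_assoc, e_mul_self, neg_one_mul, neg_add]
    · intro k _ hk
      rw [← mul_assoc, ← mul_assoc, e_mul_swap hk, neg_mul, add_neg_cancel]
    · simp
  rw [Finset.sum_neg_distrib, Finset.sum_add_distrib, ← two_smul ℝ, ← two_smul ℝ, ← smul_neg] at h3
  rw [laplaceOp_app]
  exact smul_right_injective _ two_ne_zero h3

lemma dirac_const_smul {f : V n → Cl n} {x : V n} (c : ℝ) :
    dirac (fun y => c • f y) x = c • dirac f x := by
  have h : fderiv ℝ (fun y => c • f y) x = c • fderiv ℝ f x := by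
    change fderiv ℝ (c • f) x = _
    rw [fderiv_const_smul_field c]; rfl
  simp [dirac, partialDeriv, h, Finset.smul_sum]

lemma dirac_H (hn : 2 ≤ n) {z : V n} (hz : z ≠ 0) : dirac H z = (-((n : ℝ) - 2)) • G z := by
  have hpos : (0 : ℝ) < 0 + ‖z‖ ^ 2 := by have := norm_pos_iff.2 hz; positivity
  have h : ∀ i, partialDeriv i (regH 0) z * e i = e i * partialDeriv i (regH 0) z := fun i => by
    rw [partialDeriv_regH hpos]
    simp
  have h2 := rdirac_regH hpos
  rw [rdirac, Finset.sum_congr rfl fun i _ => h i, regG_zero] at h2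
  rw [← h2, ← funext (regH_zero hn)]
  rfl

lemma analyticAt_H {z : V n} (hz : z ≠ 0) : AnalyticAt ℝ (H : V n → Cl n) z := by
  have h1 : ContDiffAt ℝ ⊤ (fun x : V n => (‖x‖ ^ (n - 2))⁻¹) z :=
    ((contDiffAt_norm ℝ hz).pow _).inv (pow_ne_zero _ (norm_ne_zero_iff.2 hz))
  have h2 : (H : V n → Cl n) = fun x => (‖x‖ ^ (n - 2))⁻¹ • (1 : Cl n) := by
    funext x; rw [H, Algebra.algebraMap_eq_smul_one]
  rw [h2]
  exact (ContDiffAt.smul (f := fun x : V n => (‖x‖ ^ (n - 2))⁻¹) (g := fun _ => (1 : Cl n)) h1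
    contDiffAt_const).analyticAt

lemma H_neg (z : V n) : (H (-z) : Cl n) = H z := by
  simp [H]

lemma H_smul {t : ℝ} (ht : 0 < t) (z : V n) : (H (t • z) : Cl n) = (t ^ (n - 2))⁻¹ • H z := by
  simp only [H, norm_smul, Real.norm_eq_abs, abs_of_pos ht, Algebra.algebraMap_eq_smul_one,
    smul_smul]
  rw [mul_pow, mul_inv]

/-- The Laplacian is minus the square of the Dirac operator, and `dirac H` is a multiple of the
monogenic function `G`. -/
lemma laplace_H (hn : 2 ≤ n) {z : V n} (hz : z ≠ 0) : (laplaceOp n).app H z = 0 := by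
  have h1 : dirac H =ᶠ[𝓝 z] fun y => (-((n : ℝ) - 2)) • G y := by
    filter_upwards [isOpen_ne.mem_nhds hz] with y hy using dirac_H hn hy
  have h2 := dirac_dirac (((analyticAt_H hz).contDiffAt (n := ⊤)).of_le le_top)
  rw [dirac_congr h1, dirac_const_smul, dirac_G hz, smul_zero] at h2
  exact neg_eq_zero.1 h2.symm

lemma contDiffAt_two_of_smooth {f : V n → Cl n} {x : V n}
    (hf : ContDiffAt ℝ ((⊤ : ℕ∞) : WithTop ℕ∞) f x) : ContDiffAt ℝ 2 f x :=
  hf.of_le two_le_infty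

lemma sub_two_pos (hn : 3 ≤ n) : (0 : ℝ) < (n : ℝ) - 2 := by
  have : (3 : ℝ) ≤ n := by exact_mod_cast hn
  linarith

lemma laplace_representation (hn : 3 ≤ n) {F : V n → Cl n} (hF : ContDiff ℝ 2 F)
    (hc : HasCompactSupport F) {x : V n} (hx : ∀ᶠ y in 𝓝 x, (laplaceOp n).app F y = 0) :
    (-(((n : ℝ) - 2) * poissonMass n)) • F x = ∫ y, H (x - y) * (laplaceOp n).app F y := by
  have h1 : ∀ y, dirac (dirac F) y = -(laplaceOp n).app F y := fun y => dirac_dirac hF.contDiffAt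
  have h2 := dirac_dirac_representation hn hF hc (x := x) (by
    filter_upwards [hx] with y hy
    rw [h1, hy, neg_zero])
  simp only [h1, mul_neg, integral_neg] at h2
  rw [neg_smul, h2, neg_neg]

/-- The Green kernel. -/
noncomputable def greenKernel (hn : 3 ≤ n) : FundSol (laplaceOp n) where
  K := H
  N := n - 2
  one_le := by omega
  add_eq := by omega
  analytic z hz := analyticAt_H hz
  hom t ht z := H_smul ht z
  null z hz := laplace_H (by omega) hz
  κ := -(((n : ℝ) - 2) * poissonMass n)
  κ_ne := neg_ne_zero.2 (mul_pos (sub_two_pos hn) (poissonMass_pos (by omega))).ne'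
  rep F hF hc x hx := laplace_representation hn
    (contDiff_iff_contDiffAt.2 fun y => contDiffAt_two_of_smooth hF.contDiffAt) hc hx

/-- The divergence form of the Laplacian. -/
noncomputable def laplaceFlux (n : ℕ) : Flux (laplaceOp n) where
  flux f i := partialDeriv i f
  congr i h := by rw [partialDeriv, partialDeriv, h.fderiv_eq]
  comp_add f v x i := by
    simp only [partialDeriv, fderiv_comp_add_right (𝕜 := ℝ) (f := f) v]
  smooth i hf := (hf.fderiv_right (m := ((⊤ : ℕ∞) : WithTop ℕ∞)) (by simp)).clm_apply
    contDiffAt_const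
  div {f x} hf := by
    rw [laplaceOp_app]
    refine Finset.sum_congr rfl fun i _ => ?_
    rw [partialDeriv, (hasFDerivAt_partialDeriv (contDiffAt_two_of_smooth hf) i).fderiv]
    rfl

lemma tameAt_of_harmonic_zero (hn : 3 ≤ n) {f : V n → Cl n}
    (hf : ∀ᶠ x in 𝓝 0, ContDiffAt ℝ 2 f x ∧ (laplaceOp n).app f x = 0) :
    TameAt (laplaceOp n) f 0 := by
  obtain ⟨R, hR, hb⟩ := Metric.eventually_nhds_iff_ball.1 hf
  have hzero : ∀ {y : V n}, 3 * R / 4 < ‖y‖ →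
      (fun y => bump (n := n) hR y • f y) =ᶠ[𝓝 y] fun _ => 0 := fun {y} hy => by
    filter_upwards [bump_eventually_zero hR hy] with z hz
    rw [hz, zero_smul]
  have hone : ∀ {y : V n}, ‖y‖ < R / 2 →
      (fun y => bump (n := n) hR y • f y) =ᶠ[𝓝 y] f := fun {y} hy => by
    filter_upwards [bump_eventually_one hR hy] with z hz
    rw [hz, one_smul]
  have hball : ∀ {y : V n}, ‖y‖ < R → ContDiffAt ℝ 2 f y ∧ (laplaceOp n).app f y = 0 :=
    fun {y} hy => hb y (by simpa using hy)
  have hC : ContDiff ℝ 2 fun y => bump (n := n) hR y • f y := by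
    rw [contDiff_iff_contDiffAt]
    intro y
    rcases lt_or_ge ‖y‖ R with hy | hy
    · exact (ContDiffBump.contDiff _).contDiffAt.smul (hball hy).1
    · exact (contDiffAt_const (c := (0 : Cl n))).congr_of_eventuallyEq (hzero (by linarith))
  have hnull : ∀ {y : V n}, ‖y‖ < R / 2 →
      (laplaceOp n).app (fun y => bump (n := n) hR y • f y) y = 0 :=
    fun {y} hy => by rw [DiffOp.app_congr (hone hy), (hball (by linarith)).2]
  refine (greenKernel hn).tameAt_of_representation (κ := -(((n : ℝ) - 2) * poissonMass n))
    (R := R) (greenKernel hn).κ_ne hR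
    ((laplaceOp n).op.continuous.comp (hC.continuous_iteratedFDeriv le_rfl))
    (fun y hy => hnull hy) (fun y hy => ?_) fun x hx => ?_
  · show (laplaceOp n).app (fun y => bump (n := n) hR y • f y) y = 0
    rw [DiffOp.app_congr (hzero (by linarith)), DiffOp.app_zero]
  · rw [← (hone hx).self_of_nhds]
    refine laplace_representation hn hC (hasCompactSupport_bump_smul hR f) ?_
    filter_upwards [(isOpen_lt continuous_norm continuous_const).mem_nhds hx] with z hz
    exact hnull hz

lemma tameAt_of_harmonic (hn : 3 ≤ n) {f : V n → Cl n} {x : V n}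
    (hf : InnerProductSpace.HarmonicAt f x) : TameAt (laplaceOp n) f x := by
  have hev : ∀ᶠ y in 𝓝 x, ContDiffAt ℝ 2 f y ∧ (laplaceOp n).app f y = 0 := by
    filter_upwards [hf.1.eventually (by simp), hf.2] with y h1 h2
    exact ⟨h1, by rw [laplaceOp_app_eq_laplacian, h2]; rfl⟩
  have h1 : Tendsto (fun y : V n => y + x) (𝓝 0) (𝓝 x) :=
    (continuous_id.add continuous_const).tendsto' _ _ (zero_add x)
  have h2 : TameAt (laplaceOp n) (fun y => f (y + x)) 0 := by
    refine tameAt_of_harmonic_zero hn ?_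
    filter_upwards [h1.eventually hev] with y hy
    refine ⟨ContDiffAt.comp (g := f) y hy.1 (contDiffAt_id.add contDiffAt_const), ?_⟩
    rw [DiffOp.app, iteratedFDeriv_comp_add_right]
    exact hy.2
  have h3 : TameAt (laplaceOp n) (fun y => f (y + x)) (x + -x) := by rwa [add_neg_cancel]
  simpa using h3.comp_add_right

lemma TameAt.harmonic {f : V n → Cl n} {x : V n} (h : TameAt (laplaceOp n) f x) :
    InnerProductSpace.HarmonicAt f x := by
  refine ⟨contDiffAt_two_of_smooth h.contDiffAt, ?_⟩
  filter_upwards [h.eventually] with y hy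
  rw [← laplaceOp_app_eq_laplacian]
  exact hy.null

end Laplace

/-! ### The functions `ε` -/

section Eps

variable {n k l : ℕ} {ω : Fin k → V n}

lemma epsFamily_mono (hn : 2 ≤ n) (hkn : k ≤ n) (hlk : l ≤ k) (hω : LinearIndependent ℝ ω) {b : V n}
    (hb : k = n → l = 0 → b ∉ lattice ω) :
    ∃ S : Set (V n), EpsFamily (cauchyKernel hn).toKernel ω l S (epsMono ω l b) ∧
      (S = ∅ ∨ k = n ∧ l = 0) := by
  by_cases h : k = n ∧ l = 0
  · obtain ⟨rfl, rfl⟩ := h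
    have he : epsMono ω 0 b = fun m => if m = 0 then
        fun x => weierstrassSum G ω x - weierstrassSum G ω (x - b)
        else removePeriods ω (multiDeriv m (weierstrassSum G ω)) := by
      funext m
      simp [epsMono]
    rw [he]
    exact ⟨_, epsFamily_torus_first hω (T := (cauchyKernel hn).toKernel)
      (fun z hz x => Kernel.app_taylor2_first _ hz x) G_neg (hb rfl rfl), Or.inr ⟨rfl, rfl⟩⟩
  · refine ⟨∅, ?_, Or.inl rfl⟩
    have he : epsMono ω l b = fun m => multiDeriv m (cotMono ω l) := by
      funext m
      simp [epsMono, h]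
    rw [he]
    refine CotLike.epsFamily hω ?_
    rw [cotMono]
    split_ifs with h1 h2
    · exact cotLike_directSum hω (T := (cauchyKernel hn).toKernel)
        (show k < n - 1 by omega)
    · exact cotLike_coupledSum_first hω (cauchyKernel hn).toKernel G_neg (by omega)
    -- Here `k = n`, hence `l ≥ 1`, and the regrouped terms decay with order `n + 3`.
    · exact cotLike_regroupedSum (cauchyKernel hn).toKernel (by omega) hlk
        (show k < n - 1 + 4 by omega) hω

lemma epsFamily_harm (hn : 3 ≤ n) (hkn : k ≤ n) (hlk : l ≤ k) (hω : LinearIndependent ℝ ω)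
    {b₂ b₃ b₄ : V n} (hb : k = n → l = 0 → Adequate ω b₂ b₃ b₄) :
    ∃ S : Set (V n), EpsFamily (greenKernel hn).toKernel ω l S (epsHarm ω l b₂ b₃ b₄) ∧
      (S = ∅ ∨ k = n ∧ l = 0) := by
  by_cases h : k = n ∧ l = 0
  · obtain ⟨rfl, rfl⟩ := h
    obtain ⟨⟨hb₂, hb₃, hb₄⟩, -, hadd⟩ := hb rfl rfl
    have he : epsHarm ω 0 b₂ b₃ b₄ = fun m => if m = 0 then
        fun x => weierstrassSum H ω x + weierstrassSum H ω (x - b₂)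
          - weierstrassSum H ω (x - b₃) - weierstrassSum H ω (x - b₄)
        else removePeriods ω (multiDeriv m (weierstrassSum H ω)) := by
      funext m
      simp [epsHarm]
    rw [he]
    exact ⟨_, epsFamily_torus_second hω (T := (greenKernel hn).toKernel)
      (fun z hz x => Kernel.app_taylor2_second _ hz x) hb₂ hb₃ hb₄ hadd, Or.inr ⟨rfl, rfl⟩⟩
  · refine ⟨∅, ?_, Or.inl rfl⟩
    have he : epsHarm ω l b₂ b₃ b₄ = fun m => multiDeriv m (cotHarm ω l) := by
      funext m
      simp [epsHarm, h]
    rw [he]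
    refine CotLike.epsFamily hω ?_
    rw [cotHarm]
    split_ifs with h1 h2
    · exact cotLike_directSum hω (T := (greenKernel hn).toKernel)
        (show k < n - 2 by omega)
    · subst h2
      exact cotLike_coupledSum_second hω (greenKernel hn).toKernel H_neg (by omega)
    -- Here `l ≥ 1`, and the regrouped terms decay with order `n + 2`.
    · exact cotLike_regroupedSum (greenKernel hn).toKernel (by omega) hlk
        (show k < n - 2 + 4 by omega) hω

/-- On the torus with the trivial bundle, a function without further singularities has no residue. -/
lemma exists_laurentCoeff_zero {j : ℕ} {Λ : DiffOp n j} (T : FundSol Λ) (Fl : Flux Λ)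
    (hω : LinearIndependent ℝ ω) {S : Set (V n)} (hS : S = ∅ ∨ k = n ∧ l = 0) (a : V n)
    {f : V n → Cl n} (hf : ∀ x, proj ω x ∈ ({proj ω a}ᶜ : Set (Cylinder ω)) → TameAt Λ f x)
    (hq : IsSection ω l {proj ω a}ᶜ f) :
    S = ∅ ∨ ∃ R₀ > 0, ∀ R (hR : 0 < R), R ≤ R₀ →
      T.laurentCoeff hR (fun x => f (x + a)) 0 = 0 := by
  rcases hS with hS | ⟨rfl, rfl⟩
  · exact Or.inl hS
  refine Or.inr (laurentCoeff_zero_eq_zero T Fl hω (fun x hx => ?_) fun x hx i => ?_)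
  · exact (hf _ fun h => hx ((proj_add_eq_iff x a).1 h)).comp_add_right
  · have h := hq (x + a) (fun h => hx ((proj_add_eq_iff x a).1 h)) (Pi.single i 1)
    rw [latPt_single, sgn_zero_left, one_smul] at h
    show f (x + ω i + a) = f (x + a)
    rw [← h, add_right_comm]

lemma isOpen_preimage_sdiff (hω : LinearIndependent ℝ ω) {U' : Set (Cylinder ω)} (hU' : IsOpen U')
    (a : V n) : IsOpen (proj ω ⁻¹' (U' \ {proj ω a})) := by
  have h1 : proj ω ⁻¹' (U' \ {proj ω a}) =
      proj ω ⁻¹' U' ∩ (fun x => x - a) ⁻¹' (lattice ω : Set (V n))ᶜ := by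
    ext x
    have := proj_add_eq_iff (ω := ω) (x - a) a
    rw [sub_add_cancel] at this
    simp [this]
  rw [h1]
  exact (hU'.preimage QuotientAddGroup.continuous_mk).inter
    ((isClosed_lattice hω).isOpen_compl.preimage (continuous_id.sub continuous_const))

lemma tameAt_of_leftMonogenicOn (hn : 2 ≤ n) {f : V n → Cl n} {O : Set (V n)} (hO : IsOpen O)
    (hf : LeftMonogenicOn f O) : ∀ x ∈ O, TameAt (diracOp n) f x := fun x hx =>
  tameAt_of_monogenic hn (by filter_upwards [hO.mem_nhds hx] with y hy using hf y hy)

end Eps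

end CliffordCylinder

-- Laurent expansions on cylinders and tori.

open CliffordCylinder in
theorem mainTheorem7 {n k l : ℕ} (hk : 1 ≤ k) (hkn : k ≤ n) (hlk : l ≤ k)
    (ω : Fin k → V n) (hω : LinearIndependent ℝ ω) (a : V n) :
    -- the monogenic case
    (2 ≤ n → ∀ b : V n, (k = n → l = 0 → b ∉ lattice ω) →
      -- near an isolated singularity
      (∀ (U' : Set (Cylinder ω)) (f : V n → Cl n), IsOpen U' → proj ω a ∈ U' →
        IsMonogenicSection ω l (U' \ {proj ω a}) f →
        ∃ (c : (Fin n → ℕ) → Cl n) (N' : Set (Cylinder ω)) (φ : V n → Cl n),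
          IsOpen N' ∧ 0 ∈ N' ∧ (∀ y' ∈ N', y' + proj ω a ∈ U') ∧
          IsMonogenicSection ω l N' φ ∧
          Filter.Tendsto (fun x => φ (x - a)) (𝓝[≠] a) (𝓝 (φ 0)) ∧
          LaurentOn (epsMono ω l b) a c φ f {x | proj ω (x - a) ∈ N' \ {0}}) ∧
      -- no further singularities
      (∀ f : V n → Cl n, IsMonogenicSection ω l {proj ω a}ᶜ f →
        ∃ (c : (Fin n → ℕ) → Cl n) (φ : V n → Cl n),
          IsMonogenicSection ω l Set.univ φ ∧
          Filter.Tendsto (fun x => φ (x - a)) (𝓝[≠] a) (𝓝 (φ 0)) ∧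
          LaurentOn (epsMono ω l b) a c φ f {x | proj ω x ≠ proj ω a})) ∧
    -- the harmonic case
    (3 ≤ n → ∀ b₂ b₃ b₄ : V n, (k = n → l = 0 → Adequate ω b₂ b₃ b₄) →
      -- near an isolated singularity
      (∀ (U' : Set (Cylinder ω)) (f : V n → Cl n), IsOpen U' → proj ω a ∈ U' →
        IsHarmonicSection ω l (U' \ {proj ω a}) f →
        ∃ (c : (Fin n → ℕ) → Cl n) (N' : Set (Cylinder ω)) (φ : V n → Cl n),
          IsOpen N' ∧ 0 ∈ N' ∧ (∀ y' ∈ N', y' + proj ω a ∈ U') ∧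
          IsHarmonicSection ω l N' φ ∧
          Filter.Tendsto (fun x => φ (x - a)) (𝓝[≠] a) (𝓝 (φ 0)) ∧
          LaurentOn (epsHarm ω l b₂ b₃ b₄) a c φ f {x | proj ω (x - a) ∈ N' \ {0}}) ∧
      -- no further singularities
      (∀ f : V n → Cl n, IsHarmonicSection ω l {proj ω a}ᶜ f →
        ∃ (c : (Fin n → ℕ) → Cl n) (φ : V n → Cl n),
          IsHarmonicSection ω l Set.univ φ ∧
          Filter.Tendsto (fun x => φ (x - a)) (𝓝[≠] a) (𝓝 (φ 0)) ∧
          LaurentOn (epsHarm ω l b₂ b₃ b₄) a c φ f {x | proj ω x ≠ proj ω a})) := by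
  refine ⟨fun hn b hb => ?_, fun hn b₂ b₃ b₄ hb => ?_⟩
  · obtain ⟨S, hε, hS⟩ := epsFamily_mono hn hkn hlk hω hb
    refine ⟨fun U' f hU' ha hf => ?_, fun f hf => ?_⟩
    · obtain ⟨c, N', Φ, hN', h0, hU, hΦ, hlim, hsum⟩ := hε.laurent_local hω a hU' ha
        (tameAt_of_leftMonogenicOn hn (isOpen_preimage_sdiff hω hU' a) hf.2) hf.1
      exact ⟨c, N', Φ, hN', h0, hU, ⟨hΦ.1, fun x hx => (hΦ.2 x hx).monogenic⟩, hlim, hsum⟩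
    · have hO := isOpen_preimage_sdiff hω isOpen_univ a
      rw [← Set.compl_eq_univ_sdiff] at hO
      have ht := tameAt_of_leftMonogenicOn hn hO hf.2
      obtain ⟨c, Φ, hΦ, hlim, hsum⟩ := hε.laurent_global hω a ht hf.1
        (exists_laurentCoeff_zero _ (diracFlux n) hω hS a ht hf.1)
      exact ⟨c, Φ, ⟨hΦ.1, fun x _ => (hΦ.2 x).monogenic⟩, hlim, hsum⟩
  · obtain ⟨S, hε, hS⟩ := epsFamily_harm hn hkn hlk hω hb
    refine ⟨fun U' f hU' ha hf => ?_, fun f hf => ?_⟩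
    · obtain ⟨c, N', Φ, hN', h0, hU, hΦ, hlim, hsum⟩ := hε.laurent_local hω a hU' ha
        (fun x hx => tameAt_of_harmonic hn (hf.2 x hx)) hf.1
      exact ⟨c, N', Φ, hN', h0, hU, ⟨hΦ.1, fun x hx => (hΦ.2 x hx).harmonic⟩, hlim, hsum⟩
    · have ht : ∀ x, proj ω x ∈ ({proj ω a}ᶜ : Set (Cylinder ω)) → TameAt (laplaceOp n) f x :=
        fun x hx => tameAt_of_harmonic hn (hf.2 x hx)
      obtain ⟨c, Φ, hΦ, hlim, hsum⟩ := hε.laurent_global hω a ht hf.1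
        (exists_laurentCoeff_zero _ (laplaceFlux n) hω hS a ht hf.1)
      exact ⟨c, Φ, ⟨hΦ.1, fun x _ => (hΦ.2 x).harmonic⟩, hlim, hsum⟩
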